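/- Let $X_1,\dots,X_n\in\mathbb{R}^{p_1\times p_2}$, $y\in\mathbb{R}^n$, $\lambda>0$, $\langle A,B\rangle=\operatorname{trace}(A^\top B)$, and let $\|B\|_*=\sum_{j\le\min(p_1,p_2)}\sigma_j(B)$ be the nuclear norm. Suppose that $\hat B$ is the unique minimizer of $$P(B)=\tfrac12\sum_{j=1}^n(y_j-\langle X_j,B\rangle)^2+\lambda\|B\|_*,$$ and let $m=\operatorname{rank}(\hat B)$. Then there are orthogonal matrices $\hat U\in\mathbb{R}^{p_1\times p_1}$, $\hat V\in\mathbb{R}^{p_2\times p_2}$, with columns $\hat u_k$, $\hat v_l$, that give at the same time singular value decompositions $$\hat B=\hat U\operatorname{diag}[\hat\sigma]\hat V^\top,\qquad \frac1\lambda\sum_{j=1}^n(y_j-\langle X_j,\hat B\rangle)X_j=\hat U\operatorname{diag}[g]\hat V^\top,$$ with $\hat\sigma_j,g_j\ge0$ and $\hat\sigma_j\ne0$ exactly for $j\le m$ (the second matrix is the subgradient of $\|\cdot\|_*$ at $\hat B$ in the optimality condition). Fix any such decomposition, and assume that $g_j<1$ for every $j\le\min(p_1,p_2)$ with $\hat\sigma_j=0$.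 For $\varepsilon>0$ let $R_\varepsilon(B)=\sum_{j\le\min(p_1,p_2)}\sqrt{\sigma_j(B)^2+\varepsilon^2}$. The function $P_\varepsilon(B)=\frac12\sum_j(y_j-\langle X_j,B\rangle)^2+\lambda R_\varepsilon(B)$ has a minimizer. Let $\hat B_\varepsilon$ be a minimizer of $P_\varepsilon$, and let $$\operatorname{vec}\tilde B^{/i}_\varepsilon=\operatorname{vec}\hat B_\varepsilon+\Big[\sum_{j\ne i}\operatorname{vec}(X_j)\operatorname{vec}(X_j)^\top+\lambda\nabla^2R_\varepsilon(\hat B_\varepsilon)\Big]^{-1}\operatorname{vec}(X_i)\,(\langle X_i,\hat B_\varepsilon\rangle-y_i)$$ be the approximate leave-$i$-out estimate of the smoothed problem (one Newton step from $\hat B_\varepsilon$); the matrix in brackets is invertible. Let $E=\{(k,l):k\le m\text{ or }l\le m\}\subseteq\{1,\dots,p_1\}\times\{1,\dots,p_2\}$, which has $mp_1+mp_2-m^2$ elements, let $\mathcal X_E$ be the $n\times|E|$ matrix with entries $\mathcal X_{j,kl}=\hat u_k^\top X_j\hat v_l$, and let $\mathcal G$ be the $|E|\times|E|$ matrix with,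 for $(k,l),(s,t)\in E$, $$\mathcal G_{kl,st}=\begin{cases} 0 & s=t=k=l\le m,\\ \frac1{\hat\sigma_s+\hat\sigma_t} & s\ne t\le m,\ s\le m,\ (k,l)=(s,t),\\ \frac1{\hat\sigma_s} & s\le m<t,\ (k,l)=(s,t),\\ \frac1{\hat\sigma_t} & t\le m<s,\ (k,l)=(s,t),\\ -\frac1{\hat\sigma_s+\hat\sigma_t} & s\ne t\le m,\ s\le m,\ (k,l)=(t,s),\\ -\frac{g_t}{\hat\sigma_s} & s\le m<t,\ (k,l)=(t,s),\\ -\frac{g_s}{\hat\sigma_t} & t\le m<s,\ (k,l)=(t,s),\\ 0 & \text{otherwise.} \end{cases}$$ Then $\mathcal X_E^\top\mathcal X_E+\lambda\mathcal G$ is invertible, and with $H=\mathcal X_E[\mathcal X_E^\top\mathcal X_E+\lambda\mathcal G]^{-1}\mathcal X_E^\top$, for every $i$ with $H_{ii}\ne1$, $$\langle X_i,\tilde B^{/i}_\varepsilon\rangle\to\langle X_i,\hat B\rangle+\frac{H_{ii}}{1-H_{ii}}\big(\langle X_i,\hat B\rangle-y_i\big)\qquad\text{as }\varepsilon\downarrow0.$$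 -/

import Mathlib

open Filter Topology

noncomputable section

namespace NuclearALO

variable {n p₁ p₂ : ℕ}

/-- The trace inner product `⟨A, B⟩ = trace (Aᵀ B)` of two real `p₁ × p₂` matrices. -/
def mInner (A B : Matrix (Fin p₁) (Fin p₂) ℝ) : ℝ := (A.transpose * B).trace

/-- The singular values of a real matrix, in decreasing order and indexed from `0`. -/
def sv (B : Matrix (Fin p₁) (Fin p₂) ℝ) (j : ℕ) : ℝ :=
  (Matrix.toEuclideanLin B).singularValues j

/-- The unitarily invariant penalty `∑ r (σ_j)`, summed over the `min p₁ p₂` singular values. -/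
def spectralPenalty (r : ℝ → ℝ) (B : Matrix (Fin p₁) (Fin p₂) ℝ) : ℝ :=
  ∑ j ∈ Finset.range (min p₁ p₂), r (sv B j)

/-- The nuclear norm: the sum of the singular values. -/
def nuclearNorm (B : Matrix (Fin p₁) (Fin p₂) ℝ) : ℝ := spectralPenalty (fun x => x) B

/-- The smoothed nuclear norm `∑ √(σ_j² + ε²)`. -/
def smoothNuclear (ε : ℝ) (B : Matrix (Fin p₁) (Fin p₂) ℝ) : ℝ :=
  spectralPenalty (fun x => Real.sqrt (x ^ 2 + ε ^ 2)) B

/-- Least squares with a penalty: `½ ∑ (y_j - ⟨X_j, B⟩)² + lam * R B`. -/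
def objective (X : Fin n → Matrix (Fin p₁) (Fin p₂) ℝ) (y : Fin n → ℝ) (lam : ℝ)
    (R : Matrix (Fin p₁) (Fin p₂) ℝ → ℝ) (B : Matrix (Fin p₁) (Fin p₂) ℝ) : ℝ :=
  (1 / 2) * ∑ j, (y j - mInner (X j) B) ^ 2 + lam * R B

/-- Vectorization of a matrix. -/
def vec (B : Matrix (Fin p₁) (Fin p₂) ℝ) : Fin p₁ × Fin p₂ → ℝ := fun kl => B kl.1 kl.2

/-- The Hessian matrix of `R` at `B`: the second partial derivatives in the matrix entries. -/
def hessian (R : Matrix (Fin p₁) (Fin p₂) ℝ → ℝ) (B : Matrix (Fin p₁) (Fin p₂) ℝ) :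
    Matrix (Fin p₁ × Fin p₂) (Fin p₁ × Fin p₂) ℝ :=
  Matrix.of fun kl st =>
    deriv (fun a : ℝ => deriv (fun b : ℝ =>
      R (B + a • Matrix.single kl.1 kl.2 (1 : ℝ) + b • Matrix.single st.1 st.2 (1 : ℝ))) 0) 0

/-- The Hessian at `B` of the leave-`i`-out objective with penalty `lam * R`:
`∑_{j ≠ i} vec X_j (vec X_j)ᵀ + lam ∇²R(B)`. -/
def looHessian (X : Fin n → Matrix (Fin p₁) (Fin p₂) ℝ) (lam : ℝ)
    (R : Matrix (Fin p₁) (Fin p₂) ℝ → ℝ) (i : Fin n) (B : Matrix (Fin p₁) (Fin p₂) ℝ) :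
    Matrix (Fin p₁ × Fin p₂) (Fin p₁ × Fin p₂) ℝ :=
  ∑ j ∈ Finset.univ.erase i, Matrix.vecMulVec (vec (X j)) (vec (X j)) + lam • hessian R B

/-- The approximate leave-`i`-out estimate: one Newton step for the leave-`i`-out objective,
started at the full data estimate `B`:
`B + [∑_{j ≠ i} X_j X_jᵀ + lam ∇²R(B)]⁻¹ X_i (⟨X_i, B⟩ - y_i)`. -/
def aloEstimate (X : Fin n → Matrix (Fin p₁) (Fin p₂) ℝ) (y : Fin n → ℝ) (lam : ℝ)
    (R : Matrix (Fin p₁) (Fin p₂) ℝ → ℝ) (i : Fin n) (B : Matrix (Fin p₁) (Fin p₂) ℝ) :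
    Matrix (Fin p₁) (Fin p₂) ℝ :=
  Matrix.of fun k l =>
    B k l + ((looHessian X lam R i B)⁻¹.mulVec ((mInner (X i) B - y i) • vec (X i))) (k, l)

/-- The `p₁ × p₂` matrix with `s 0, s 1, …` on its diagonal and `0` elsewhere. -/
def rectDiag (p₁ p₂ : ℕ) (s : ℕ → ℝ) : Matrix (Fin p₁) (Fin p₂) ℝ :=
  Matrix.of fun k l => if k.val = l.val then s k.val else 0

/-- `A = U diag[s] Vᵀ` is a (full) singular value decomposition of `A`, with the singular values
listed in any order; only the entries `s j` with `j < min p₁ p₂` matter. -/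
structure IsSVD (A : Matrix (Fin p₁) (Fin p₂) ℝ) (U : Matrix (Fin p₁) (Fin p₁) ℝ)
    (V : Matrix (Fin p₂) (Fin p₂) ℝ) (s : ℕ → ℝ) : Prop where
  left_orthogonal : U ∈ Matrix.orthogonalGroup (Fin p₁) ℝ
  right_orthogonal : V ∈ Matrix.orthogonalGroup (Fin p₂) ℝ
  nonneg : ∀ j < min p₁ p₂, 0 ≤ s j
  eq_mul : A = U * rectDiag p₁ p₂ s * V.transpose

/-- `lam⁻¹ ∑ (y_j - ⟨X_j, B⟩) X_j`, the subgradient of the nuclear norm that appears in the first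
order optimality condition at `B`. -/
def dualMatrix (X : Fin n → Matrix (Fin p₁) (Fin p₂) ℝ) (y : Fin n → ℝ) (lam : ℝ)
    (B : Matrix (Fin p₁) (Fin p₂) ℝ) : Matrix (Fin p₁) (Fin p₂) ℝ :=
  (1 / lam) • ∑ j, (y j - mInner (X j) B) • X j

/-- `U` and `V` give at the same time an SVD `B = U diag[σ] Vᵀ` of `B`, with the `rank B` nonzero
singular values first, and an SVD `U diag[g] Vᵀ` of the subgradient of the nuclear norm in the
optimality condition; `g j` is the subgradient that belongs to the singular value `σ j`. -/
structure IsOptimalSVD (X : Fin n → Matrix (Fin p₁) (Fin p₂) ℝ) (y : Fin n → ℝ) (lam : ℝ)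
    (B : Matrix (Fin p₁) (Fin p₂) ℝ) (U : Matrix (Fin p₁) (Fin p₁) ℝ)
    (V : Matrix (Fin p₂) (Fin p₂) ℝ) (σ g : ℕ → ℝ) : Prop where
  svd : IsSVD B U V σ
  nonzero_first : ∀ j < min p₁ p₂, (σ j ≠ 0 ↔ j < B.rank)
  svd_dual : IsSVD (dualMatrix X y lam B) U V g

/-- The index set `E = {(k, l) : k ≤ m or l ≤ m}` (here the indices start at `0`). -/
abbrev EIdx (p₁ p₂ m : ℕ) : Type := {kl : Fin p₁ × Fin p₂ // kl.1.val < m ∨ kl.2.val < m}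

/-- The columns in `E` of the matrix with entries `u_kᵀ X_j v_l`. -/
def designE (X : Fin n → Matrix (Fin p₁) (Fin p₂) ℝ) (U : Matrix (Fin p₁) (Fin p₁) ℝ)
    (V : Matrix (Fin p₂) (Fin p₂) ℝ) (m : ℕ) : Matrix (Fin n) (EIdx p₁ p₂ m) ℝ :=
  Matrix.of fun j kl => (U.transpose * X j * V) kl.1.1 kl.1.2

/-- The matrix `𝒢`, with rows `(k, l)` and columns `(s, t)` in `E`. -/
def gMatrix (p₁ p₂ m : ℕ) (σ g : ℕ → ℝ) : Matrix (EIdx p₁ p₂ m) (EIdx p₁ p₂ m) ℝ :=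
  Matrix.of fun kl st =>
    let k := kl.1.1.val
    let l := kl.1.2.val
    let s := st.1.1.val
    let t := st.1.2.val
    if k = s ∧ l = t then
      if s = t then 0
      else if s < m ∧ t < m then 1 / (σ s + σ t)
      else if s < m then 1 / σ s
      else 1 / σ t
    else if k = t ∧ l = s then
      if s < m ∧ t < m then -(1 / (σ s + σ t))
      else if s < m then -(g t / σ s)
      else -(g s / σ t)
    else 0

/-- `𝒳_Eᵀ 𝒳_E + lam 𝒢`. -/
def gramE (X : Fin n → Matrix (Fin p₁) (Fin p₂) ℝ) (lam : ℝ) (U : Matrix (Fin p₁) (Fin p₁) ℝ)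
    (V : Matrix (Fin p₂) (Fin p₂) ℝ) (σ g : ℕ → ℝ) (m : ℕ) :
    Matrix (EIdx p₁ p₂ m) (EIdx p₁ p₂ m) ℝ :=
  (designE X U V m).transpose * designE X U V m + lam • gMatrix p₁ p₂ m σ g

/-- `H = 𝒳_E [𝒳_Eᵀ 𝒳_E + lam 𝒢]⁻¹ 𝒳_Eᵀ`. -/
def hatMatrix (X : Fin n → Matrix (Fin p₁) (Fin p₂) ℝ) (lam : ℝ)
    (U : Matrix (Fin p₁) (Fin p₁) ℝ) (V : Matrix (Fin p₂) (Fin p₂) ℝ) (σ g : ℕ → ℝ) (m : ℕ) :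
    Matrix (Fin n) (Fin n) ℝ :=
  designE X U V m * (gramE X lam U V σ g m)⁻¹ * (designE X U V m).transpose

end NuclearALO

end

open NuclearALO

/-!
Write `W = √(Bᵀ B + ε²)`. The smoothed nuclear norm is `tr W` up to a constant
(`smoothNuclear_eq_trace`), its gradient is `Z = B W⁻¹` (`hasDerivAt_smoothNuclear`), and the
derivative `K` of `W` in a direction `D` solves the Sylvester equation `K W + W K = Dᵀ B + Bᵀ D`
(`hasDerivAt_modulus`). The Hessian maps `D` to the derivative `Y = (D - Z K) W⁻¹` of `Z`. The
inverse of `W` blows up as `ε → 0`, but with `T = ε W⁻¹`, which satisfies `Zᵀ Z = 1 - T²`, and its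
derivative `J` the pair `(D, Y)` obeys a system of bilinear equations without inverses
(`IsLinearized`). The identity `⟨D, Y⟩ = tr (Y W Yᵀ) + tr (J W J)` shows that the Hessian is
positive definite (`exists_isLinearized`), so the leave-one-out Hessian is invertible.

The minimizers of the smoothed problems converge to the unique minimizer of the limit problem
(`tendsto_of_isMinOn_objective`). Along them `W` converges to the modulus of the limit, the gradient
`Z` converges because the optimality condition expresses it through the residuals, and `T` converges
because it is the square root of `1 - Zᵀ Z`. No perturbation theory of singular vectors is needed.
The limits satisfy `W T = 0`; diagonalizing `W - T` produces a simultaneous singular value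
decomposition of the minimizer and its subgradient (`exists_simultaneous_svd`), and every such
decomposition diagonalizes `W` and `T` (`exists_isAdapted`).

In diagonal coordinates the limit system can be solved entrywise (`IsStrictPair.solve`): strict
complementarity forces `D` to be supported on `E`, and `Y = 𝒢 D` there. The quadratic form of `𝒢` is
nonnegative, and its kernel consists of directions along which the nuclear norm is affine near the
minimizer. Hence uniqueness of the minimizer makes the Gram matrix invertible (`isUnit_det_gramE`).

The leave-one-out prediction is governed by the solution `D` of the leave-one-out equations with
right-hand side `X_i` (`exists_solution_looHessian`). Scaled to a bounded set, these solutions have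
limit points along ultrafilters, which satisfy the limit equations with right-hand side `s X_i` for
some `s ≥ 0`. They give `⟨X_i, D⟩ (1 - H_ii) = s H_ii`, and `s ≠ 0`, since the homogeneous
equations have only the trivial solution when `H_ii ≠ 1` (`IsAdapted.limit_solution`). Dividing by
`s` yields the claim.
-/

noncomputable section

namespace NuclearALO

open scoped Matrix MatrixOrder

variable {n p₁ p₂ : ℕ}

/-! ### The modulus of a matrix and its trace -/

theorem continuousOn_matrix_sqrt (k : ℕ) :
    ContinuousOn (CFC.sqrt : Matrix (Fin k) (Fin k) ℝ → Matrix (Fin k) (Fin k) ℝ)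
      {A | 0 ≤ A} := by
  open scoped Matrix.Norms.L2Operator in
  exact CFC.continuousOn_sqrt

theorem isClosed_matrix_nonneg (k : ℕ) :
    IsClosed {A : Matrix (Fin k) (Fin k) ℝ | 0 ≤ A} := by
  have h : {A : Matrix (Fin k) (Fin k) ℝ | 0 ≤ A} =
      {A | Aᴴ = A} ∩ ⋂ x : Fin k → ℝ, {A | 0 ≤ star x ⬝ᵥ (A *ᵥ x)} := by
    ext A
    simp only [Matrix.nonneg_iff_posSemidef, Matrix.posSemidef_iff_dotProduct_mulVec,
      Set.mem_ofPred_eq, Set.mem_inter_iff, Set.mem_iInter]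
    rfl
  rw [h]
  refine (isClosed_eq (by fun_prop) continuous_id).inter (isClosed_iInter fun x => ?_)
  exact isClosed_le continuous_const
    (continuous_const.dotProduct (continuous_id.matrix_mulVec continuous_const))

/-- The regularized modulus `√(Bᵀ B + ε²)`, with eigenvalues `√(σ_l² + ε²)`, as a positive
semidefinite square root. At `ε = 0` it is the modulus `|B|`. -/
def modulus (ε : ℝ) (B : Matrix (Fin p₁) (Fin p₂) ℝ) : Matrix (Fin p₂) (Fin p₂) ℝ :=
  CFC.sqrt (Bᵀ * B + ε ^ 2 • (1 : Matrix (Fin p₂) (Fin p₂) ℝ))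

theorem posSemidef_gram_add (ε : ℝ) (B : Matrix (Fin p₁) (Fin p₂) ℝ) :
    (Bᵀ * B + ε ^ 2 • (1 : Matrix (Fin p₂) (Fin p₂) ℝ)).PosSemidef := by
  have h := Matrix.posSemidef_conjTranspose_mul_self B
  rw [Matrix.conjTranspose_eq_transpose_of_trivial] at h
  exact h.add (Matrix.PosSemidef.one.smul (sq_nonneg ε))

theorem modulus_posSemidef (ε : ℝ) (B : Matrix (Fin p₁) (Fin p₂) ℝ) :
    (modulus ε B).PosSemidef :=
  Matrix.nonneg_iff_posSemidef.mp (CFC.sqrt_nonneg _)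

theorem modulus_mul_self (ε : ℝ) (B : Matrix (Fin p₁) (Fin p₂) ℝ) :
    modulus ε B * modulus ε B = Bᵀ * B + ε ^ 2 • 1 :=
  CFC.sqrt_mul_sqrt_self _ (posSemidef_gram_add ε B).nonneg

theorem posSemidef_eq_of_mul_self_eq {k : ℕ} {A W : Matrix (Fin k) (Fin k) ℝ}
    (hA : A.PosSemidef) (hW : W.PosSemidef) (h : A * A = W * W) : A = W := by
  have h1 : CFC.sqrt (W * W) = A := CFC.sqrt_unique h hA.nonneg
  rw [← h1]
  exact CFC.sqrt_unique rfl hW.nonneg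

theorem eq_modulus {ε : ℝ} {B : Matrix (Fin p₁) (Fin p₂) ℝ} {W : Matrix (Fin p₂) (Fin p₂) ℝ}
    (hW : W.PosSemidef) (h : W * W = Bᵀ * B + ε ^ 2 • 1) : W = modulus ε B :=
  posSemidef_eq_of_mul_self_eq hW (modulus_posSemidef ε B) (h.trans (modulus_mul_self ε B).symm)

theorem modulus_posDef {ε : ℝ} (hε : ε ≠ 0) (B : Matrix (Fin p₁) (Fin p₂) ℝ) :
    (modulus ε B).PosDef := by
  have h := Matrix.posSemidef_conjTranspose_mul_self B
  rw [Matrix.conjTranspose_eq_transpose_of_trivial] at h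
  have h2 : (Bᵀ * B + ε ^ 2 • (1 : Matrix (Fin p₂) (Fin p₂) ℝ)).PosDef :=
    Matrix.PosDef.posSemidef_add h (Matrix.PosDef.one.smul (by positivity))
  rw [← modulus_mul_self] at h2
  have h3 := h2.det_pos
  rw [Matrix.det_mul] at h3
  refine (modulus_posSemidef ε B).posDef_iff_isUnit.mpr ?_
  rw [Matrix.isUnit_iff_isUnit_det, isUnit_iff_ne_zero]
  rintro h0
  simp [h0] at h3

theorem continuous_modulus :
    Continuous fun q : ℝ × Matrix (Fin p₁) (Fin p₂) ℝ => modulus q.1 q.2 := by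
  refine (continuousOn_matrix_sqrt p₂).comp_continuous ?_ fun q =>
    (posSemidef_gram_add q.1 q.2).nonneg
  fun_prop

/-- The spectral theorem in matrix form. The operator `A` is kept apart from the matrix `S`, so
that it can be given as `T* T`, whose eigenvalues are the squared singular values by definition. -/
theorem eq_mul_diagonal_eigenvalues_mul {k : ℕ} {S : Matrix (Fin k) (Fin k) ℝ}
    {A : EuclideanSpace ℝ (Fin k) →ₗ[ℝ] EuclideanSpace ℝ (Fin k)} (hA : A.IsSymmetric)
    (hS : A = Matrix.toEuclideanLin S) (hk : Module.finrank ℝ (EuclideanSpace ℝ (Fin k)) = k) :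
    ∃ P : Matrix (Fin k) (Fin k) ℝ, Pᵀ * P = 1 ∧ P * Pᵀ = 1 ∧
      S = P * Matrix.diagonal (hA.eigenvalues hk) * Pᵀ := by
  set b := hA.eigenvectorBasis hk with hb
  have key : ∀ i l, (S *ᵥ (b l).ofLp) i = b l i * hA.eigenvalues hk l := by
    intro i l
    have h1 := hA.apply_eigenvectorBasis hk l
    rw [← hb] at h1
    have h2 := congrArg (fun v : EuclideanSpace ℝ (Fin k) => v i) h1
    rw [mul_comm]
    refine Eq.trans ?_ h2
    rw [hS]
    rfl
  have horth := orthonormal_iff_ite.mp b.orthonormal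
  clear_value b
  let P : Matrix (Fin k) (Fin k) ℝ := Matrix.of fun i l => b l i
  have hP : Pᵀ * P = 1 := by
    ext i l
    simp only [Matrix.mul_apply, Matrix.transpose_apply, Matrix.one_apply, P, Matrix.of_apply]
    rw [← horth i l]
    simp [PiLp.inner_apply, mul_comm]
  have hP' : P * Pᵀ = 1 := mul_eq_one_comm.mp hP
  refine ⟨P, hP, hP', ?_⟩
  have hSP : S * P = P * Matrix.diagonal (hA.eigenvalues hk) := by
    ext i l
    rw [Matrix.mul_diagonal, Matrix.mul_apply]
    exact key i l
  rw [← hSP, Matrix.mul_assoc, hP', Matrix.mul_one]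

theorem exists_gram_eq_diagonal_sv (B : Matrix (Fin p₁) (Fin p₂) ℝ) :
    ∃ P : Matrix (Fin p₂) (Fin p₂) ℝ, Pᵀ * P = 1 ∧ P * Pᵀ = 1 ∧
      Bᵀ * B = P * Matrix.diagonal (fun l : Fin p₂ => sv B l ^ 2) * Pᵀ := by
  set T := Matrix.toEuclideanLin B with hT
  have hn : Module.finrank ℝ (EuclideanSpace ℝ (Fin p₂)) = p₂ := by simp
  have hadj : LinearMap.adjoint T ∘ₗ T = Matrix.toEuclideanLin (Bᵀ * B) := by
    rw [hT, ← Matrix.toEuclideanLin_conjTranspose_eq_adjoint,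
      Matrix.conjTranspose_eq_transpose_of_trivial]
    refine LinearMap.ext fun x => ?_
    simp only [Matrix.toEuclideanLin, LinearMap.comp_apply, Matrix.toLpLin_apply,
      Matrix.mulVec_mulVec]
  have hsv : (fun l : Fin p₂ => sv B l ^ 2) = T.isSymmetric_adjoint_comp_self.eigenvalues hn :=
    funext fun l => T.sq_singularValues_fin hn l
  rw [hsv]
  exact eq_mul_diagonal_eigenvalues_mul T.isSymmetric_adjoint_comp_self hadj hn

theorem trace_modulus (ε : ℝ) (B : Matrix (Fin p₁) (Fin p₂) ℝ) :
    (modulus ε B).trace = ∑ l ∈ Finset.range p₂, Real.sqrt (sv B l ^ 2 + ε ^ 2) := by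
  obtain ⟨P, hP, hP', hB⟩ := exists_gram_eq_diagonal_sv B
  set D : Matrix (Fin p₂) (Fin p₂) ℝ :=
    Matrix.diagonal fun l => Real.sqrt (sv B l ^ 2 + ε ^ 2) with hD
  have hW : P * D * Pᵀ = modulus ε B := by
    apply eq_modulus
    · have : D.PosSemidef := Matrix.PosSemidef.diagonal fun l => Real.sqrt_nonneg _
      simpa [Matrix.conjTranspose_eq_transpose_of_trivial] using this.mul_mul_conjTranspose_same P
    · have h1 : D * D = Matrix.diagonal (fun l : Fin p₂ => sv B l ^ 2) + ε ^ 2 • 1 := by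
        rw [hD, Matrix.diagonal_mul_diagonal, ← Matrix.diagonal_one, ← Matrix.diagonal_smul,
          Matrix.diagonal_add]
        congr 1
        ext l
        rw [Real.mul_self_sqrt (by positivity)]
        simp
      calc P * D * Pᵀ * (P * D * Pᵀ) = P * D * (Pᵀ * P) * D * Pᵀ := by
            simp only [Matrix.mul_assoc]
        _ = P * (D * D) * Pᵀ := by rw [hP]; simp only [Matrix.mul_assoc, Matrix.one_mul]
        _ = _ := by
          rw [h1, hB, Matrix.mul_add, Matrix.add_mul]
          simp [hP']
  rw [← hW, Matrix.trace_mul_comm, ← Matrix.mul_assoc, hP, Matrix.one_mul, hD,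
    Matrix.trace_diagonal, Finset.sum_range]

theorem sv_nonneg (B : Matrix (Fin p₁) (Fin p₂) ℝ) (j : ℕ) : 0 ≤ sv B j :=
  LinearMap.singularValues_nonneg _ _

theorem sv_eq_zero_of_le (B : Matrix (Fin p₁) (Fin p₂) ℝ) {j : ℕ} (hj : p₁ ≤ j) :
    sv B j = 0 := by
  refine (Matrix.toEuclideanLin B).singularValues_eq_zero_iff_le_finrank_range.mpr ?_
  refine (Submodule.finrank_le _).trans ?_
  simpa using hj

/-- The trace of the modulus has `p₂` terms while the penalty has `min p₁ p₂`; each excess term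
belongs to a vanishing singular value and equals `ε`. -/
theorem smoothNuclear_eq_trace {ε : ℝ} (hε : 0 ≤ ε) (B : Matrix (Fin p₁) (Fin p₂) ℝ) :
    smoothNuclear ε B = (modulus ε B).trace - (p₂ - min p₁ p₂ : ℕ) * ε := by
  have h : ∑ l ∈ Finset.range p₂, Real.sqrt (sv B l ^ 2 + ε ^ 2) =
      smoothNuclear ε B + (p₂ - min p₁ p₂ : ℕ) * ε := by
    rw [← Finset.sum_range_add_sum_Ico _ (min_le_right p₁ p₂), smoothNuclear, spectralPenalty]
    congr 1
    rw [Finset.sum_congr rfl (g := fun _ => ε)]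
    · simp
    · intro l hl
      rw [Finset.mem_Ico] at hl
      rw [sv_eq_zero_of_le B (by omega)]
      simp [Real.sqrt_sq hε]
  rw [trace_modulus, h]
  ring

theorem nuclearNorm_eq_smoothNuclear (B : Matrix (Fin p₁) (Fin p₂) ℝ) :
    nuclearNorm B = smoothNuclear 0 B := by
  simp [nuclearNorm, smoothNuclear, spectralPenalty, Real.sqrt_sq, sv_nonneg]

theorem nuclearNorm_eq_trace (B : Matrix (Fin p₁) (Fin p₂) ℝ) :
    nuclearNorm B = (modulus 0 B).trace := by
  rw [nuclearNorm_eq_smoothNuclear, smoothNuclear_eq_trace le_rfl]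
  simp

theorem smoothNuclear_le (B : Matrix (Fin p₁) (Fin p₂) ℝ) {ε : ℝ} (hε : 0 ≤ ε) :
    smoothNuclear ε B ≤ nuclearNorm B + min p₁ p₂ * ε := by
  have : ∀ j ∈ Finset.range (min p₁ p₂), Real.sqrt (sv B j ^ 2 + ε ^ 2) ≤ sv B j + ε := by
    intro j _
    have := sv_nonneg B j
    exact Real.sqrt_le_iff.mpr ⟨by positivity, by nlinarith⟩
  have := Finset.sum_le_sum this
  rw [Finset.sum_add_distrib] at this
  simpa [smoothNuclear, nuclearNorm, spectralPenalty] using this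

theorem nuclearNorm_le_smoothNuclear (B : Matrix (Fin p₁) (Fin p₂) ℝ) (ε : ℝ) :
    nuclearNorm B ≤ smoothNuclear ε B := by
  unfold nuclearNorm smoothNuclear spectralPenalty
  refine Finset.sum_le_sum fun j _ => Real.le_sqrt_of_sq_le ?_
  linarith [sq_nonneg ε]

theorem abs_apply_le_nuclearNorm (B : Matrix (Fin p₁) (Fin p₂) ℝ) (k : Fin p₁) (l : Fin p₂) :
    |B k l| ≤ nuclearNorm B := by
  obtain ⟨P, hP, hP', hB⟩ := exists_gram_eq_diagonal_sv B
  have h1 : (Bᵀ * B).trace = ∑ l ∈ Finset.range p₂, sv B l ^ 2 := by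
    rw [hB, Matrix.trace_mul_comm, ← Matrix.mul_assoc, hP, Matrix.one_mul, Matrix.trace_diagonal,
      Finset.sum_range]
  have h2 : nuclearNorm B = ∑ l ∈ Finset.range p₂, sv B l := by
    rw [nuclearNorm_eq_trace, trace_modulus]
    simp [Real.sqrt_sq, sv_nonneg]
  have h3 : B k l ^ 2 ≤ (Bᵀ * B).trace := by
    rw [Matrix.trace]
    simp only [Matrix.diag_apply, Matrix.mul_apply, Matrix.transpose_apply]
    refine le_trans ?_ (Finset.single_le_sum (f := fun l => ∑ k, B k l * B k l)
      (fun l _ => Finset.sum_nonneg fun k _ => mul_self_nonneg _) (Finset.mem_univ l))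
    rw [sq]
    exact Finset.single_le_sum (f := fun k => B k l * B k l)
      (fun k _ => mul_self_nonneg _) (Finset.mem_univ k)
  refine abs_le_of_sq_le_sq (h3.trans ?_)
    (by rw [h2]; exact Finset.sum_nonneg fun j _ => sv_nonneg B j)
  rw [h1, h2]
  exact Finset.sum_sq_le_sq_sum_of_nonneg fun j _ => sv_nonneg B j

/-! ### Minimizers of the smoothed problems -/

theorem continuous_mInner (A : Matrix (Fin p₁) (Fin p₂) ℝ) : Continuous (mInner A) := by
  unfold mInner
  fun_prop

theorem continuous_smoothNuclear {ε : ℝ} (hε : 0 ≤ ε) :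
    Continuous (smoothNuclear ε : Matrix (Fin p₁) (Fin p₂) ℝ → ℝ) := by
  rw [funext (smoothNuclear_eq_trace hε)]
  have : Continuous fun B : Matrix (Fin p₁) (Fin p₂) ℝ => modulus ε B :=
    continuous_modulus.comp (by fun_prop : Continuous fun B => (ε, B))
  fun_prop

theorem continuous_objective (X : Fin n → Matrix (Fin p₁) (Fin p₂) ℝ) (y : Fin n → ℝ) (lam : ℝ)
    {R : Matrix (Fin p₁) (Fin p₂) ℝ → ℝ} (hR : Continuous R) :
    Continuous (objective X y lam R) := by
  unfold objective
  have := fun j => continuous_mInner (X j)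
  fun_prop

theorem continuous_nuclearNorm :
    Continuous (nuclearNorm : Matrix (Fin p₁) (Fin p₂) ℝ → ℝ) := by
  rw [funext nuclearNorm_eq_smoothNuclear]
  exact continuous_smoothNuclear le_rfl

theorem isCompact_setOf_abs_apply_le (p₁ p₂ : ℕ) (C : ℝ) :
    IsCompact {B : Matrix (Fin p₁) (Fin p₂) ℝ | ∀ k l, |B k l| ≤ C} := by
  have h : IsCompact (Set.pi Set.univ fun _ : Fin p₁ =>
      Set.pi Set.univ fun _ : Fin p₂ => Set.Icc (-C) C) :=
    isCompact_univ_pi fun _ => isCompact_univ_pi fun _ => isCompact_Icc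
  refine (congrArg IsCompact (Set.ext fun B => ?_)).mp h
  exact ⟨fun hB k l => abs_le.mpr (hB k trivial l trivial), fun hB k _ l _ => abs_le.mp (hB k l)⟩

theorem exists_tendsto_of_abs_apply_le {α : Type*} (u : Ultrafilter α)
    {F : α → Matrix (Fin p₁) (Fin p₂) ℝ} (C : ℝ) (h : ∀ᶠ a in u, ∀ k l, |F a k l| ≤ C) :
    ∃ L, Tendsto F u (𝓝 L) := by
  obtain ⟨L, -, hL⟩ := (isCompact_setOf_abs_apply_le p₁ p₂ C).ultrafilter_le_nhds (u.map F)
    (Filter.tendsto_principal.mpr h)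
  exact ⟨L, hL⟩

theorem lam_mul_nuclearNorm_le_objective (X : Fin n → Matrix (Fin p₁) (Fin p₂) ℝ) (y : Fin n → ℝ)
    {lam : ℝ} (hlam : 0 < lam) (ε : ℝ) (B : Matrix (Fin p₁) (Fin p₂) ℝ) :
    lam * nuclearNorm B ≤ objective X y lam (smoothNuclear ε) B := by
  have h1 : lam * nuclearNorm B ≤ lam * smoothNuclear ε B :=
    mul_le_mul_of_nonneg_left (nuclearNorm_le_smoothNuclear B ε) hlam.le
  have h2 : 0 ≤ (1 / 2 : ℝ) * ∑ j, (y j - mInner (X j) B) ^ 2 := by positivity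
  unfold objective
  linarith

theorem exists_isMinOn_objective (X : Fin n → Matrix (Fin p₁) (Fin p₂) ℝ) (y : Fin n → ℝ)
    {lam : ℝ} (hlam : 0 < lam) {ε : ℝ} (hε : 0 ≤ ε) :
    ∃ B, IsMinOn (objective X y lam (smoothNuclear ε)) Set.univ B := by
  set f := objective X y lam (smoothNuclear ε) with hf
  set C := f 0 / lam
  have hfB : ∀ B k l, lam * |B k l| ≤ f B := fun B k l =>
    (mul_le_mul_of_nonneg_left (abs_apply_le_nuclearNorm B k l) hlam.le).trans
      (lam_mul_nuclearNorm_le_objective X y hlam ε B)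
  have h0 : ∀ B, f B ≤ f 0 → B ∈ {B : Matrix (Fin p₁) (Fin p₂) ℝ | ∀ k l, |B k l| ≤ C} := by
    intro B hB k l
    rw [le_div_iff₀ hlam, mul_comm]
    exact (hfB B k l).trans hB
  obtain ⟨B, -, hB⟩ := (isCompact_setOf_abs_apply_le p₁ p₂ C).exists_isMinOn ⟨0, h0 0 le_rfl⟩
    (continuous_objective X y lam (continuous_smoothNuclear hε)).continuousOn
  refine ⟨B, fun A _ => ?_⟩
  rcases le_or_gt (f A) (f 0) with hA | hA
  · exact hB (h0 A hA)
  · exact le_trans (hB (h0 0 le_rfl)) hA.le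

/-- The minimizers of the smoothed problems stay bounded, and every limit point of theirs minimizes
the limit problem, whose minimizer is unique. -/
theorem tendsto_of_isMinOn_objective {X : Fin n → Matrix (Fin p₁) (Fin p₂) ℝ} {y : Fin n → ℝ}
    {lam : ℝ} (hlam : 0 < lam) {Bhat : Matrix (Fin p₁) (Fin p₂) ℝ}
    (hBhat : ∀ B, B ≠ Bhat →
      objective X y lam nuclearNorm Bhat < objective X y lam nuclearNorm B)
    {Bε : ℝ → Matrix (Fin p₁) (Fin p₂) ℝ}
    (hBε : ∀ ε : ℝ, 0 < ε → IsMinOn (objective X y lam (smoothNuclear ε)) Set.univ (Bε ε)) :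
    Tendsto Bε (𝓝[>] 0) (𝓝 Bhat) := by
  rw [tendsto_iff_ultrafilter]
  intro u hu
  have hpos : ∀ᶠ ε in (u : Filter ℝ), 0 < ε := hu self_mem_nhdsWithin
  have hid : Tendsto (fun ε : ℝ => ε) u (𝓝 0) := hu.trans nhdsWithin_le_nhds
  have hone : ∀ᶠ ε in (u : Filter ℝ), ε < 1 := hid.eventually (gt_mem_nhds one_pos)
  set P := objective X y lam nuclearNorm with hP
  have hup : ∀ ε, 0 < ε → objective X y lam (smoothNuclear ε) (Bε ε) ≤
      P Bhat + lam * (min p₁ p₂ * ε) := by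
    intro ε hε
    refine (hBε ε hε (Set.mem_univ Bhat)).trans ?_
    have := mul_le_mul_of_nonneg_left (smoothNuclear_le Bhat hε.le) hlam.le
    simp only [hP, objective]
    linarith
  have hlow : ∀ ε, 0 < ε → P (Bε ε) ≤ P Bhat + lam * (min p₁ p₂ * ε) := by
    intro ε hε
    refine le_trans ?_ (hup ε hε)
    have := mul_le_mul_of_nonneg_left (nuclearNorm_le_smoothNuclear (Bε ε) ε) hlam.le
    simp only [hP, objective]
    linarith
  obtain ⟨L, hL⟩ := exists_tendsto_of_abs_apply_le u (F := Bε)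
    ((P Bhat + lam * (min p₁ p₂ * 1)) / lam) (by
      filter_upwards [hpos, hone] with ε hε hε1 k l
      rw [le_div_iff₀ hlam, mul_comm]
      calc lam * |Bε ε k l| ≤ lam * nuclearNorm (Bε ε) :=
            mul_le_mul_of_nonneg_left (abs_apply_le_nuclearNorm _ k l) hlam.le
        _ ≤ _ := lam_mul_nuclearNorm_le_objective X y hlam ε _
        _ ≤ _ := hup ε hε
        _ ≤ _ := by gcongr)
  have hle : P L ≤ P Bhat := by
    have h1 : Tendsto (fun ε => P (Bε ε)) u (𝓝 (P L)) :=
      ((continuous_objective X y lam continuous_nuclearNorm).tendsto L).comp hL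
    have h2 : Tendsto (fun ε : ℝ => P Bhat + lam * (min p₁ p₂ * ε)) u
        (𝓝 (P Bhat + lam * (min p₁ p₂ * 0))) :=
      (hid.const_mul _).const_mul _ |>.const_add _
    have := le_of_tendsto_of_tendsto h1 h2 (hpos.mono hlow)
    simpa using this
  have : L = Bhat := by
    by_contra hne
    exact absurd (hBhat L hne) (not_lt.mpr hle)
  exact this ▸ hL

section

open scoped Matrix.Norms.L2Operator

/-! ### The derivative of the modulus -/

theorem trace_transpose_mul_mul_nonneg {k l : ℕ} {W : Matrix (Fin k) (Fin k) ℝ}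
    (hW : W.PosSemidef) (L : Matrix (Fin k) (Fin l) ℝ) : 0 ≤ (Lᵀ * W * L).trace := by
  have := (hW.conjTranspose_mul_mul_same L).trace_nonneg
  rwa [Matrix.conjTranspose_eq_transpose_of_trivial] at this

theorem eq_zero_of_trace_transpose_mul_mul_eq_zero {k l : ℕ} {W : Matrix (Fin k) (Fin k) ℝ}
    (hW : W.PosDef) {L : Matrix (Fin k) (Fin l) ℝ} (h : (Lᵀ * W * L).trace = 0) : L = 0 := by
  have h1 := hW.posSemidef.conjTranspose_mul_mul_same L
  rw [Matrix.conjTranspose_eq_transpose_of_trivial] at h1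
  have h2 := h1.trace_eq_zero_iff.mp h
  ext i j
  have h3 : star (L.col j) ⬝ᵥ (W *ᵥ L.col j) = 0 := by
    have := congrFun (congrFun h2 j) j
    rw [Matrix.mul_assoc, Matrix.mul_apply] at this
    exact this
  by_contra hne
  have : L.col j ≠ 0 := fun h0 => hne (congrFun h0 i)
  exact absurd h3 (hW.dotProduct_mulVec_pos this).ne'

/-- The Sylvester operator `L ↦ L W + W L`, the derivative of `A ↦ A²` at `W`. -/
def sylvester {k : ℕ} (W : Matrix (Fin k) (Fin k) ℝ) :
    Matrix (Fin k) (Fin k) ℝ →ₗ[ℝ] Matrix (Fin k) (Fin k) ℝ :=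
  LinearMap.mulRight ℝ W + LinearMap.mulLeft ℝ W

@[simp]
theorem sylvester_apply {k : ℕ} (W L : Matrix (Fin k) (Fin k) ℝ) :
    sylvester W L = L * W + W * L := rfl

/-- If `L W + W L = 0` then `tr (L W Lᵀ) + tr (Lᵀ W L) = 0`, and both terms are nonnegative. -/
theorem sylvester_injective {k : ℕ} {W : Matrix (Fin k) (Fin k) ℝ} (hW : W.PosDef) :
    Function.Injective (sylvester W) := by
  rw [← LinearMap.ker_eq_bot, LinearMap.ker_eq_bot']
  intro L hL
  rw [sylvester_apply] at hL
  have h1 := trace_transpose_mul_mul_nonneg hW.posSemidef Lᵀ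
  have h2 := trace_transpose_mul_mul_nonneg hW.posSemidef L
  apply eq_zero_of_trace_transpose_mul_mul_eq_zero hW
  have h3 : (Lᵀ * (L * W + W * L)).trace = 0 := by rw [hL]; simp
  have h4 : (Lᵀ * (L * W)).trace = (Lᵀᵀ * W * Lᵀ).trace := by
    rw [Matrix.transpose_transpose, Matrix.trace_mul_comm]
  rw [Matrix.mul_add, Matrix.trace_add, h4, ← Matrix.mul_assoc] at h3
  linarith

/-- The Sylvester operator of a positive definite matrix, as a continuous linear equivalence. -/
def sylvesterEquiv {k : ℕ} {W : Matrix (Fin k) (Fin k) ℝ} (hW : W.PosDef) :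
    Matrix (Fin k) (Fin k) ℝ ≃L[ℝ] Matrix (Fin k) (Fin k) ℝ :=
  (LinearEquiv.ofInjectiveEndo (sylvester W) (sylvester_injective hW)).toContinuousLinearEquiv

/-- The derivative of the modulus solves a Sylvester equation. Along the line the modulus is the
local inverse of `A ↦ A²` applied to a polynomial in `t`, by the inverse function theorem. -/
theorem hasDerivAt_modulus {ε : ℝ} (hε : ε ≠ 0) (B D : Matrix (Fin p₁) (Fin p₂) ℝ)
    {K : Matrix (Fin p₂) (Fin p₂) ℝ}
    (hK : K * modulus ε B + modulus ε B * K = Dᵀ * B + Bᵀ * D) :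
    HasDerivAt (fun t : ℝ => modulus ε (B + t • D)) K 0 := by
  set W := modulus ε B with hWdef
  have hW : W.PosDef := modulus_posDef hε B
  have hsq : HasStrictFDerivAt (fun A : Matrix (Fin p₂) (Fin p₂) ℝ => A * A)
      (sylvesterEquiv hW : Matrix (Fin p₂) (Fin p₂) ℝ →L[ℝ] Matrix (Fin p₂) (Fin p₂) ℝ) W := by
    have h := (hasStrictFDerivAt_id (𝕜 := ℝ) W).mul' (hasStrictFDerivAt_id W)
    refine h.congr_fderiv ?_
    ext1 L
    simp [sylvesterEquiv, add_comm]
  have hcont : Tendsto (fun t : ℝ => modulus ε (B + t • D)) (𝓝 0) (𝓝 W) := by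
    have : Continuous fun t : ℝ => modulus ε (B + t • D) :=
      continuous_modulus.comp (by fun_prop : Continuous fun t : ℝ => (ε, B + t • D))
    simpa using this.tendsto 0
  have hS : HasDerivAt (fun t : ℝ => (B + t • D)ᵀ * (B + t • D) +
      ε ^ 2 • (1 : Matrix (Fin p₂) (Fin p₂) ℝ))
      (Dᵀ * B + Bᵀ * D) 0 := by
    have h1 : (fun t : ℝ => (B + t • D)ᵀ * (B + t • D) +
        ε ^ 2 • (1 : Matrix (Fin p₂) (Fin p₂) ℝ)) =
        fun t : ℝ => (Bᵀ * B + ε ^ 2 • 1) + t • (Dᵀ * B + Bᵀ * D) + t ^ 2 • (Dᵀ * D) := by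
      funext t
      simp only [Matrix.transpose_add, Matrix.transpose_smul, Matrix.add_mul, Matrix.mul_add,
        Matrix.smul_mul, Matrix.mul_smul, smul_add, sq, mul_smul]
      abel
    rw [h1]
    have h2 := (((hasDerivAt_id (0 : ℝ)).smul_const (Dᵀ * B + Bᵀ * D)).const_add
      (Bᵀ * B + ε ^ 2 • (1 : Matrix (Fin p₂) (Fin p₂) ℝ))).add
      (((hasDerivAt_id (0 : ℝ)).pow 2).smul_const (Dᵀ * D))
    exact h2.congr_deriv (by simp)
  have hinv := hsq.to_localInverse.hasFDerivAt
  have hW2 : W * W = (B + (0:ℝ) • D)ᵀ * (B + (0:ℝ) • D) + ε ^ 2 • 1 := by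
    simpa using modulus_mul_self ε B
  rw [hW2] at hinv
  have hcomp := hinv.comp_hasDerivAt 0 hS
  have hKe : (sylvesterEquiv hW).symm (Dᵀ * B + Bᵀ * D) = K := by
    rw [ContinuousLinearEquiv.symm_apply_eq, ← hK]
    rfl
  rw [ContinuousLinearEquiv.coe_coe, hKe] at hcomp
  refine hcomp.congr_of_eventuallyEq ?_
  filter_upwards [hcont.eventually hsq.eventually_left_inverse] with t ht
  rw [← ht, Function.comp_apply, ← modulus_mul_self, ht]

/-! ### First and second derivatives of the smoothed nuclear norm -/

theorem mInner_eq_sum (A B : Matrix (Fin p₁) (Fin p₂) ℝ) :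
    mInner A B = ∑ k, ∑ l, A k l * B k l := by
  simp only [mInner, Matrix.trace, Matrix.diag_apply, Matrix.mul_apply, Matrix.transpose_apply]
  exact Finset.sum_comm

theorem mInner_comm (A B : Matrix (Fin p₁) (Fin p₂) ℝ) : mInner A B = mInner B A := by
  simp only [mInner_eq_sum, mul_comm]

theorem mInner_add_right (A B C : Matrix (Fin p₁) (Fin p₂) ℝ) :
    mInner A (B + C) = mInner A B + mInner A C := by
  simp [mInner, Matrix.mul_add]

theorem mInner_smul_right (A B : Matrix (Fin p₁) (Fin p₂) ℝ) (c : ℝ) :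
    mInner A (c • B) = c * mInner A B := by
  simp [mInner]

theorem mInner_add_left (A B C : Matrix (Fin p₁) (Fin p₂) ℝ) :
    mInner (A + B) C = mInner A C + mInner B C := by
  simp [mInner, Matrix.add_mul]

theorem mInner_smul_left (A B : Matrix (Fin p₁) (Fin p₂) ℝ) (c : ℝ) :
    mInner (c • A) B = c * mInner A B := by
  simp [mInner]

theorem mInner_single (A : Matrix (Fin p₁) (Fin p₂) ℝ) (k : Fin p₁) (l : Fin p₂) :
    mInner A (Matrix.single k l 1) = A k l := by
  rw [mInner_eq_sum, Finset.sum_eq_single k, Finset.sum_eq_single l]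
  · simp
  · intro b _ hb; simp [hb.symm]
  · simp
  · intro b _ hb; simp [hb.symm]
  · simp

theorem vec_dotProduct_vec (A B : Matrix (Fin p₁) (Fin p₂) ℝ) : vec A ⬝ᵥ vec B = mInner A B := by
  rw [mInner_eq_sum, dotProduct, Fintype.sum_prod_type]
  rfl

/-- The gradient `B (Bᵀ B + ε²)^(-1/2)` of the smoothed nuclear norm at `B`. -/
def smoothGrad (ε : ℝ) (B : Matrix (Fin p₁) (Fin p₂) ℝ) : Matrix (Fin p₁) (Fin p₂) ℝ :=
  B * (modulus ε B)⁻¹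

theorem smoothGrad_mul_modulus {ε : ℝ} (hε : ε ≠ 0) (B : Matrix (Fin p₁) (Fin p₂) ℝ) :
    smoothGrad ε B * modulus ε B = B := by
  have := (modulus_posDef hε B).isUnit
  rw [Matrix.isUnit_iff_isUnit_det] at this
  rw [smoothGrad, Matrix.mul_assoc, Matrix.nonsing_inv_mul _ this, Matrix.mul_one]

theorem exists_modulusDeriv {ε : ℝ} (hε : ε ≠ 0) (B D : Matrix (Fin p₁) (Fin p₂) ℝ) :
    ∃ K, K * modulus ε B + modulus ε B * K = Dᵀ * B + Bᵀ * D :=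
  (LinearMap.injective_iff_surjective.mp (sylvester_injective (modulus_posDef hε B))) _

theorem trace_modulusDeriv {ε : ℝ} (hε : ε ≠ 0) {B D : Matrix (Fin p₁) (Fin p₂) ℝ}
    {K : Matrix (Fin p₂) (Fin p₂) ℝ}
    (hK : K * modulus ε B + modulus ε B * K = Dᵀ * B + Bᵀ * D) :
    K.trace = mInner (smoothGrad ε B) D := by
  have hW := modulus_posDef hε B
  have hu := hW.isUnit
  rw [Matrix.isUnit_iff_isUnit_det] at hu
  have hWt : (modulus ε B)ᵀ = modulus ε B := by
    simpa [Matrix.conjTranspose_eq_transpose_of_trivial] using hW.isHermitian.eq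
  have h1 := congrArg (fun A => (A * (modulus ε B)⁻¹).trace) hK
  simp only [Matrix.add_mul, Matrix.trace_add] at h1
  have h2 : (modulus ε B * K * (modulus ε B)⁻¹).trace = K.trace := by
    rw [Matrix.trace_mul_comm, ← Matrix.mul_assoc, Matrix.nonsing_inv_mul _ hu, Matrix.one_mul]
  have h3 : (Bᵀ * D * (modulus ε B)⁻¹).trace = mInner (smoothGrad ε B) D := by
    rw [Matrix.trace_mul_comm, mInner, smoothGrad, Matrix.transpose_mul,
      Matrix.transpose_nonsing_inv, hWt, Matrix.mul_assoc]
  have h4 : (Dᵀ * B * (modulus ε B)⁻¹).trace = mInner (smoothGrad ε B) D := by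
    rw [mInner_comm, mInner, smoothGrad, Matrix.mul_assoc]
  rw [Matrix.mul_assoc, Matrix.mul_nonsing_inv _ hu, Matrix.mul_one, h2, h3, h4] at h1
  linarith

theorem hasDerivAt_smoothNuclear {ε : ℝ} (hε : 0 < ε) (B D : Matrix (Fin p₁) (Fin p₂) ℝ) :
    HasDerivAt (fun t : ℝ => smoothNuclear ε (B + t • D)) (mInner (smoothGrad ε B) D) 0 := by
  obtain ⟨K, hK⟩ := exists_modulusDeriv hε.ne' B D
  simp only [smoothNuclear_eq_trace hε.le]
  rw [← trace_modulusDeriv hε.ne' hK]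
  have h1 := hasDerivAt_modulus hε.ne' B D hK
  have h2 := (LinearMap.toContinuousLinearMap
    (Matrix.traceLinearMap (Fin p₂) ℝ ℝ)).hasFDerivAt.comp_hasDerivAt 0 h1
  exact h2.sub_const _

/-- The second derivative of the smoothed nuclear norm: with `Z = B W⁻¹` and `K` the derivative of
`W` in direction `D`, the derivative of `Z` is `(D - Z K) W⁻¹`. -/
theorem hasDerivAt_smoothGrad {ε : ℝ} (hε : ε ≠ 0) (B D : Matrix (Fin p₁) (Fin p₂) ℝ)
    {K : Matrix (Fin p₂) (Fin p₂) ℝ}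
    (hK : K * modulus ε B + modulus ε B * K = Dᵀ * B + Bᵀ * D) (E : Matrix (Fin p₁) (Fin p₂) ℝ) :
    HasDerivAt (fun t : ℝ => mInner (smoothGrad ε (B + t • D)) E)
      (mInner ((D - smoothGrad ε B * K) * (modulus ε B)⁻¹) E) 0 := by
  have hW := modulus_posDef hε B
  have h1 := hasDerivAt_modulus hε B D hK
  have hW0 : modulus ε (B + (0 : ℝ) • D) = modulus ε B := by simp
  obtain ⟨w, hw⟩ := hW.isUnit
  have h2 : HasDerivAt (fun t : ℝ => (modulus ε (B + t • D))⁻¹)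
      (-((modulus ε B)⁻¹ * K * (modulus ε B)⁻¹)) 0 := by
    have h3 := hasFDerivAt_ringInverse (𝕜 := ℝ) w
    rw [hw, ← hW0] at h3
    have h4 := h3.comp_hasDerivAt 0 h1
    simp only [Function.comp_def, ← Matrix.nonsing_inv_eq_ringInverse] at h4
    refine h4.congr_deriv ?_
    rw [← hw]
    simp [Matrix.coe_units_inv]
  have h3 : ∀ A : Matrix (Fin p₁) (Fin p₂) ℝ, HasDerivAt
      (fun t : ℝ => mInner (A * (modulus ε (B + t • D))⁻¹) E)
      (mInner (A * -((modulus ε B)⁻¹ * K * (modulus ε B)⁻¹)) E) 0 := by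
    intro A
    let φ : Matrix (Fin p₂) (Fin p₂) ℝ →ₗ[ℝ] ℝ :=
      { toFun := fun V => mInner (A * V) E
        map_add' := fun V V' => by
          rw [Matrix.mul_add, mInner_add_left]
        map_smul' := fun c V => by
          rw [Matrix.mul_smul, mInner_smul_left]
          rfl }
    exact (LinearMap.toContinuousLinearMap φ).hasFDerivAt.comp_hasDerivAt 0 h2
  have h4 : (fun t : ℝ => mInner (smoothGrad ε (B + t • D)) E) = fun t : ℝ =>
      mInner (B * (modulus ε (B + t • D))⁻¹) E + t * mInner (D * (modulus ε (B + t • D))⁻¹) E := by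
    funext t
    rw [smoothGrad, Matrix.add_mul, Matrix.smul_mul, mInner_add_left, mInner_smul_left]
  rw [h4]
  refine ((h3 B).add ((hasDerivAt_id (0 : ℝ)).mul (h3 D))).congr_deriv ?_
  have h5 : (D - smoothGrad ε B * K) * (modulus ε B)⁻¹ =
      B * -((modulus ε B)⁻¹ * K * (modulus ε B)⁻¹) + D * (modulus ε B)⁻¹ := by
    rw [smoothGrad]
    simp only [Matrix.sub_mul, Matrix.mul_neg, Matrix.mul_assoc]
    abel
  rw [h5, mInner_add_left]
  simp

theorem hessian_smoothNuclear_apply {ε : ℝ} (hε : 0 < ε) (B : Matrix (Fin p₁) (Fin p₂) ℝ)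
    (kl st : Fin p₁ × Fin p₂) {K : Matrix (Fin p₂) (Fin p₂) ℝ}
    (hK : K * modulus ε B + modulus ε B * K =
      (Matrix.single kl.1 kl.2 (1 : ℝ))ᵀ * B + Bᵀ * Matrix.single kl.1 kl.2 (1 : ℝ)) :
    hessian (smoothNuclear ε) B kl st =
      ((Matrix.single kl.1 kl.2 1 - smoothGrad ε B * K) * (modulus ε B)⁻¹ :
        Matrix (Fin p₁) (Fin p₂) ℝ) st.1 st.2 := by
  rw [hessian, Matrix.of_apply]
  simp only [(hasDerivAt_smoothNuclear hε _ _).deriv]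
  rw [(hasDerivAt_smoothGrad hε.ne' B _ hK _).deriv, mInner_single]

/-- The action of the Hessian on `vec D`. It is obtained for the transpose because `hessian` takes
the derivative in the direction of the row index last; symmetry of the Hessian is not needed. -/
theorem exists_hessian_transpose_mulVec {ε : ℝ} (hε : 0 < ε) (B D : Matrix (Fin p₁) (Fin p₂) ℝ) :
    ∃ K, K * modulus ε B + modulus ε B * K = Dᵀ * B + Bᵀ * D ∧
      (hessian (smoothNuclear ε) B)ᵀ *ᵥ vec D =
        vec ((D - smoothGrad ε B * K) * (modulus ε B)⁻¹) := by
  choose K hK using fun kl : Fin p₁ × Fin p₂ =>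
    exists_modulusDeriv hε.ne' B (Matrix.single kl.1 kl.2 (1 : ℝ))
  have hD : D = ∑ kl : Fin p₁ × Fin p₂, vec D kl • Matrix.single kl.1 kl.2 (1 : ℝ) := by
    conv_lhs => rw [Matrix.matrix_eq_sum_single D]
    rw [Fintype.sum_prod_type]
    simp [vec]
  refine ⟨∑ kl, vec D kl • K kl, ?_, ?_⟩
  · conv_rhs => rw [hD]
    simp only [Matrix.transpose_sum, Matrix.sum_mul, Matrix.mul_sum, Matrix.transpose_smul,
      Matrix.smul_mul, Matrix.mul_smul, ← Finset.sum_add_distrib, ← smul_add, hK]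
  · have h : (D - smoothGrad ε B * ∑ kl, vec D kl • K kl) * (modulus ε B)⁻¹ =
        ∑ kl : Fin p₁ × Fin p₂, vec D kl • ((Matrix.single kl.1 kl.2 1 - smoothGrad ε B * K kl) *
          (modulus ε B)⁻¹) := by
      conv_lhs => enter [1, 1]; rw [hD]
      simp only [Matrix.sum_mul, Matrix.mul_sum, Matrix.smul_mul, Matrix.mul_smul,
        ← Finset.sum_sub_distrib, ← smul_sub]
    rw [h]
    ext st
    rw [vec, Matrix.sum_apply, Matrix.mulVec, dotProduct]
    refine Finset.sum_congr rfl fun kl _ => ?_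
    rw [Matrix.transpose_apply, hessian_smoothNuclear_apply hε B kl st (hK kl), Matrix.smul_apply,
      smul_eq_mul, mul_comm]

theorem hasDerivAt_objective (X : Fin n → Matrix (Fin p₁) (Fin p₂) ℝ) (y : Fin n → ℝ)
    (lam : ℝ) {ε : ℝ} (hε : 0 < ε) (B D : Matrix (Fin p₁) (Fin p₂) ℝ) :
    HasDerivAt (fun t : ℝ => objective X y lam (smoothNuclear ε) (B + t • D))
      (-∑ j, (y j - mInner (X j) B) * mInner (X j) D + lam * mInner (smoothGrad ε B) D) 0 := by
  unfold objective
  have h1 : ∀ j ∈ Finset.univ, HasDerivAt (fun t : ℝ => (y j - mInner (X j) (B + t • D)) ^ 2)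
      (-2 * ((y j - mInner (X j) B) * mInner (X j) D)) 0 := by
    intro j _
    simp only [mInner_add_right, mInner_smul_right]
    have h := ((((hasDerivAt_id (0 : ℝ)).mul_const (mInner (X j) D)).const_add
      (mInner (X j) B)).const_sub (y j)).pow 2
    refine h.congr_deriv ?_
    simp
    ring
  have h2 := ((HasDerivAt.fun_sum h1).const_mul (1 / 2 : ℝ)).add
    ((hasDerivAt_smoothNuclear hε B D).const_mul lam)
  refine h2.congr_deriv ?_
  rw [← Finset.mul_sum]
  ring

/-- The first order optimality condition of the smoothed problem. -/
theorem smoothGrad_eq_dualMatrix {X : Fin n → Matrix (Fin p₁) (Fin p₂) ℝ} {y : Fin n → ℝ}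
    {lam : ℝ} (hlam : 0 < lam) {ε : ℝ} (hε : 0 < ε) {B : Matrix (Fin p₁) (Fin p₂) ℝ}
    (hB : IsMinOn (objective X y lam (smoothNuclear ε)) Set.univ B) :
    smoothGrad ε B = dualMatrix X y lam B := by
  ext k l
  have h1 : IsLocalMin (fun t : ℝ => objective X y lam (smoothNuclear ε)
      (B + t • Matrix.single k l (1 : ℝ))) 0 := by
    refine Filter.Eventually.of_forall fun t => ?_
    simpa using hB (Set.mem_univ (B + t • Matrix.single k l (1 : ℝ)))
  have h2 := h1.hasDerivAt_eq_zero (hasDerivAt_objective X y lam hε B (Matrix.single k l 1))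
  simp only [mInner_single] at h2
  rw [dualMatrix, Matrix.smul_apply, Matrix.sum_apply, smul_eq_mul]
  simp only [Matrix.smul_apply, smul_eq_mul]
  field_simp
  linarith

end

/-! ### The linearized equations and invertibility of the Hessian -/

/-- The relation between a direction `D` and the derivative `Y` of the gradient `Z` in this
direction, together with the derivatives `K` of `W` and `J` of `T = ε W⁻¹`. The five equations are
the derivatives of `B = Z W`, `W² = Bᵀ B + ε²`, `T W = ε`, `W T = ε` and `T² = 1 - Zᵀ Z`. They
contain neither inverses nor `ε`, so that they persist in the limit `ε → 0`. -/
structure IsLinearized (W T : Matrix (Fin p₂) (Fin p₂) ℝ) (B Z D Y : Matrix (Fin p₁) (Fin p₂) ℝ)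
    (K J : Matrix (Fin p₂) (Fin p₂) ℝ) : Prop where
  dB_eq : D = Y * W + Z * K
  dW_eq : K * W + W * K = Dᵀ * B + Bᵀ * D
  dT_mul : J * W = -(T * K)
  mul_dT : W * J = -(K * T)
  dT_eq : T * J + J * T = -(Yᵀ * Z + Zᵀ * Y)

theorem transpose_eq_of_isHermitian {k : ℕ} {W : Matrix (Fin k) (Fin k) ℝ} (hW : W.IsHermitian) :
    Wᵀ = W := by
  simpa [Matrix.conjTranspose_eq_transpose_of_trivial] using hW.eq

theorem transpose_smoothGrad_mul_smoothGrad {ε : ℝ} (hε : ε ≠ 0) (B : Matrix (Fin p₁) (Fin p₂) ℝ) :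
    (smoothGrad ε B)ᵀ * smoothGrad ε B =
      1 - (ε • (modulus ε B)⁻¹) * (ε • (modulus ε B)⁻¹) := by
  have hW := modulus_posDef hε B
  have hu := hW.isUnit
  rw [Matrix.isUnit_iff_isUnit_det] at hu
  have hWt := transpose_eq_of_isHermitian hW.isHermitian
  have h := modulus_mul_self ε B
  rw [smoothGrad, Matrix.transpose_mul, Matrix.transpose_nonsing_inv, hWt, eq_sub_iff_add_eq]
  set W := modulus ε B
  calc W⁻¹ * Bᵀ * (B * W⁻¹) + ε • W⁻¹ * ε • W⁻¹ = W⁻¹ * (Bᵀ * B + ε ^ 2 • 1) * W⁻¹ := by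
        simp only [Matrix.mul_add, Matrix.add_mul, Matrix.mul_smul, Matrix.smul_mul, Matrix.mul_one,
          Matrix.mul_assoc, sq, mul_smul]
    _ = (W⁻¹ * W) * (W * W⁻¹) := by rw [← h]; simp only [Matrix.mul_assoc]
    _ = 1 := by rw [Matrix.nonsing_inv_mul _ hu, Matrix.mul_nonsing_inv _ hu, Matrix.one_mul]

/-- The Hessian of the smoothed nuclear norm maps `vec D` to `vec Y`, where `D` and `Y` satisfy the
linearized equations, and it is positive definite, as `⟨D, Y⟩ = tr (Y W Yᵀ) + tr (J W J)`. -/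
theorem exists_isLinearized {ε : ℝ} (hε : 0 < ε) (B D : Matrix (Fin p₁) (Fin p₂) ℝ) :
    ∃ Y K J, IsLinearized (modulus ε B) (ε • (modulus ε B)⁻¹) B (smoothGrad ε B) D Y K J ∧
      (hessian (smoothNuclear ε) B)ᵀ *ᵥ vec D = vec Y ∧ 0 ≤ mInner D Y ∧
      (mInner D Y = 0 → D = 0) := by
  obtain ⟨K, hK, hH⟩ := exists_hessian_transpose_mulVec hε B D
  have hW := modulus_posDef hε.ne' B
  have hu := hW.isUnit
  rw [Matrix.isUnit_iff_isUnit_det] at hu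
  have hWt := transpose_eq_of_isHermitian hW.isHermitian
  have hZW := smoothGrad_mul_modulus hε.ne' B
  have hZZ := transpose_smoothGrad_mul_smoothGrad hε.ne' B
  set W := modulus ε B with hWdef
  set Z := smoothGrad ε B with hZdef
  set T := ε • W⁻¹ with hT
  have hWT : W * T = ε • 1 := by rw [hT, Matrix.mul_smul, Matrix.mul_nonsing_inv _ hu]
  have hTW : T * W = ε • 1 := by rw [hT, Matrix.smul_mul, Matrix.nonsing_inv_mul _ hu]
  have hTt : Tᵀ = T := by rw [hT, Matrix.transpose_smul, Matrix.transpose_nonsing_inv, hWt]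
  have hKt : Kᵀ = K := by
    apply sylvester_injective hW
    rw [sylvester_apply, sylvester_apply, hK]
    have := congrArg Matrix.transpose hK
    simp only [Matrix.transpose_add, Matrix.transpose_mul, hWt, Matrix.transpose_transpose] at this
    rw [add_comm, this, add_comm]
  set Y := (D - Z * K) * W⁻¹ with hY
  have hYW : Y * W = D - Z * K := by
    rw [hY, Matrix.mul_assoc, Matrix.nonsing_inv_mul _ hu, Matrix.mul_one]
  set J := -(T * K * W⁻¹) with hJ
  have hJW : J * W = -(T * K) := by
    rw [hJ, Matrix.neg_mul, Matrix.mul_assoc, Matrix.nonsing_inv_mul _ hu, Matrix.mul_one]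
  have hWJ : W * J = -(K * T) := by
    rw [hJ, Matrix.mul_neg, ← Matrix.mul_assoc, ← Matrix.mul_assoc, hWT, hT]
    simp
  have hJt : Jᵀ = J := by
    rw [hJ, Matrix.transpose_neg, Matrix.transpose_mul, Matrix.transpose_mul,
      Matrix.transpose_nonsing_inv, hWt, hKt, hTt, hT]
    simp [Matrix.mul_assoc]
  have hcan : ∀ A C : Matrix (Fin p₂) (Fin p₂) ℝ, W * A * W = W * C * W → A = C := by
    intro A C h
    have h' : W⁻¹ * (W * A * W) * W⁻¹ = W⁻¹ * (W * C * W) * W⁻¹ := by rw [h]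
    simpa only [← Matrix.mul_assoc, Matrix.nonsing_inv_mul _ hu, Matrix.one_mul,
      Matrix.mul_nonsing_inv_cancel_right _ _ hu] using h'
  have hWYZW : W * (Yᵀ * Z) * W = (D - Z * K)ᵀ * (Z * W) := by
    rw [← hYW, Matrix.transpose_mul Y W, hWt]; simp only [Matrix.mul_assoc]
  have hWZYW : W * (Zᵀ * Y) * W = (Z * W)ᵀ * (D - Z * K) := by
    rw [← hYW, Matrix.transpose_mul, hWt]; simp only [Matrix.mul_assoc]
  have hdT : T * J + J * T = -(Yᵀ * Z + Zᵀ * Y) := by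
    -- Multiplied by `W` on both sides, the claim follows from `Y * W = D - Z * K` and `T * W = ε`.
    apply hcan
    have h1 : W * (T * J + J * T) * W = -(ε • (T * K + K * T)) := by
      calc W * (T * J + J * T) * W = (W * T) * (J * W) + (W * J) * (T * W) := by
            simp only [Matrix.mul_add, Matrix.add_mul, Matrix.mul_assoc]
        _ = _ := by
            rw [hWT, hTW, hJW, hWJ]
            simp [smul_add]
            abel
    have h2 : W * (-(Yᵀ * Z + Zᵀ * Y)) * W = -(W * (Yᵀ * Z) * W + W * (Zᵀ * Y) * W) := by
      simp only [Matrix.mul_add, Matrix.add_mul, Matrix.mul_neg, Matrix.neg_mul]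
    have h3 : (Z * K)ᵀ * (Z * W) = K * W - ε • (K * T) := by
      calc (Z * K)ᵀ * (Z * W) = K * (Zᵀ * Z) * W := by
            rw [Matrix.transpose_mul, hKt]; simp only [Matrix.mul_assoc]
        _ = K * W - K * T * (T * W) := by
            rw [hZZ]; simp only [Matrix.mul_sub, Matrix.sub_mul, Matrix.mul_one, Matrix.mul_assoc]
        _ = _ := by rw [hTW]; simp
    have h4 : (Z * W)ᵀ * (Z * K) = W * K - ε • (T * K) := by
      calc (Z * W)ᵀ * (Z * K) = W * (Zᵀ * Z) * K := by
            rw [Matrix.transpose_mul, hWt]; simp only [Matrix.mul_assoc]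
        _ = W * K - (W * T) * (T * K) := by
            rw [hZZ]; simp only [Matrix.mul_sub, Matrix.sub_mul, Matrix.mul_one, Matrix.mul_assoc]
        _ = _ := by rw [hWT]; simp
    rw [h1, h2, hWYZW, hWZYW, Matrix.transpose_sub, Matrix.sub_mul, Matrix.mul_sub, h3, h4, hZW,
      smul_add]
    have h5 : Dᵀ * B = K * W + W * K - Bᵀ * D := by rw [hK]; abel
    rw [h5]
    abel
  -- The term `tr (K Zᵀ Y)` of `⟨D, Y⟩` is turned into `tr (J W J)` by the equation for `T J + J T`.
  have hq : mInner D Y = (Y * W * Yᵀ).trace + (J * W * J).trace := by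
    have h1 : D = Y * W + Z * K := by rw [hYW]; abel
    have h2 : mInner (Y * W) Y = (Y * W * Yᵀ).trace := by
      rw [mInner_comm, mInner, Matrix.trace_mul_comm]
    have h3 : mInner (Z * K) Y = (K * (Zᵀ * Y)).trace := by
      rw [mInner, Matrix.transpose_mul, hKt, Matrix.mul_assoc]
    have h4 : (K * (Yᵀ * Z)).trace = (K * (Zᵀ * Y)).trace := by
      rw [← Matrix.trace_transpose, Matrix.transpose_mul, hKt, Matrix.transpose_mul,
        Matrix.transpose_transpose, Matrix.trace_mul_comm]
    have h5 : (K * (T * J)).trace = -(J * W * J).trace := by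
      rw [← Matrix.mul_assoc, show K * T = -(W * J) by rw [hWJ, neg_neg], Matrix.neg_mul,
        Matrix.trace_neg, Matrix.trace_mul_comm, Matrix.mul_assoc]
    have h6 : (K * (J * T)).trace = -(J * W * J).trace := by
      rw [← Matrix.mul_assoc, Matrix.trace_mul_comm, ← Matrix.mul_assoc,
        show T * K = -(J * W) by rw [hJW, neg_neg], Matrix.neg_mul, Matrix.trace_neg]
    have h7 := congrArg (fun A => (K * A).trace) hdT
    simp only [Matrix.mul_add, Matrix.mul_neg, Matrix.trace_add, Matrix.trace_neg, h4, h5, h6] at h7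
    conv_lhs => rw [h1]
    rw [mInner_add_left, h2, h3]
    linarith
  have hq1 : 0 ≤ (Y * W * Yᵀ).trace := by
    simpa using trace_transpose_mul_mul_nonneg hW.posSemidef Yᵀ
  have hq2 : 0 ≤ (J * W * J).trace := by
    simpa [hJt] using trace_transpose_mul_mul_nonneg hW.posSemidef J
  refine ⟨Y, K, J, ⟨by rw [hYW]; abel, hK, hJW, hWJ, hdT⟩, hH, by rw [hq]; positivity, fun h0 => ?_⟩
  rw [hq] at h0
  have hY0 : Yᵀ = 0 := eq_zero_of_trace_transpose_mul_mul_eq_zero hW (by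
    rw [Matrix.transpose_transpose]; linarith)
  have hJ0 : J = 0 := eq_zero_of_trace_transpose_mul_mul_eq_zero hW (by rw [hJt]; linarith)
  have hK0 : K = 0 := by
    have : W * (T * K) = 0 := by rw [← neg_neg (T * K), ← hJW, hJ0]; simp
    rw [← Matrix.mul_assoc, hWT, Matrix.smul_mul, Matrix.one_mul] at this
    exact (smul_eq_zero.mp this).resolve_left hε.ne'
  have : Y * W + Z * K = D := by rw [hYW]; abel
  rw [← this, hK0, Matrix.transpose_eq_zero.mp hY0]
  simp

theorem looHessian_transpose_mulVec (X : Fin n → Matrix (Fin p₁) (Fin p₂) ℝ) (lam : ℝ)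
    (R : Matrix (Fin p₁) (Fin p₂) ℝ → ℝ) (i : Fin n) (B D Y : Matrix (Fin p₁) (Fin p₂) ℝ)
    (hY : (hessian R B)ᵀ *ᵥ vec D = vec Y) :
    (looHessian X lam R i B)ᵀ *ᵥ vec D =
      vec (∑ j ∈ Finset.univ.erase i, mInner (X j) D • X j + lam • Y) := by
  rw [looHessian, Matrix.transpose_add, Matrix.add_mulVec, Matrix.transpose_smul,
    Matrix.smul_mulVec, hY, Matrix.transpose_sum, Matrix.sum_mulVec]
  have : ∀ j, (Matrix.vecMulVec (vec (X j)) (vec (X j)))ᵀ *ᵥ vec D =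
      mInner (X j) D • vec (X j) := by
    intro j
    rw [Matrix.transpose_vecMulVec, Matrix.vecMulVec_mulVec, vec_dotProduct_vec]
    ext kl
    simp [mul_comm]
  simp only [this]
  ext kl
  simp [vec, Matrix.sum_apply]

theorem isUnit_det_looHessian (X : Fin n → Matrix (Fin p₁) (Fin p₂) ℝ) {lam : ℝ} (hlam : 0 < lam)
    {ε : ℝ} (hε : 0 < ε) (i : Fin n) (B : Matrix (Fin p₁) (Fin p₂) ℝ) :
    IsUnit (looHessian X lam (smoothNuclear ε) i B).det := by
  rw [← Matrix.det_transpose, ← Matrix.isUnit_iff_isUnit_det, ← Matrix.mulVec_injective_iff_isUnit]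
  refine (injective_iff_map_eq_zero
    (Matrix.mulVecLin (looHessian X lam (smoothNuclear ε) i B)ᵀ)).mpr fun d hd => ?_
  let D : Matrix (Fin p₁) (Fin p₂) ℝ := Matrix.of fun k l => d (k, l)
  have hdD : d = vec D := rfl
  obtain ⟨Y, K, J, -, hY, h0, h1⟩ := exists_isLinearized hε B D
  rw [Matrix.mulVecLin_apply, hdD, looHessian_transpose_mulVec X lam _ i B D Y hY] at hd
  have h2 := congrArg (fun v => vec D ⬝ᵥ v) hd
  simp only [vec_dotProduct_vec, dotProduct_zero] at h2
  rw [mInner_add_right, mInner_smul_right] at h2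
  have h3 : mInner D (∑ j ∈ Finset.univ.erase i, mInner (X j) D • X j) =
      ∑ j ∈ Finset.univ.erase i, mInner (X j) D ^ 2 := by
    have : ∀ s : Finset (Fin n), mInner D (∑ j ∈ s, mInner (X j) D • X j) =
        ∑ j ∈ s, mInner (X j) D ^ 2 := by
      intro s
      simp only [mInner, Matrix.mul_sum, Matrix.trace_sum, Matrix.mul_smul, Matrix.trace_smul]
      refine Finset.sum_congr rfl fun j _ => ?_
      have := mInner_comm D (X j)
      simp only [mInner] at this
      rw [this, smul_eq_mul, sq]
    exact this _
  rw [h3] at h2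
  have h4 : 0 ≤ ∑ j ∈ Finset.univ.erase i, mInner (X j) D ^ 2 := by positivity
  have h5 : mInner D Y = 0 := by
    have : 0 ≤ lam * mInner D Y := by positivity
    have : lam * mInner D Y = 0 := by linarith
    exact (mul_eq_zero.mp this).resolve_left hlam.ne'
  rw [hdD, h1 h5]
  rfl

/-! ### Limits along the minimizers -/

theorem tendsto_matrix_mul {ι : Type*} {f : Filter ι} {a b c : ℕ}
    {F : ι → Matrix (Fin a) (Fin b) ℝ} {G : ι → Matrix (Fin b) (Fin c) ℝ}
    {A : Matrix (Fin a) (Fin b) ℝ} {B : Matrix (Fin b) (Fin c) ℝ} (hF : Tendsto F f (𝓝 A))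
    (hG : Tendsto G f (𝓝 B)) : Tendsto (fun x => F x * G x) f (𝓝 (A * B)) := by
  have hc : Continuous fun q : Matrix (Fin a) (Fin b) ℝ × Matrix (Fin b) (Fin c) ℝ =>
    q.1 * q.2 := by fun_prop
  exact Tendsto.comp (f := fun x => (F x, G x))
    (g := fun q : Matrix (Fin a) (Fin b) ℝ × Matrix (Fin b) (Fin c) ℝ => q.1 * q.2)
    (hc.tendsto (A, B)) (hF.prodMk_nhds hG)

theorem tendsto_matrix_transpose {ι : Type*} {f : Filter ι} {a b : ℕ}
    {F : ι → Matrix (Fin a) (Fin b) ℝ} {A : Matrix (Fin a) (Fin b) ℝ} (hF : Tendsto F f (𝓝 A)) :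
    Tendsto (fun x => (F x)ᵀ) f (𝓝 Aᵀ) := by
  have hc : Continuous fun q : Matrix (Fin a) (Fin b) ℝ => qᵀ := by fun_prop
  exact Tendsto.comp (g := fun q : Matrix (Fin a) (Fin b) ℝ => qᵀ) (hc.tendsto A) hF

theorem continuous_dualMatrix (X : Fin n → Matrix (Fin p₁) (Fin p₂) ℝ) (y : Fin n → ℝ)
    (lam : ℝ) : Continuous (dualMatrix X y lam) := by
  unfold dualMatrix
  have := fun j => continuous_mInner (X j)
  fun_prop

/-- Convergence of `W`, `Z` and `T = ε W⁻¹` along minimizers of the smoothed problems. The gradient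
`Z` converges because it equals the continuous expression `dualMatrix` at the minimizer, and `T`
because it is the positive semidefinite square root of `1 - Zᵀ Z`. The relations `Z W = B`,
`T² = 1 - Zᵀ Z`, `W T = ε` pass to the limit. -/
theorem tendsto_modulus_of_isMinOn {X : Fin n → Matrix (Fin p₁) (Fin p₂) ℝ} {y : Fin n → ℝ}
    {lam : ℝ} (hlam : 0 < lam) {Bhat : Matrix (Fin p₁) (Fin p₂) ℝ}
    (hBhat : ∀ B, B ≠ Bhat →
      objective X y lam nuclearNorm Bhat < objective X y lam nuclearNorm B)
    {Bε : ℝ → Matrix (Fin p₁) (Fin p₂) ℝ}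
    (hBε : ∀ ε : ℝ, 0 < ε → IsMinOn (objective X y lam (smoothNuclear ε)) Set.univ (Bε ε)) :
    Tendsto (fun ε => modulus ε (Bε ε)) (𝓝[>] 0) (𝓝 (modulus 0 Bhat)) ∧
    Tendsto (fun ε => smoothGrad ε (Bε ε)) (𝓝[>] 0) (𝓝 (dualMatrix X y lam Bhat)) ∧
    dualMatrix X y lam Bhat * modulus 0 Bhat = Bhat ∧
    ∃ T : Matrix (Fin p₂) (Fin p₂) ℝ, T.PosSemidef ∧
      Tendsto (fun ε => ε • (modulus ε (Bε ε))⁻¹) (𝓝[>] 0) (𝓝 T) ∧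
      (dualMatrix X y lam Bhat)ᵀ * dualMatrix X y lam Bhat = 1 - T * T ∧
      modulus 0 Bhat * T = 0 ∧ T * modulus 0 Bhat = 0 := by
  have hB := tendsto_of_isMinOn_objective hlam hBhat hBε
  have hid : Tendsto (fun ε : ℝ => ε) (𝓝[>] 0) (𝓝 0) :=
    tendsto_nhdsWithin_of_tendsto_nhds tendsto_id
  have hpos : ∀ᶠ ε : ℝ in 𝓝[>] 0, 0 < ε := self_mem_nhdsWithin
  have hW : Tendsto (fun ε => modulus ε (Bε ε)) (𝓝[>] 0) (𝓝 (modulus 0 Bhat)) :=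
    Tendsto.comp (g := fun q : ℝ × Matrix (Fin p₁) (Fin p₂) ℝ => modulus q.1 q.2)
      (f := fun ε => (ε, Bε ε)) (continuous_modulus.tendsto ((0 : ℝ), Bhat)) (hid.prodMk_nhds hB)
  have hZ : Tendsto (fun ε => smoothGrad ε (Bε ε)) (𝓝[>] 0) (𝓝 (dualMatrix X y lam Bhat)) := by
    have h : Tendsto (fun ε => dualMatrix X y lam (Bε ε)) (𝓝[>] 0)
        (𝓝 (dualMatrix X y lam Bhat)) :=
      ((continuous_dualMatrix X y lam).tendsto Bhat).comp hB
    refine h.congr' ?_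
    filter_upwards [hpos] with ε hε
    exact (smoothGrad_eq_dualMatrix hlam hε (hBε ε hε)).symm
  set Z := dualMatrix X y lam Bhat
  set W := modulus 0 Bhat
  have hZW : Z * W = Bhat := by
    refine tendsto_nhds_unique (tendsto_matrix_mul hZ hW) (hB.congr' ?_)
    filter_upwards [hpos] with ε hε
    exact (smoothGrad_mul_modulus hε.ne' (Bε ε)).symm
  have hinv : ∀ ε : ℝ, 0 < ε → (ε • (modulus ε (Bε ε))⁻¹).PosSemidef := fun ε hε =>
    (modulus_posSemidef ε (Bε ε)).inv.smul hε.le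
  have hcont : Continuous fun A : Matrix (Fin p₁) (Fin p₂) ℝ => 1 - Aᵀ * A := by fun_prop
  have hC := (hcont.tendsto Z).comp hZ
  have hsq : ∀ ε : ℝ, 0 < ε → (ε • (modulus ε (Bε ε))⁻¹) * (ε • (modulus ε (Bε ε))⁻¹) =
      1 - (smoothGrad ε (Bε ε))ᵀ * smoothGrad ε (Bε ε) := by
    intro ε hε
    rw [transpose_smoothGrad_mul_smoothGrad hε.ne']
    abel
  have hnn : ∀ ε : ℝ, 0 < ε → 0 ≤ 1 - (smoothGrad ε (Bε ε))ᵀ * smoothGrad ε (Bε ε) := by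
    intro ε hε
    rw [← hsq ε hε, Matrix.nonneg_iff_posSemidef]
    have := Matrix.posSemidef_conjTranspose_mul_self (ε • (modulus ε (Bε ε))⁻¹)
    rwa [(hinv ε hε).isHermitian.eq] at this
  have hC0 : (0 : Matrix (Fin p₂) (Fin p₂) ℝ) ≤ 1 - Zᵀ * Z :=
    (isClosed_matrix_nonneg p₂).mem_of_tendsto hC (by
      filter_upwards [hpos] with ε hε
      exact hnn ε hε)
  have hT : Tendsto (fun ε => ε • (modulus ε (Bε ε))⁻¹) (𝓝[>] 0)
      (𝓝 (CFC.sqrt (1 - Zᵀ * Z))) := by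
    have h1 : Tendsto (fun ε => 1 - (smoothGrad ε (Bε ε))ᵀ * smoothGrad ε (Bε ε)) (𝓝[>] 0)
        (𝓝[{A | 0 ≤ A}] (1 - Zᵀ * Z)) := by
      refine tendsto_nhdsWithin_iff.mpr ⟨hC, ?_⟩
      filter_upwards [hpos] with ε hε
      exact hnn ε hε
    refine ((continuousOn_matrix_sqrt p₂ _ hC0).tendsto.comp h1).congr' ?_
    filter_upwards [hpos] with ε hε
    exact CFC.sqrt_unique (hsq ε hε) (hinv ε hε).nonneg
  have hWT : ∀ᶠ ε : ℝ in 𝓝[>] 0, modulus ε (Bε ε) * (ε • (modulus ε (Bε ε))⁻¹) =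
      ε • (1 : Matrix (Fin p₂) (Fin p₂) ℝ) ∧
      (ε • (modulus ε (Bε ε))⁻¹) * modulus ε (Bε ε) = ε • (1 : Matrix (Fin p₂) (Fin p₂) ℝ) := by
    filter_upwards [hpos] with ε hε
    have hu := (modulus_posDef hε.ne' (Bε ε)).isUnit
    rw [Matrix.isUnit_iff_isUnit_det] at hu
    rw [Matrix.mul_smul, Matrix.mul_nonsing_inv _ hu, Matrix.smul_mul, Matrix.nonsing_inv_mul _ hu]
    exact ⟨rfl, rfl⟩
  have hlim0 : Tendsto (fun ε : ℝ => ε • (1 : Matrix (Fin p₂) (Fin p₂) ℝ)) (𝓝[>] 0) (𝓝 0) := by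
    simpa using hid.smul_const (1 : Matrix (Fin p₂) (Fin p₂) ℝ)
  refine ⟨hW, hZ, hZW, CFC.sqrt (1 - Zᵀ * Z), Matrix.nonneg_iff_posSemidef.mp (CFC.sqrt_nonneg _),
    hT, ?_, ?_, ?_⟩
  · rw [CFC.sqrt_mul_sqrt_self _ hC0]
    abel
  · exact tendsto_nhds_unique (hW.mul hT) (hlim0.congr' (hWT.mono fun ε h => h.1.symm))
  · exact tendsto_nhds_unique (hT.mul hW) (hlim0.congr' (hWT.mono fun ε h => h.2.symm))

/-! ### Existence of a simultaneous singular value decomposition -/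

theorem exists_antitone_diagonalization {k : ℕ} {S : Matrix (Fin k) (Fin k) ℝ}
    (hS : S.IsHermitian) :
    ∃ (P : Matrix (Fin k) (Fin k) ℝ) (ν : Fin k → ℝ), Pᵀ * P = 1 ∧ P * Pᵀ = 1 ∧ Antitone ν ∧
      S = P * Matrix.diagonal ν * Pᵀ := by
  have hk : Module.finrank ℝ (EuclideanSpace ℝ (Fin k)) = k := by simp
  have hA := Matrix.isSymmetric_toEuclideanLin_iff.mpr hS
  obtain ⟨P, h1, h2, h3⟩ := eq_mul_diagonal_eigenvalues_mul hA rfl hk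
  exact ⟨P, hA.eigenvalues hk, h1, h2, hA.eigenvalues_antitone hk, h3⟩

theorem mul_diagonal_mul_mul_self {k : ℕ} {P : Matrix (Fin k) (Fin k) ℝ} (hP : Pᵀ * P = 1)
    (a b : Fin k → ℝ) :
    P * Matrix.diagonal a * Pᵀ * (P * Matrix.diagonal b * Pᵀ) =
      P * Matrix.diagonal (fun l => a l * b l) * Pᵀ := by
  calc _ = P * Matrix.diagonal a * (Pᵀ * P) * Matrix.diagonal b * Pᵀ := by
        simp only [Matrix.mul_assoc]
    _ = _ := by
        rw [hP, Matrix.mul_one, Matrix.mul_assoc P, Matrix.diagonal_mul_diagonal]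

theorem posSemidef_mul_diagonal_mul {k : ℕ} (P : Matrix (Fin k) (Fin k) ℝ) {a : Fin k → ℝ}
    (ha : ∀ l, 0 ≤ a l) : (P * Matrix.diagonal a * Pᵀ).PosSemidef := by
  have : (Matrix.diagonal a).PosSemidef := Matrix.PosSemidef.diagonal ha
  simpa [Matrix.conjTranspose_eq_transpose_of_trivial] using this.mul_mul_conjTranspose_same P

/-- Positive semidefinite matrices with product `0` are the positive and the negative part of their
difference. -/
theorem posPart_negPart_eq {k : ℕ} {W T P : Matrix (Fin k) (Fin k) ℝ} {ν : Fin k → ℝ}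
    (hW : W.PosSemidef) (hT : T.PosSemidef) (hWT : W * T = 0) (hTW : T * W = 0)
    (hP : Pᵀ * P = 1) (h : W - T = P * Matrix.diagonal ν * Pᵀ) :
    W = P * Matrix.diagonal (fun l => max (ν l) 0) * Pᵀ ∧
      T = P * Matrix.diagonal (fun l => max (-ν l) 0) * Pᵀ := by
  -- `W + T` is the positive square root of `(W - T)²`, since the products `W T`, `T W` vanish.
  have h1 : W + T = P * Matrix.diagonal (fun l => |ν l|) * Pᵀ := by
    refine posSemidef_eq_of_mul_self_eq (hW.add hT)
      (posSemidef_mul_diagonal_mul P fun l => abs_nonneg _) ?_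
    rw [mul_diagonal_mul_mul_self hP]
    simp only [abs_mul_abs_self]
    rw [← mul_diagonal_mul_mul_self hP, ← h]
    simp only [Matrix.mul_add, Matrix.add_mul, Matrix.mul_sub, Matrix.sub_mul, hWT, hTW]
    abel
  have hd : ∀ c d : Fin k → ℝ, P * Matrix.diagonal (fun l => c l + d l) * Pᵀ =
      P * Matrix.diagonal c * Pᵀ + P * Matrix.diagonal d * Pᵀ := by
    intro c d
    rw [← Matrix.diagonal_add, Matrix.mul_add, Matrix.add_mul]
  have hs : ∀ (a : ℝ) (c : Fin k → ℝ), P * Matrix.diagonal (fun l => a * c l) * Pᵀ =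
      a • (P * Matrix.diagonal c * Pᵀ) := by
    intro a c
    rw [← Matrix.smul_mul, ← Matrix.mul_smul, ← Matrix.diagonal_smul]
    rfl
  have e1 : (fun l => max (ν l) 0) = fun l => (1 / 2) * |ν l| + (1 / 2) * ν l := by
    funext l
    rcases le_total 0 (ν l) with h0 | h0
    · rw [max_eq_left h0, abs_of_nonneg h0]; ring
    · rw [max_eq_right h0, abs_of_nonpos h0]; ring
  have e2 : (fun l => max (-ν l) 0) = fun l => (1 / 2) * |ν l| + (-(1 / 2)) * ν l := by
    funext l
    rcases le_total 0 (ν l) with h0 | h0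
    · rw [max_eq_right (by linarith), abs_of_nonneg h0]; ring
    · rw [max_eq_left (by linarith), abs_of_nonpos h0]; ring
  rw [e1, e2, hd, hd, hs, hs, hs, ← h, ← h1]
  constructor
  · ext i j; simp; ring
  · ext i j; simp; ring

/-- A lower set of `Fin k` is an initial segment. -/
theorem fin_mem_iff_lt_card {k : ℕ} {p : Fin k → Prop} [DecidablePred p]
    (hp : ∀ i j, i ≤ j → p j → p i) (l : Fin k) : p l ↔ l.val < Fintype.card {i // p i} := by
  rw [Fintype.card_subtype]
  constructor
  · intro hl
    have : Finset.Iic l ⊆ Finset.univ.filter p := fun i hi => by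
      simpa using hp i l (by simpa using hi) hl
    have := Finset.card_le_card this
    rw [Fin.card_Iic] at this
    exact this
  · intro hl
    by_contra hn
    have : Finset.univ.filter p ⊆ Finset.Iio l := fun i hi => by
      rw [Finset.mem_Iio]
      by_contra hle
      exact hn (hp l i (not_lt.mp hle) (by simpa using hi))
    have := Finset.card_le_card this
    rw [Fin.card_Iio] at this
    exact absurd hl (not_lt.mpr this)

theorem rank_eq_card_of_gram_eq {B : Matrix (Fin p₁) (Fin p₂) ℝ}
    {V : Matrix (Fin p₂) (Fin p₂) ℝ} {s : Fin p₂ → ℝ} (hV : Vᵀ * V = 1)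
    (h : Bᵀ * B = V * Matrix.diagonal s * Vᵀ) : B.rank = Fintype.card {l // s l ≠ 0} := by
  have hV' : V * Vᵀ = 1 := mul_eq_one_comm.mp hV
  rw [← Matrix.rank_transpose_mul_self, h,
    Matrix.rank_mul_eq_left_of_isUnit_det _ _ (Matrix.isUnit_det_of_left_inverse hV'),
    Matrix.rank_mul_eq_right_of_isUnit_det _ _ (Matrix.isUnit_det_of_left_inverse hV),
    Matrix.rank_diagonal]

/-- A matrix with orthogonal columns of decreasing norms `g 0, g 1, …` has the form `U diag[g]`: the
nonzero columns, normalized, extend to an orthonormal basis. As `g` decreases, there are no nonzero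
columns beyond the first `p₁`, so the columns of `U` are indexed as `rectDiag` requires. -/
theorem exists_orthogonal_mul_rectDiag {G : Matrix (Fin p₁) (Fin p₂) ℝ} {g : ℕ → ℝ}
    (hg : ∀ l : Fin p₂, 0 ≤ g l) (hanti : ∀ i j : Fin p₂, i ≤ j → g j ≤ g i)
    (hG : Gᵀ * G = Matrix.diagonal fun l : Fin p₂ => g l * g l) :
    ∃ U ∈ Matrix.orthogonalGroup (Fin p₁) ℝ, G = U * rectDiag p₁ p₂ g := by
  have hinner : ∀ l l' : Fin p₂, ∑ i, G i l * G i l' = if l = l' then g l * g l else 0 := by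
    intro l l'
    have := congrFun (congrFun hG l) l'
    rwa [Matrix.mul_apply, Matrix.diagonal_apply] at this
  have hlt : ∀ l : Fin p₂, g l ≠ 0 → l.val < p₁ := by
    intro l hl
    have h1 : G.rank = Fintype.card {l : Fin p₂ // g l * g l ≠ 0} :=
      rank_eq_card_of_gram_eq (V := 1) (by simp) (by simpa using hG)
    have h2 := (fin_mem_iff_lt_card (p := fun l : Fin p₂ => g l * g l ≠ 0) (by
      intro i j hij hj h0
      have h3 := hanti i j hij
      rw [mul_self_eq_zero.mp h0] at h3
      exact hj (by rw [le_antisymm h3 (hg j), mul_zero])) l).mp (mul_self_ne_zero.mpr hl)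
    rw [← h1] at h2
    exact h2.trans_le (Matrix.rank_le_height G)
  let v : Fin p₁ → EuclideanSpace ℝ (Fin p₁) := fun k =>
    if h : k.val < p₂ then WithLp.toLp 2 fun i => (g k)⁻¹ * G i ⟨k, h⟩ else 0
  let s : Set (Fin p₁) := {k | k.val < p₂ ∧ g k ≠ 0}
  have hv : Orthonormal ℝ (s.domRestrict v) := by
    rw [orthonormal_iff_ite]
    rintro ⟨a, ha, ha0⟩ ⟨b, hb, hb0⟩
    have h1 : inner ℝ (v a) (v b) = (g a)⁻¹ * (g b)⁻¹ * ∑ i, G i ⟨a, ha⟩ * G i ⟨b, hb⟩ := by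
      simp only [v, dif_pos ha, dif_pos hb, PiLp.inner_apply, Finset.mul_sum]
      refine Finset.sum_congr rfl fun i _ => ?_
      simp
      ring
    change inner ℝ (v a) (v b) = _
    rw [h1, hinner]
    by_cases hab : a = b
    · subst hab
      simp
      field_simp
    · have : (⟨a.val, ha⟩ : Fin p₂) ≠ ⟨b.val, hb⟩ := fun h => hab (Fin.ext (by simpa using h))
      rw [if_neg this, if_neg (fun h => hab (by simpa using h)), mul_zero]
  obtain ⟨b, hb⟩ := hv.exists_orthonormalBasis_extension_of_card_eq (by simp)
  have horth := orthonormal_iff_ite.mp b.orthonormal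
  let U : Matrix (Fin p₁) (Fin p₁) ℝ := Matrix.of fun i k => b k i
  have hU : Uᵀ * U = 1 := by
    ext k l
    simp only [Matrix.mul_apply, Matrix.transpose_apply, Matrix.one_apply, U, Matrix.of_apply]
    rw [← horth k l]
    simp [PiLp.inner_apply, mul_comm]
  refine ⟨U, (Matrix.mem_orthogonalGroup_iff' _ _).mpr hU, ?_⟩
  ext i l
  rw [Matrix.mul_apply]
  by_cases hl : g l = 0
  · have h1 : ∑ i, G i l * G i l = 0 := by rw [hinner, if_pos rfl, hl, mul_zero]
    have h2 := (Finset.sum_eq_zero_iff_of_nonneg fun i _ => mul_self_nonneg _).mp h1 i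
      (Finset.mem_univ i)
    rw [mul_self_eq_zero.mp h2]
    symm
    refine Finset.sum_eq_zero fun k _ => ?_
    rw [rectDiag, Matrix.of_apply]
    split_ifs with h
    · rw [h, hl, mul_zero]
    · rw [mul_zero]
  · rw [Finset.sum_eq_single (⟨l, hlt l hl⟩ : Fin p₁)]
    · have h1 := hb ⟨l, hlt l hl⟩ ⟨l.2, hl⟩
      simp only [U, Matrix.of_apply, rectDiag, h1, v, dif_pos l.2]
      simp
      field_simp
    · intro k _ hk
      have : k.val ≠ l.val := fun h => hk (Fin.ext h)
      rw [rectDiag, Matrix.of_apply, if_neg this, mul_zero]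
    · simp

theorem rectDiag_mul_diagonal (g : ℕ → ℝ) (s : ℕ → ℝ) :
    rectDiag p₁ p₂ g * Matrix.diagonal (fun l : Fin p₂ => s l) =
      rectDiag p₁ p₂ fun j => g j * s j := by
  ext k l
  rw [Matrix.mul_diagonal]
  simp only [rectDiag, Matrix.of_apply]
  split_ifs with h
  · rw [h]
  · simp

/-- Simultaneous singular value decompositions of `B = Z W` and `Z`. The matrix `V` diagonalizes
`W - T` with decreasing eigenvalues, so that the singular values of `Z` (whose squares are the
eigenvalues of `1 - T²`) decrease, and the nonzero singular values of `B` come first. -/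
theorem exists_simultaneous_svd {B Z : Matrix (Fin p₁) (Fin p₂) ℝ}
    {W T : Matrix (Fin p₂) (Fin p₂) ℝ} (hW : W.PosSemidef) (hT : T.PosSemidef)
    (hWT : W * T = 0) (hTW : T * W = 0) (hZZ : Zᵀ * Z = 1 - T * T) (hZW : Z * W = B) :
    ∃ U V σ g, IsSVD B U V σ ∧ (∀ j < min p₁ p₂, (σ j ≠ 0 ↔ j < B.rank)) ∧ IsSVD Z U V g := by
  obtain ⟨V, ν, hV, hV', hν, hN⟩ := exists_antitone_diagonalization
    (hW.isHermitian.sub hT.isHermitian)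
  obtain ⟨hWν, hTν⟩ := posPart_negPart_eq hW hT hWT hTW hV hN
  have hTT : Vᵀ * (T * T) * V = Matrix.diagonal fun l => max (-ν l) 0 * max (-ν l) 0 := by
    rw [hTν, mul_diagonal_mul_mul_self hV, ← Matrix.mul_assoc, ← Matrix.mul_assoc, hV,
      Matrix.one_mul, Matrix.mul_assoc, hV, Matrix.mul_one]
  have hG : (Z * V)ᵀ * (Z * V) = Matrix.diagonal fun l => 1 - max (-ν l) 0 * max (-ν l) 0 := by
    rw [Matrix.transpose_mul, Matrix.mul_assoc, ← Matrix.mul_assoc Zᵀ, hZZ, ← Matrix.mul_assoc,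
      Matrix.mul_sub, Matrix.sub_mul, hTT, Matrix.mul_one, hV, ← Matrix.diagonal_one,
      Matrix.diagonal_sub]
  have hnn : ∀ l, 0 ≤ 1 - max (-ν l) 0 * max (-ν l) 0 := by
    intro l
    have h1 := congrFun (congrFun hG l) l
    rw [Matrix.diagonal_apply_eq, Matrix.mul_apply] at h1
    rw [← h1]
    exact Finset.sum_nonneg fun i _ => mul_self_nonneg _
  let σ : ℕ → ℝ := fun j => if h : j < p₂ then max (ν ⟨j, h⟩) 0 else 0
  let g : ℕ → ℝ := fun j =>
    if h : j < p₂ then Real.sqrt (1 - max (-ν ⟨j, h⟩) 0 * max (-ν ⟨j, h⟩) 0) else 0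
  have hσ : ∀ l : Fin p₂, σ l = max (ν l) 0 := fun l => by simp [σ]
  have hg : ∀ l : Fin p₂, g l = Real.sqrt (1 - max (-ν l) 0 * max (-ν l) 0) := fun l => by
    simp [g]
  have hg0 : ∀ j, 0 ≤ g j := fun j => by
    simp only [g]; split_ifs <;> positivity
  have hσ0 : ∀ j, 0 ≤ σ j := fun j => by
    simp only [σ]; split_ifs <;> positivity
  obtain ⟨U, hU, hZU⟩ := exists_orthogonal_mul_rectDiag (G := Z * V) (g := g) (fun l => hg0 l)
    (by
      intro i j hij
      rw [hg, hg]
      refine Real.sqrt_le_sqrt ?_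
      have h1 : max (-ν i) 0 ≤ max (-ν j) 0 := max_le_max (by linarith [hν hij]) le_rfl
      have h2 : 0 ≤ max (-ν i) 0 := le_max_right _ _
      nlinarith)
    (by
      rw [hG]
      congr 1
      funext l
      rw [hg, Real.mul_self_sqrt (hnn l)])
  have hVO : V ∈ Matrix.orthogonalGroup (Fin p₂) ℝ := (Matrix.mem_orthogonalGroup_iff' _ _).mpr hV
  have hZ : Z = U * rectDiag p₁ p₂ g * Vᵀ := by
    rw [← hZU, Matrix.mul_assoc, hV', Matrix.mul_one]
  have hWσ : W = V * Matrix.diagonal (fun l : Fin p₂ => σ l) * Vᵀ := by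
    rw [hWν]
    simp only [hσ]
  refine ⟨U, V, σ, g, ⟨hU, hVO, fun j _ => hσ0 j, ?_⟩, ?_, ⟨hU, hVO, fun j _ => hg0 j, hZ⟩⟩
  · have h1 : rectDiag p₁ p₂ σ = rectDiag p₁ p₂ fun j => g j * σ j := by
      ext k l
      simp only [rectDiag, Matrix.of_apply]
      split_ifs with h
      · rw [h, hg, hσ]
        rcases le_total (ν l) 0 with h0 | h0
        · rw [max_eq_right h0, mul_zero]
        · rw [max_eq_right (neg_nonpos.mpr h0)]
          simp
      · rfl
    rw [h1, ← rectDiag_mul_diagonal, ← hZW]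
    conv_lhs => rw [hZ, hWσ]
    calc _ = U * rectDiag p₁ p₂ g * (Vᵀ * V) * Matrix.diagonal (fun l : Fin p₂ => σ l) * Vᵀ := by
          simp only [Matrix.mul_assoc]
      _ = _ := by rw [hV, Matrix.mul_one]; simp only [Matrix.mul_assoc]
  · intro j hj
    have hBB : Bᵀ * B = V * Matrix.diagonal (fun l : Fin p₂ => σ l * σ l) * Vᵀ := by
      have hWt := transpose_eq_of_isHermitian hW.isHermitian
      rw [← mul_diagonal_mul_mul_self hV, ← hWσ, ← hZW, Matrix.transpose_mul, hWt]
      calc W * Zᵀ * (Z * W) = W * (Zᵀ * Z) * W := by simp only [Matrix.mul_assoc]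
        _ = W * W - W * T * T * W := by
          rw [hZZ, Matrix.mul_sub, Matrix.sub_mul, Matrix.mul_one]
          simp only [Matrix.mul_assoc]
        _ = W * W := by rw [hWT]; simp
    rw [rank_eq_card_of_gram_eq hV hBB]
    have hj2 : j < p₂ := lt_of_lt_of_le hj (min_le_right _ _)
    have h1 := fin_mem_iff_lt_card (p := fun l : Fin p₂ => σ l * σ l ≠ 0) (by
      intro a b hab hb h0
      have h2 : σ b ≤ σ a := by
        rw [hσ, hσ]
        exact max_le_max (hν hab) le_rfl
      rw [mul_self_eq_zero.mp h0] at h2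
      exact hb (by rw [le_antisymm h2 (hσ0 b), mul_zero])) ⟨j, hj2⟩
    rw [← h1]
    exact mul_self_ne_zero.symm

/-! ### The limit equations in diagonal coordinates -/

/-- The entries of a matrix indexed by natural numbers, `0` outside the range. It gives sense to the
transposed position `(l, k)` of an entry `(k, l)` of a rectangular matrix. -/
def natEntry {a b : ℕ} (D : Matrix (Fin a) (Fin b) ℝ) (k l : ℕ) : ℝ :=
  if h : k < a ∧ l < b then D ⟨k, h.1⟩ ⟨l, h.2⟩ else 0

@[simp]
theorem natEntry_val {a b : ℕ} (D : Matrix (Fin a) (Fin b) ℝ) (k : Fin a) (l : Fin b) :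
    natEntry D k l = D k l := by
  simp [natEntry]

theorem natEntry_of_le_left {a b : ℕ} (D : Matrix (Fin a) (Fin b) ℝ) {k l : ℕ} (h : a ≤ k) :
    natEntry D k l = 0 :=
  dif_neg fun h' => absurd h'.1 (not_lt.mpr h)

theorem natEntry_of_le_right {a b : ℕ} (D : Matrix (Fin a) (Fin b) ℝ) {k l : ℕ} (h : b ≤ l) :
    natEntry D k l = 0 :=
  dif_neg fun h' => absurd h'.2 (not_lt.mpr h)

theorem rectDiag_mul_apply {q : ℕ} (g : ℕ → ℝ) (K : Matrix (Fin p₂) (Fin q) ℝ) (k : Fin p₁)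
    (l : Fin q) : (rectDiag p₁ p₂ g * K) k l = g k * natEntry K k l := by
  rw [Matrix.mul_apply]
  by_cases hk : k.val < p₂
  · rw [Finset.sum_eq_single ⟨k, hk⟩]
    · simp [rectDiag, natEntry, hk]
    · intro i _ hi
      have : k.val ≠ i.val := fun h => hi (Fin.ext h.symm)
      simp [rectDiag, this]
    · simp
  · rw [natEntry_of_le_left K (not_lt.mp hk), mul_zero]
    refine Finset.sum_eq_zero fun i _ => ?_
    have : k.val ≠ i.val := by omega
    simp [rectDiag, this]

theorem transpose_mul_rectDiag_apply (g : ℕ → ℝ) (D : Matrix (Fin p₁) (Fin p₂) ℝ)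
    (k l : Fin p₂) : (Dᵀ * rectDiag p₁ p₂ g) k l = natEntry D l k * g l := by
  rw [Matrix.mul_apply]
  by_cases hl : l.val < p₁
  · rw [Finset.sum_eq_single ⟨l, hl⟩]
    · simp [rectDiag, natEntry, hl]
    · intro i _ hi
      have : i.val ≠ l.val := fun h => hi (Fin.ext h)
      simp [rectDiag, this]
    · simp
  · rw [natEntry_of_le_left D (not_lt.mp hl), zero_mul]
    refine Finset.sum_eq_zero fun i _ => ?_
    have : i.val ≠ l.val := by omega
    simp [rectDiag, this]

theorem transpose_rectDiag_mul_apply (g : ℕ → ℝ) (D : Matrix (Fin p₁) (Fin p₂) ℝ)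
    (k l : Fin p₂) : ((rectDiag p₁ p₂ g)ᵀ * D) k l = g k * natEntry D k l := by
  have := transpose_mul_rectDiag_apply g D l k
  rw [← Matrix.transpose_apply (Dᵀ * rectDiag p₁ p₂ g), Matrix.transpose_mul,
    Matrix.transpose_transpose] at this
  rw [this, mul_comm]

/-- The action of the matrix `𝒢` on an array `d`: the entry of `𝒢 d` at `(k, l)` involves only the
entries of `d` at `(k, l)` and `(l, k)`. -/
def gAct (m : ℕ) (σ g : ℕ → ℝ) (d : ℕ → ℕ → ℝ) (k l : ℕ) : ℝ :=
  if k = l then 0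
  else if k < m ∧ l < m then (d k l - d l k) / (σ k + σ l)
  else if k < m then (d k l - g l * d l k) / σ k
  else (d k l - g k * d l k) / σ l

theorem gMatrix_mulVec (m : ℕ) (σ g : ℕ → ℝ) (D : Matrix (Fin p₁) (Fin p₂) ℝ)
    (kl : EIdx p₁ p₂ m) :
    (gMatrix p₁ p₂ m σ g *ᵥ fun st => D st.1.1 st.1.2) kl =
      gAct m σ g (natEntry D) kl.1.1 kl.1.2 := by
  obtain ⟨⟨k, l⟩, hkl⟩ := kl
  simp only at hkl
  simp only [Matrix.mulVec, dotProduct, gMatrix, Matrix.of_apply]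
  by_cases hk : k.val = l.val
  · rw [gAct, if_pos hk]
    refine Finset.sum_eq_zero fun st _ => ?_
    obtain ⟨⟨s, t⟩, hst⟩ := st
    simp only
    by_cases h1 : k.val = s.val ∧ l.val = t.val
    · rw [if_pos h1, if_pos (by omega), zero_mul]
    · rw [if_neg h1, if_neg (by omega), zero_mul]
  have hother : ∀ st : EIdx p₁ p₂ m, st ≠ ⟨(k, l), hkl⟩ →
      ¬ (k.val = st.1.1.val ∧ l.val = st.1.2.val) := by
    rintro ⟨⟨s, t⟩, hst⟩ hne ⟨h1, h2⟩
    exact hne (by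
      simp only [Subtype.mk.injEq, Prod.mk.injEq]
      exact ⟨Fin.ext h1.symm, Fin.ext h2.symm⟩)
  -- The transposed position `(l, k)` need not exist when `p₁ ≠ p₂`.
  by_cases hv : l.val < p₁ ∧ k.val < p₂
  · have hsw : natEntry D l k = D ⟨l, hv.1⟩ ⟨k, hv.2⟩ := by simp [natEntry, hv]
    rw [Finset.sum_eq_add (⟨(k, l), hkl⟩ : EIdx p₁ p₂ m) ⟨(⟨l, hv.1⟩, ⟨k, hv.2⟩), hkl.symm⟩]
    · simp only [gAct, hsw, natEntry_val, and_true, if_true, hk, Ne.symm hk, false_and,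
        if_false]
      by_cases h1 : k.val < m <;> by_cases h2 : l.val < m
      · simp only [h1, h2, and_self, if_true]
        rw [add_comm (σ l)]
        ring
      · simp only [h1, h2, and_false, false_and, if_true, if_false]
        ring
      · simp only [h1, h2, and_false, false_and, if_true, if_false]
        ring
      · omega
    · intro h
      simp only [Subtype.mk.injEq, Prod.mk.injEq] at h
      exact hk (congrArg Fin.val h.1)
    · rintro st - ⟨h1, h2⟩
      rw [if_neg (hother st h1), if_neg, zero_mul]
      rintro ⟨h3, h4⟩
      apply h2
      obtain ⟨⟨s, t⟩, hst⟩ := st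
      simp only [Subtype.mk.injEq, Prod.mk.injEq]
      exact ⟨Fin.ext h4.symm, Fin.ext h3.symm⟩
    · simp
    · simp
  · have hsw : natEntry D l k = 0 := dif_neg hv
    rw [Finset.sum_eq_single (⟨(k, l), hkl⟩ : EIdx p₁ p₂ m)]
    · simp only [gAct, hsw, natEntry_val, and_true, if_true, if_neg hk, sub_zero, mul_zero]
      by_cases h1 : k.val < m <;> by_cases h2 : l.val < m
      · simp only [h1, h2, and_self, if_true]; ring
      · simp only [h1, h2, and_false, if_true, if_false]; ring
      · simp only [h1, h2, false_and, if_false]; ring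
      · omega
    · intro st _ h1
      rw [if_neg (hother st h1), if_neg, zero_mul]
      rintro ⟨h3, h4⟩
      exact hv ⟨h4 ▸ st.1.1.2, h3 ▸ st.1.2.2⟩
    · simp

/-- Singular values `σ` of rank `m`, singular values `g` of a subgradient of the nuclear norm that
are smaller than `1` where `σ` vanishes (strict complementarity), and `τ = √(1 - g²)`. All sequences
are indexed by the natural numbers and extended beyond the size of the matrices by `σ = g = 0`. -/
structure IsStrictPair (p₁ p₂ m : ℕ) (σ g τ : ℕ → ℝ) : Prop where
  le_left : m ≤ p₁
  le_right : m ≤ p₂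
  sigma_pos : ∀ j < m, 0 < σ j
  sigma_zero : ∀ j, m ≤ j → σ j = 0
  g_one : ∀ j < m, g j = 1
  tau_zero : ∀ j < m, τ j = 0
  tau_pos : ∀ j, m ≤ j → 0 < τ j
  g_zero : ∀ j, p₁ ≤ j → g j = 0
  tau_sq : ∀ j, τ j ^ 2 = 1 - g j ^ 2

/-- The linearized equations in the limit `ε → 0`, in coordinates in which all matrices are
diagonal. They confine `D` to `E`, they determine `Y` on `E` as `𝒢 D`, and they determine the
auxiliary derivatives `K` and `J` from `D` and `Y`. -/
theorem IsStrictPair.solve {m : ℕ} {σ g τ : ℕ → ℝ} (h : IsStrictPair p₁ p₂ m σ g τ)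
    {D Y : Matrix (Fin p₁) (Fin p₂) ℝ} {K J : Matrix (Fin p₂) (Fin p₂) ℝ}
    (hL : IsLinearized (Matrix.diagonal fun l : Fin p₂ => σ l)
      (Matrix.diagonal fun l : Fin p₂ => τ l) (rectDiag p₁ p₂ σ) (rectDiag p₁ p₂ g) D Y K J) :
    (∀ k l, m ≤ k.val → m ≤ l.val → D k l = 0) ∧
    (∀ k l, k.val < m ∨ l.val < m → Y k l = gAct m σ g (natEntry D) k l) ∧
    (D = 0 → Y = 0 → K = 0 ∧ J = 0) := by
  have e1 : ∀ (k : Fin p₁) (l : Fin p₂), D k l = Y k l * σ l + g k * natEntry K k l := by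
    intro k l
    have := congrFun (congrFun hL.dB_eq k) l
    rwa [Matrix.add_apply, Matrix.mul_diagonal, rectDiag_mul_apply] at this
  have e2 : ∀ k l : Fin p₂, K k l * σ l + σ k * K k l =
      natEntry D l k * σ l + σ k * natEntry D k l := by
    intro k l
    have := congrFun (congrFun hL.dW_eq k) l
    rwa [Matrix.add_apply, Matrix.mul_diagonal, Matrix.diagonal_mul, Matrix.add_apply,
      transpose_mul_rectDiag_apply, transpose_rectDiag_mul_apply] at this
  have e3 : ∀ k l : Fin p₂, J k l * σ l = -(τ k * K k l) := by
    intro k l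
    have := congrFun (congrFun hL.dT_mul k) l
    rwa [Matrix.mul_diagonal, Matrix.neg_apply, Matrix.diagonal_mul] at this
  have e4 : ∀ k l : Fin p₂, σ k * J k l = -(K k l * τ l) := by
    intro k l
    have := congrFun (congrFun hL.mul_dT k) l
    rwa [Matrix.diagonal_mul, Matrix.neg_apply, Matrix.mul_diagonal] at this
  have e5 : ∀ k l : Fin p₂, τ k * J k l + J k l * τ l =
      -(natEntry Y l k * g l + g k * natEntry Y k l) := by
    intro k l
    have := congrFun (congrFun hL.dT_eq k) l
    rwa [Matrix.add_apply, Matrix.diagonal_mul, Matrix.mul_diagonal, Matrix.neg_apply,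
      Matrix.add_apply, transpose_mul_rectDiag_apply, transpose_rectDiag_mul_apply] at this
  have hK0 : ∀ k l : Fin p₂, m ≤ k.val → m ≤ l.val → K k l = 0 := by
    intro k l hk hl
    have := e3 k l
    rw [h.sigma_zero l hl, mul_zero, eq_comm, neg_eq_zero] at this
    exact (mul_eq_zero.mp this).resolve_left (h.tau_pos k hk).ne'
  refine ⟨?_, ?_, ?_⟩
  · intro k l hk hl
    rw [e1, h.sigma_zero l hl, mul_zero, zero_add]
    by_cases hk2 : k.val < p₂
    · have := hK0 ⟨k, hk2⟩ l hk hl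
      rw [show natEntry K k l = K ⟨k, hk2⟩ l by simp [natEntry, hk2], this, mul_zero]
    · rw [natEntry_of_le_left K (not_lt.mp hk2), mul_zero]
  · intro k l hkl
    by_cases hk2 : k.val < p₂
    · have hKk : natEntry K k l = K ⟨k, hk2⟩ l := by simp [natEntry, hk2]
      have e1' := e1 k l
      rw [hKk] at e1'
      have e2' := e2 ⟨k, hk2⟩ l
      simp only [natEntry_val] at e2'
      by_cases h1 : k.val < m <;> by_cases h2 : l.val < m
      · have s1 := h.sigma_pos k h1
        have s2 := h.sigma_pos l h2
        rw [h.g_one k h1, one_mul] at e1'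
        have hK : K ⟨k, hk2⟩ l = (natEntry D l k * σ l + σ k * D k l) / (σ k + σ l) := by
          field_simp; linarith
        have hY : Y k l = (D k l - natEntry D l k) / (σ k + σ l) := by
          rw [eq_div_iff (by positivity)]
          have := e1'
          rw [hK] at this
          field_simp at this
          have h3 : σ l * (D k l - natEntry D l k - Y k l * (σ k + σ l)) = 0 := by linarith
          have := (mul_eq_zero.mp h3).resolve_left s2.ne'
          linarith
        rw [hY, gAct]
        by_cases h3 : k.val = l.val
        · rw [if_pos h3, ← h3]
          have : natEntry D k k = D k l := by
            conv_lhs => rw [show natEntry D k k = natEntry D k l by rw [h3]]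
            simp
          rw [this]; simp
        · rw [if_neg h3, if_pos ⟨h1, h2⟩, natEntry_val]
      · -- `σ l = 0` leaves `Y k l` undetermined in `e1`. It is recovered from `J`, which is known
        -- through `e4`, by way of `e5`, where the identity `τ l ^ 2 = 1 - g l ^ 2` enters.
        have s1 := h.sigma_pos k h1
        have hl := not_lt.mp h2
        have t2 := h.tau_pos l hl
        have e4' := e4 ⟨k, hk2⟩ l
        have e5' := e5 ⟨k, hk2⟩ l
        simp only [natEntry_val] at e5'
        rw [h.g_one k h1, h.sigma_zero l hl, mul_zero, zero_add, one_mul] at e1'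
        rw [h.g_one k h1, h.tau_zero k h1] at e5'
        simp only at e4'
        have hKl : K l ⟨k, hk2⟩ = D k l := by
          have e2'' := e2 l ⟨k, hk2⟩
          rw [h.sigma_zero l hl] at e2''
          simp only [natEntry_val] at e2''
          have h3 : σ k * (K l ⟨k, hk2⟩ - D k l) = 0 := by linarith
          have := (mul_eq_zero.mp h3).resolve_left s1.ne'
          linarith
        have hlk : natEntry Y l k * σ k = natEntry D l k - g l * D k l := by
          by_cases hl1 : l.val < p₁
          · have e1'' := e1 ⟨l, hl1⟩ ⟨k, hk2⟩
            rw [show natEntry K l k = K l ⟨k, hk2⟩ by simp [natEntry, hk2], hKl] at e1''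
            simp only [natEntry, hl1, hk2, and_self, dif_pos]
            linarith
          · rw [natEntry_of_le_left Y (not_lt.mp hl1), natEntry_of_le_left D (not_lt.mp hl1),
              h.g_zero l (not_lt.mp hl1)]
            simp
        rw [gAct, if_neg (by omega), if_neg (by omega), if_pos h1, natEntry_val,
          eq_div_iff s1.ne']
        have hsq := h.tau_sq l
        rw [← e1'] at e4'
        linear_combination (σ k) * e5' - (τ l) * e4' - g l * hlk + (D k l) * hsq
      · have s2 := h.sigma_pos l h2
        have hk := not_lt.mp h1
        rw [h.sigma_zero k hk] at e2'
        have hK : K ⟨k, hk2⟩ l = natEntry D l k := by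
          have h3 : σ l * (K ⟨k, hk2⟩ l - natEntry D l k) = 0 := by linarith
          have := (mul_eq_zero.mp h3).resolve_left s2.ne'
          linarith
        rw [gAct, if_neg (by omega), if_neg (by omega), if_neg h1, eq_div_iff s2.ne', natEntry_val,
          ← hK]
        linarith
      · omega
    · have hl : l.val < m := by have := h.le_right; omega
      have s2 := h.sigma_pos l hl
      have e1' := e1 k l
      rw [natEntry_of_le_left K (not_lt.mp hk2), mul_zero, add_zero] at e1'
      have := h.le_right
      rw [gAct, if_neg (by omega), if_neg (by omega), if_neg (by omega), natEntry_val,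
        natEntry_of_le_right D (not_lt.mp hk2), mul_zero, sub_zero, e1', mul_div_assoc,
        div_self s2.ne', mul_one]
  · intro hD hY
    have hn : ∀ a b, natEntry D a b = 0 := fun a b => by simp [natEntry, hD]
    have hnY : ∀ a b, natEntry Y a b = 0 := fun a b => by simp [natEntry, hY]
    have hK : ∀ k l, K k l = 0 := by
      intro k l
      by_cases hkl : m ≤ k.val ∧ m ≤ l.val
      · exact hK0 k l hkl.1 hkl.2
      · have := e2 k l
        rw [hn, hn] at this
        have hpos : 0 < σ l + σ k := by
          rcases lt_or_ge k.val m with h1 | h1 <;> rcases lt_or_ge l.val m with h2 | h2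
          · have := h.sigma_pos k h1; have := h.sigma_pos l h2; linarith
          · have := h.sigma_pos k h1; have := h.sigma_zero l h2; linarith
          · have := h.sigma_zero k h1; have := h.sigma_pos l h2; linarith
          · omega
        have h3 : (σ l + σ k) * K k l = 0 := by linarith
        exact (mul_eq_zero.mp h3).resolve_left hpos.ne'
    refine ⟨by ext k l; exact hK k l, ?_⟩
    ext k l
    rcases lt_or_ge k.val m with h1 | h1
    · have := e4 k l
      rw [hK, zero_mul, neg_zero] at this
      exact (mul_eq_zero.mp this).resolve_left (h.sigma_pos k h1).ne'
    · have := e5 k l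
      rw [hnY, hnY] at this
      have hpos : 0 < τ k + τ l := by
        have h2 := h.tau_pos k h1
        rcases lt_or_ge l.val m with h3 | h3
        · rw [h.tau_zero l h3]; linarith
        · have := h.tau_pos l h3; linarith
      have h3 : (τ k + τ l) * J k l = 0 := by linarith
      exact (mul_eq_zero.mp h3).resolve_left hpos.ne'

/-! ### The quadratic form of `𝒢` -/

/-- The matrix with the entries `v` on `E` and `0` elsewhere. -/
def onE (m : ℕ) (v : EIdx p₁ p₂ m → ℝ) : Matrix (Fin p₁) (Fin p₂) ℝ :=
  Matrix.of fun k l => if h : k.val < m ∨ l.val < m then v ⟨(k, l), h⟩ else 0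

theorem onE_apply {m : ℕ} (v : EIdx p₁ p₂ m → ℝ) (kl : EIdx p₁ p₂ m) :
    onE m v kl.1.1 kl.1.2 = v kl := by
  obtain ⟨⟨k, l⟩, h⟩ := kl
  simp [onE, h]

theorem onE_eq_zero {m : ℕ} (v : EIdx p₁ p₂ m → ℝ) {k : Fin p₁} {l : Fin p₂} (hk : m ≤ k.val)
    (hl : m ≤ l.val) : onE m v k l = 0 := by
  simp [onE, not_lt.mpr hk, not_lt.mpr hl]

theorem sum_eidx_eq_sum {m : ℕ} {D : Matrix (Fin p₁) (Fin p₂) ℝ}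
    (hD : ∀ k l, m ≤ k.val → m ≤ l.val → D k l = 0) (f : Fin p₁ → Fin p₂ → ℝ) :
    ∑ kl : EIdx p₁ p₂ m, f kl.1.1 kl.1.2 * D kl.1.1 kl.1.2 = ∑ k, ∑ l, f k l * D k l := by
  refine (Finset.sum_subtype
    (Finset.univ.filter fun kl : Fin p₁ × Fin p₂ => kl.1.val < m ∨ kl.2.val < m) (by simp)
    (fun kl => f kl.1 kl.2 * D kl.1 kl.2)).symm.trans ?_
  refine (Finset.sum_filter_of_ne ?_).trans (Fintype.sum_prod_type _)
  intro kl _ hne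
  by_contra hkl
  simp only [not_or, not_lt] at hkl
  exact hne (by rw [hD _ _ hkl.1 hkl.2, mul_zero])

theorem mInner_mul_mul (A D : Matrix (Fin p₁) (Fin p₂) ℝ) (U : Matrix (Fin p₁) (Fin p₁) ℝ)
    (V : Matrix (Fin p₂) (Fin p₂) ℝ) : mInner (Uᵀ * A * V) D = mInner A (U * D * Vᵀ) := by
  rw [mInner, mInner, Matrix.transpose_mul, Matrix.transpose_mul, Matrix.transpose_transpose,
    Matrix.mul_assoc, Matrix.trace_mul_comm]
  simp only [Matrix.mul_assoc]

theorem designE_mulVec (X : Fin n → Matrix (Fin p₁) (Fin p₂) ℝ) (U : Matrix (Fin p₁) (Fin p₁) ℝ)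
    (V : Matrix (Fin p₂) (Fin p₂) ℝ) {m : ℕ} {D : Matrix (Fin p₁) (Fin p₂) ℝ}
    (hD : ∀ k l, m ≤ k.val → m ≤ l.val → D k l = 0) (j : Fin n) :
    (designE X U V m *ᵥ fun kl => D kl.1.1 kl.1.2) j = mInner (X j) (U * D * Vᵀ) := by
  rw [← mInner_mul_mul, mInner_eq_sum]
  exact sum_eidx_eq_sum hD fun k l => (Uᵀ * X j * V) k l

theorem natEntry_eq_zero_of_le {m : ℕ} {D : Matrix (Fin p₁) (Fin p₂) ℝ}
    (hD : ∀ k l, m ≤ k.val → m ≤ l.val → D k l = 0) {k l : ℕ} (hk : m ≤ k) (hl : m ≤ l) :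
    natEntry D k l = 0 := by
  unfold natEntry
  split_ifs with h
  · exact hD _ _ hk hl
  · rfl

theorem sum_natEntry (D : Matrix (Fin p₁) (Fin p₂) ℝ) (f : ℕ → ℕ → ℝ) {N : ℕ} (h1 : p₁ ≤ N)
    (h2 : p₂ ≤ N) : ∑ k : Fin p₁, ∑ l : Fin p₂, f k l * D k l =
      ∑ k ∈ Finset.range N, ∑ l ∈ Finset.range N, f k l * natEntry D k l := by
  rw [← Finset.sum_subset (Finset.range_mono h1)
    (f := fun k => ∑ l ∈ Finset.range N, f k l * natEntry D k l), Finset.sum_range]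
  · refine Finset.sum_congr rfl fun k _ => ?_
    rw [← Finset.sum_subset (Finset.range_mono h2) (f := fun l => f k l * natEntry D k l),
      Finset.sum_range]
    · simp
    · intro l _ hl
      rw [natEntry_of_le_right D (by simpa using hl), mul_zero]
  · intro k _ hk
    refine Finset.sum_eq_zero fun l _ => ?_
    rw [natEntry_of_le_left D (by simpa using hk), mul_zero]

/-- The contributions of `(k, l)` and `(l, k)` to the quadratic form of `𝒢` together are
nonnegative: they equal `(x - y)² / (σ k + σ l)` inside the `m × m` block, and
`(x² + y² - 2 g x y) / σ` with `g < 1` outside. -/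
theorem gAct_pair {m : ℕ} {σ g τ : ℕ → ℝ} (h : IsStrictPair p₁ p₂ m σ g τ)
    {d : ℕ → ℕ → ℝ} (hd : ∀ k l, m ≤ k → m ≤ l → d k l = 0) (k l : ℕ) :
    0 ≤ gAct m σ g d k l * d k l + gAct m σ g d l k * d l k ∧
      (gAct m σ g d k l * d k l + gAct m σ g d l k * d l k = 0 →
        d k l = d l k ∧ (m ≤ k ∨ m ≤ l → d k l = 0)) := by
  by_cases hkl : k = l
  · subst hkl
    simp only [gAct, if_true]
    refine ⟨by simp, fun _ => ⟨trivial, fun hk => hd k k ?_ ?_⟩⟩ <;> omega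
  have hlk : ¬ l = k := fun h => hkl h.symm
  have hgt : ∀ j, m ≤ j → g j ^ 2 < 1 := by
    intro j hj
    have := h.tau_sq j
    have := h.tau_pos j hj
    nlinarith
  -- `(x² + y² - 2 g x y)` is positive definite when `g² < 1`
  have key : ∀ s a x y : ℝ, 0 < s → a ^ 2 < 1 →
      0 ≤ (x - a * y) / s * x + (y - a * x) / s * y ∧
      ((x - a * y) / s * x + (y - a * x) / s * y = 0 → x = 0 ∧ y = 0) := by
    intro s a x y hs ha
    have e : (x - a * y) / s * x + (y - a * x) / s * y =
        ((x - a * y) ^ 2 + (1 - a ^ 2) * y ^ 2) / s := by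
      field_simp; ring
    have ha' : 0 < 1 - a ^ 2 := by linarith
    rw [e]
    refine ⟨by positivity, fun h0 => ?_⟩
    have h1 : (x - a * y) ^ 2 + (1 - a ^ 2) * y ^ 2 = 0 := by
      rcases div_eq_zero_iff.mp h0 with h | h
      · exact h
      · exact absurd h hs.ne'
    have h2 : 0 ≤ (1 - a ^ 2) * y ^ 2 := by positivity
    have h3 : (1 - a ^ 2) * y ^ 2 = 0 := by nlinarith [sq_nonneg (x - a * y)]
    have hy : y = 0 := by
      have := (mul_eq_zero.mp h3).resolve_left ha'.ne'
      exact pow_eq_zero_iff two_ne_zero |>.mp this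
    subst hy
    refine ⟨?_, rfl⟩
    have : x ^ 2 = 0 := by nlinarith
    exact pow_eq_zero_iff two_ne_zero |>.mp this
  simp only [gAct, if_neg hkl, if_neg hlk]
  by_cases h1 : k < m <;> by_cases h2 : l < m
  · simp only [h1, h2, and_self, if_true]
    have s1 := h.sigma_pos k h1
    have s2 := h.sigma_pos l h2
    have e : (d k l - d l k) / (σ k + σ l) * d k l + (d l k - d k l) / (σ l + σ k) * d l k =
        (d k l - d l k) ^ 2 / (σ k + σ l) := by
      rw [add_comm (σ l)]; ring
    rw [e]
    refine ⟨by positivity, fun h0 => ⟨?_, fun h3 => by omega⟩⟩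
    have hpos : 0 < σ k + σ l := by positivity
    have := (div_eq_zero_iff.mp h0).resolve_right hpos.ne'
    linarith [pow_eq_zero_iff two_ne_zero |>.mp this]
  · simp only [h1, h2, and_false, false_and, if_true, if_false]
    have := key (σ k) (g l) (d k l) (d l k) (h.sigma_pos k h1) (hgt l (not_lt.mp h2))
    refine ⟨this.1, fun h0 => ?_⟩
    obtain ⟨h3, h4⟩ := this.2 h0
    exact ⟨by rw [h3, h4], fun _ => h3⟩
  · simp only [h1, h2, and_false, false_and, if_true, if_false]
    have := key (σ l) (g k) (d k l) (d l k) (h.sigma_pos l h2) (hgt k (not_lt.mp h1))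
    refine ⟨this.1, fun h0 => ?_⟩
    obtain ⟨h3, h4⟩ := this.2 h0
    exact ⟨by rw [h3, h4], fun _ => h3⟩
  · rw [hd k l (not_lt.mp h1) (not_lt.mp h2), hd l k (not_lt.mp h2) (not_lt.mp h1)]
    simp

/-- The quadratic form of `𝒢` is positive semidefinite; its kernel consists of the symmetric
matrices supported in the `m × m` block. -/
theorem gMatrix_quadraticForm {m : ℕ} {σ g τ : ℕ → ℝ} (h : IsStrictPair p₁ p₂ m σ g τ)
    {D : Matrix (Fin p₁) (Fin p₂) ℝ} (hD : ∀ k l, m ≤ k.val → m ≤ l.val → D k l = 0) :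
    0 ≤ (gMatrix p₁ p₂ m σ g *ᵥ fun st => D st.1.1 st.1.2) ⬝ᵥ (fun st => D st.1.1 st.1.2) ∧
    ((gMatrix p₁ p₂ m σ g *ᵥ fun st => D st.1.1 st.1.2) ⬝ᵥ (fun st => D st.1.1 st.1.2) = 0 →
      ∀ k l : ℕ, natEntry D k l = natEntry D l k ∧ (m ≤ k ∨ m ≤ l → natEntry D k l = 0)) := by
  set N := p₁ + p₂
  set F : ℕ → ℕ → ℝ := fun k l => gAct m σ g (natEntry D) k l * natEntry D k l with hF
  have hd : ∀ k l, m ≤ k → m ≤ l → natEntry D k l = 0 := fun k l => natEntry_eq_zero_of_le hD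
  have e1 : (gMatrix p₁ p₂ m σ g *ᵥ fun st => D st.1.1 st.1.2) ⬝ᵥ (fun st => D st.1.1 st.1.2) =
      ∑ k ∈ Finset.range N, ∑ l ∈ Finset.range N, F k l := by
    rw [dotProduct]
    simp only [gMatrix_mulVec]
    rw [sum_eidx_eq_sum hD (fun k l => gAct m σ g (natEntry D) k l),
      sum_natEntry D (gAct m σ g (natEntry D)) (Nat.le_add_right p₁ p₂) (Nat.le_add_left p₂ p₁)]
  have e2 : 2 * ∑ k ∈ Finset.range N, ∑ l ∈ Finset.range N, F k l =
      ∑ k ∈ Finset.range N, ∑ l ∈ Finset.range N, (F k l + F l k) := by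
    simp only [Finset.sum_add_distrib]
    rw [Finset.sum_comm (f := fun k l => F l k)]
    ring
  have hpos : ∀ k l, 0 ≤ F k l + F l k := fun k l => (gAct_pair h hd k l).1
  have e3 : 0 ≤ ∑ k ∈ Finset.range N, ∑ l ∈ Finset.range N, (F k l + F l k) :=
    Finset.sum_nonneg fun k _ => Finset.sum_nonneg fun l _ => hpos k l
  rw [e1]
  refine ⟨by linarith, fun h0 k l => ?_⟩
  rw [h0, mul_zero] at e2
  by_cases hkl : k < N ∧ l < N
  · have h1 := (Finset.sum_eq_zero_iff_of_nonneg fun k _ =>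
      Finset.sum_nonneg fun l _ => hpos k l).mp e2.symm k (Finset.mem_range.mpr hkl.1)
    have h2 := (Finset.sum_eq_zero_iff_of_nonneg fun l _ => hpos k l).mp h1 l
      (Finset.mem_range.mpr hkl.2)
    exact (gAct_pair h hd k l).2 h2
  · have h1 : natEntry D k l = 0 := dif_neg (by omega)
    have h2 : natEntry D l k = 0 := dif_neg (by omega)
    rw [h1, h2]
    simp

/-! ### Strict complementarity in adapted coordinates -/

/-- Orthogonal matrices `U`, `V` diagonalizing `B`, `Z`, `W` and `T` at the same time, with strictly
complementary singular values. -/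
structure IsAdapted (B Z : Matrix (Fin p₁) (Fin p₂) ℝ) (W T : Matrix (Fin p₂) (Fin p₂) ℝ)
    (U : Matrix (Fin p₁) (Fin p₁) ℝ) (V : Matrix (Fin p₂) (Fin p₂) ℝ) (m : ℕ) (σ g τ : ℕ → ℝ) :
    Prop where
  left_mul : Uᵀ * U = 1
  right_mul : Vᵀ * V = 1
  pair : IsStrictPair p₁ p₂ m σ g τ
  B_eq : B = U * rectDiag p₁ p₂ σ * Vᵀ
  Z_eq : Z = U * rectDiag p₁ p₂ g * Vᵀ
  W_eq : W = V * Matrix.diagonal (fun l : Fin p₂ => σ l) * Vᵀ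
  T_eq : T = V * Matrix.diagonal (fun l : Fin p₂ => τ l) * Vᵀ

theorem gram_eq_of_eq_mul {B : Matrix (Fin p₁) (Fin p₂) ℝ} {U : Matrix (Fin p₁) (Fin p₁) ℝ}
    {V : Matrix (Fin p₂) (Fin p₂) ℝ} {s : ℕ → ℝ} (hU : Uᵀ * U = 1) (hs : ∀ j, p₁ ≤ j → s j = 0)
    (h : B = U * rectDiag p₁ p₂ s * Vᵀ) :
    Bᵀ * B = V * Matrix.diagonal (fun l : Fin p₂ => s l * s l) * Vᵀ := by
  have h1 : (rectDiag p₁ p₂ s)ᵀ * rectDiag p₁ p₂ s =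
      Matrix.diagonal (fun l : Fin p₂ => s l * s l) := by
    ext k l
    rw [transpose_mul_rectDiag_apply, Matrix.diagonal_apply]
    unfold natEntry
    split_ifs with h1 h2 h2
    · simp [rectDiag, h2]
    · have : l.val ≠ k.val := fun h => h2 (Fin.ext h.symm)
      simp [rectDiag, this]
    · have : p₁ ≤ k.val := by
        by_contra h3
        exact h1 ⟨by rw [← h2]; omega, k.2⟩
      rw [hs _ this, zero_mul, zero_mul]
    · rw [zero_mul]
  rw [h, ← h1]
  simp only [Matrix.transpose_mul, Matrix.transpose_transpose]
  calc _ = V * (rectDiag p₁ p₂ s)ᵀ * (Uᵀ * U) * rectDiag p₁ p₂ s * Vᵀ := by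
        simp only [Matrix.mul_assoc]
    _ = _ := by rw [hU, Matrix.mul_one]; simp only [Matrix.mul_assoc]

theorem eq_of_mul_diagonal_mul_eq {k : ℕ} {V : Matrix (Fin k) (Fin k) ℝ} (hV : Vᵀ * V = 1)
    {a b : Matrix (Fin k) (Fin k) ℝ} (h : V * a * Vᵀ = V * b * Vᵀ) : a = b := by
  have h1 : Vᵀ * (V * a * Vᵀ) * V = Vᵀ * (V * b * Vᵀ) * V := by rw [h]
  have h2 : ∀ c : Matrix (Fin k) (Fin k) ℝ, Vᵀ * (V * c * Vᵀ) * V = c := by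
    intro c
    calc _ = (Vᵀ * V) * c * (Vᵀ * V) := by simp only [Matrix.mul_assoc]
      _ = c := by rw [hV, Matrix.one_mul, Matrix.mul_one]
  rwa [h2, h2] at h1

/-- Every simultaneous singular value decomposition of `B` and the subgradient `Z` also diagonalizes
`W = |B|` and `T = √(1 - Zᵀ Z)`, by uniqueness of positive square roots. That `g = 1` where `σ ≠ 0`
follows from `W T = 0`. -/
theorem exists_isAdapted {B Z : Matrix (Fin p₁) (Fin p₂) ℝ} {T : Matrix (Fin p₂) (Fin p₂) ℝ}
    {U : Matrix (Fin p₁) (Fin p₁) ℝ} {V : Matrix (Fin p₂) (Fin p₂) ℝ} {σ g : ℕ → ℝ}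
    (hB : IsSVD B U V σ) (hσ : ∀ j < min p₁ p₂, (σ j ≠ 0 ↔ j < B.rank)) (hZ : IsSVD Z U V g)
    (hg : ∀ j < min p₁ p₂, σ j = 0 → g j < 1) (hT : T.PosSemidef) (hZZ : Zᵀ * Z = 1 - T * T)
    (hWT : modulus 0 B * T = 0) :
    ∃ σ' g' τ, IsAdapted B Z (modulus 0 B) T U V B.rank σ' g' τ ∧
      gMatrix p₁ p₂ B.rank σ' g' = gMatrix p₁ p₂ B.rank σ g := by
  set m := B.rank with hm
  have hm1 : m ≤ p₁ := Matrix.rank_le_height B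
  have hm2 : m ≤ p₂ := Matrix.rank_le_width B
  have hU : Uᵀ * U = 1 := (Matrix.mem_orthogonalGroup_iff' _ _).mp hB.left_orthogonal
  have hV : Vᵀ * V = 1 := (Matrix.mem_orthogonalGroup_iff' _ _).mp hB.right_orthogonal
  have hV' : V * Vᵀ = 1 := mul_eq_one_comm.mp hV
  -- Only the first `min p₁ p₂` entries of `σ` and `g` carry information; the others become `0`.
  let clip : (ℕ → ℝ) → ℕ → ℝ := fun s j => if j < min p₁ p₂ then s j else 0
  have clip_lt : ∀ s j, j < min p₁ p₂ → clip s j = s j := fun s j hj => if_pos hj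
  have clip_ge : ∀ s j, min p₁ p₂ ≤ j → clip s j = 0 := fun s j hj => if_neg (not_lt.mpr hj)
  have hrect : ∀ s, rectDiag p₁ p₂ (clip s) = rectDiag p₁ p₂ s := by
    intro s
    ext k l
    simp only [rectDiag, Matrix.of_apply]
    split_ifs with h
    · exact clip_lt _ _ (lt_min k.2 (h ▸ l.2))
    · rfl
  set σ' := clip σ with hσ'
  set g' := clip g with hg'
  set τ : ℕ → ℝ := fun j => Real.sqrt (1 - g' j ^ 2) with hτ
  have hg'0 : ∀ j, p₁ ≤ j → g' j = 0 := fun j hj => clip_ge _ _ ((min_le_left _ _).trans hj)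
  have hσ'0 : ∀ j, p₁ ≤ j → σ' j = 0 := fun j hj => clip_ge _ _ ((min_le_left _ _).trans hj)
  have hBeq : B = U * rectDiag p₁ p₂ σ' * Vᵀ := by rw [hrect]; exact hB.eq_mul
  have hZeq : Z = U * rectDiag p₁ p₂ g' * Vᵀ := by rw [hrect]; exact hZ.eq_mul
  have hσnn : ∀ j, 0 ≤ σ' j := by
    intro j
    rcases lt_or_ge j (min p₁ p₂) with h | h
    · rw [hσ', clip_lt _ _ h]; exact hB.nonneg j h
    · rw [hσ', clip_ge _ _ h]
  have hgnn : ∀ j, 0 ≤ g' j := by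
    intro j
    rcases lt_or_ge j (min p₁ p₂) with h | h
    · rw [hg', clip_lt _ _ h]; exact hZ.nonneg j h
    · rw [hg', clip_ge _ _ h]
  have hW : modulus 0 B = V * Matrix.diagonal (fun l : Fin p₂ => σ' l) * Vᵀ := by
    symm
    apply eq_modulus (posSemidef_mul_diagonal_mul V fun l => hσnn l)
    rw [mul_diagonal_mul_mul_self hV, gram_eq_of_eq_mul hU hσ'0 hBeq]
    simp
  have hTT : T * T = V * Matrix.diagonal (fun l : Fin p₂ => 1 - g' l * g' l) * Vᵀ := by
    have h1 : T * T = 1 - Zᵀ * Z := by rw [hZZ]; abel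
    rw [h1, gram_eq_of_eq_mul hU hg'0 hZeq, ← Matrix.diagonal_sub, Matrix.mul_sub, Matrix.sub_mul,
      show Matrix.diagonal (fun _ : Fin p₂ => (1 : ℝ)) = 1 from Matrix.diagonal_one, Matrix.mul_one,
      hV']
  have hg1 : ∀ j, 0 ≤ 1 - g' j ^ 2 := by
    intro j
    rcases lt_or_ge j p₂ with h | h
    · have h1 : (T * V)ᵀ * (T * V) = Matrix.diagonal (fun l : Fin p₂ => 1 - g' l * g' l) := by
        rw [Matrix.transpose_mul, transpose_eq_of_isHermitian hT.isHermitian, Matrix.mul_assoc,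
          ← Matrix.mul_assoc T, hTT]
        calc _ = (Vᵀ * V) * Matrix.diagonal (fun l : Fin p₂ => 1 - g' l * g' l) * (Vᵀ * V) := by
              simp only [Matrix.mul_assoc]
          _ = _ := by rw [hV, Matrix.one_mul, Matrix.mul_one]
      have h2 := congrFun (congrFun h1 ⟨j, h⟩) ⟨j, h⟩
      rw [Matrix.diagonal_apply_eq, Matrix.mul_apply] at h2
      rw [sq, ← h2]
      exact Finset.sum_nonneg fun i _ => mul_self_nonneg _
    · rw [hg', clip_ge _ _ ((min_le_right _ _).trans h)]
      norm_num
  have hτsq : ∀ j, τ j ^ 2 = 1 - g' j ^ 2 := fun j => Real.sq_sqrt (hg1 j)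
  have hTeq : T = V * Matrix.diagonal (fun l : Fin p₂ => τ l) * Vᵀ := by
    refine posSemidef_eq_of_mul_self_eq hT
      (posSemidef_mul_diagonal_mul V fun l => Real.sqrt_nonneg _) ?_
    rw [mul_diagonal_mul_mul_self hV, hTT]
    congr 3
    funext l
    rw [← sq, ← sq, hτsq]
  have hστ : ∀ j < p₂, σ' j * τ j = 0 := by
    intro j hj
    have h1 := hWT
    rw [hW, hTeq, mul_diagonal_mul_mul_self hV] at h1
    have h2 : V * Matrix.diagonal (fun l : Fin p₂ => σ' l * τ l) * Vᵀ = V * 0 * Vᵀ := by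
      rw [h1]; simp
    have h3 := congrFun (congrFun (eq_of_mul_diagonal_mul_eq hV h2) ⟨j, hj⟩) ⟨j, hj⟩
    rwa [Matrix.diagonal_apply_eq] at h3
  have hpos : ∀ j < m, 0 < σ' j := by
    intro j hj
    have hj' : j < min p₁ p₂ := by omega
    refine lt_of_le_of_ne (hσnn j) (Ne.symm ?_)
    rw [hσ', clip_lt _ _ hj']
    exact (hσ j hj').mpr hj
  have hτ0 : ∀ j < m, τ j = 0 := fun j hj =>
    (mul_eq_zero.mp (hστ j (by omega))).resolve_left (hpos j hj).ne'
  refine ⟨σ', g', τ, ⟨hU, hV, ⟨hm1, hm2, hpos, ?_, ?_, hτ0, ?_, hg'0, hτsq⟩, hBeq, hZeq, hW, hTeq⟩,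
    ?_⟩
  · intro j hj
    rcases lt_or_ge j (min p₁ p₂) with h | h
    · rw [hσ', clip_lt _ _ h]
      by_contra hne
      exact absurd ((hσ j h).mp hne) (not_lt.mpr hj)
    · exact clip_ge _ _ h
  · intro j hj
    have h1 := hτsq j
    rw [hτ0 j hj] at h1
    nlinarith [hgnn j]
  · intro j hj
    refine lt_of_le_of_ne (Real.sqrt_nonneg _) fun h0 => ?_
    have h1 := hτsq j
    have h0' : τ j = 0 := h0.symm
    rw [h0'] at h1
    have h2 : g' j = 1 := by nlinarith [hgnn j]
    rcases lt_or_ge j (min p₁ p₂) with h | h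
    · have h3 : σ j = 0 := by
        by_contra hne
        exact absurd ((hσ j h).mp hne) (not_lt.mpr hj)
      have := hg j h h3
      rw [hg', clip_lt _ _ h] at h2
      linarith
    · rw [hg', clip_ge _ _ h] at h2
      norm_num at h2
  · -- An entry of `𝒢` involving an index beyond `min p₁ p₂` is one without a transposed partner,
    -- so the clipped value does not occur in it.
    ext ⟨⟨k, l⟩, hkl⟩ ⟨⟨s, t⟩, hst⟩
    have hs1 := s.2
    have ht1 := t.2
    have hk1 := k.2
    have hl1 := l.2
    simp only [gMatrix, Matrix.of_apply]
    simp only at hst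
    by_cases hs : s.val < min p₁ p₂ <;> by_cases ht : t.val < min p₁ p₂
    · rw [hσ', hg', clip_lt _ _ hs, clip_lt _ _ hs, clip_lt _ _ ht, clip_lt _ _ ht]
    · have h1 : ¬ (k.val = t.val ∧ l.val = s.val) := by omega
      have h2 : ¬ t.val < m := by omega
      have h3 : s.val < m := by omega
      simp only [h1, h2, h3, and_false, if_false, if_true]
      rw [hσ', clip_lt _ _ hs]
    · have h1 : ¬ (k.val = t.val ∧ l.val = s.val) := by omega
      have h2 : ¬ s.val < m := by omega
      simp only [h1, h2, false_and, if_false]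
      rw [hσ', clip_lt _ _ ht]
    · omega

/-! ### Invertibility of the Gram matrix -/

theorem eventually_posSemidef_diagonal_add_smul {k m : ℕ} {σ : ℕ → ℝ} (hσ : ∀ j < m, 0 < σ j)
    (hσ0 : ∀ j, m ≤ j → σ j = 0) {S : Matrix (Fin k) (Fin k) ℝ} (hS : Sᵀ = S)
    (hSm : ∀ i j : Fin k, m ≤ i.val ∨ m ≤ j.val → S i j = 0) :
    ∀ᶠ t : ℝ in 𝓝[>] 0, (Matrix.diagonal (fun l : Fin k => σ l) + t • S).PosSemidef := by
  obtain ⟨P, ν, hP, hP', -, hν⟩ := exists_antitone_diagonalization (S := S)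
    (by rw [Matrix.IsHermitian, Matrix.conjTranspose_eq_transpose_of_trivial, hS])
  -- `C` bounds the eigenvalues of `-S`, and `diag[σ] + t S` dominates `diag[σ - t C]` on the first
  -- `m` coordinates.
  set C := ∑ l, |ν l| with hC
  have hCν : ∀ l, 0 ≤ C + ν l := by
    intro l
    have := Finset.single_le_sum (f := fun l => |ν l|) (fun l _ => abs_nonneg _) (Finset.mem_univ l)
    have := neg_abs_le (ν l)
    linarith
  have hCS : (C • (1 : Matrix (Fin k) (Fin k) ℝ) + S).PosSemidef := by
    have h1 := posSemidef_mul_diagonal_mul P hCν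
    have h2 : P * Matrix.diagonal (fun l => C + ν l) * Pᵀ = C • 1 + S := by
      rw [← Matrix.diagonal_add, Matrix.mul_add, Matrix.add_mul, ← hν,
        ← Matrix.smul_one_eq_diagonal, Matrix.mul_smul, Matrix.mul_one, Matrix.smul_mul, hP']
    rwa [h2] at h1
  let Q : Matrix (Fin k) (Fin k) ℝ := Matrix.diagonal fun l => if l.val < m then 1 else 0
  have hQt : Qᴴ = Q := by
    rw [Matrix.conjTranspose_eq_transpose_of_trivial]; exact Matrix.diagonal_transpose _
  have hQ := hCS.conjTranspose_mul_mul_same Q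
  rw [hQt] at hQ
  have hall : ∀ᶠ t : ℝ in 𝓝[>] 0, ∀ j ∈ Finset.range m, t * C ≤ σ j := by
    rw [Filter.eventually_all_finset]
    intro j hj
    have h1 : Tendsto (fun t : ℝ => t * C) (𝓝[>] 0) (𝓝 (0 * C)) :=
      (tendsto_nhdsWithin_of_tendsto_nhds tendsto_id).mul_const C
    rw [zero_mul] at h1
    filter_upwards [h1.eventually (gt_mem_nhds (hσ j (Finset.mem_range.mp hj)))] with t ht
    exact ht.le
  filter_upwards [hall, self_mem_nhdsWithin] with t ht ht0
  have ht0' : (0 : ℝ) < t := ht0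
  have h1 : (Matrix.diagonal fun l : Fin k => if l.val < m then σ l - t * C else 0).PosSemidef := by
    refine Matrix.PosSemidef.diagonal fun l => ?_
    simp only [Pi.zero_apply]
    split_ifs with h
    · linarith [ht l (Finset.mem_range.mpr h)]
    · exact le_rfl
  have h2 : Matrix.diagonal (fun l : Fin k => σ l) + t • S =
      (Matrix.diagonal fun l : Fin k => if l.val < m then σ l - t * C else 0) +
        t • (Q * (C • 1 + S) * Q) := by
    ext i j
    simp only [Q, Matrix.add_apply, Matrix.smul_apply, Matrix.mul_diagonal, Matrix.diagonal_mul,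
      Matrix.diagonal_apply, Matrix.one_apply, smul_eq_mul]
    by_cases hij : i = j
    · subst hij
      by_cases hi : i.val < m
      · simp [hi]; ring
      · simp [hi, hSm i i (Or.inl (not_lt.mp hi)), hσ0 i (not_lt.mp hi)]
    · by_cases hi : i.val < m
      · by_cases hj : j.val < m
        · simp [hi, hj, hij]
        · simp [hij, hj, hSm i j (Or.inr (not_lt.mp hj))]
      · simp [hij, hi, hSm i j (Or.inl (not_lt.mp hi))]
  rw [h2]
  exact h1.add (hQ.smul ht0'.le)

/-- If the core `A` of `U A Vᵀ` is a positive semidefinite matrix `M` in its `m × m` block and `0`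
elsewhere, then the nuclear norm is the trace of `M`, hence linear in such `A`. -/
theorem nuclearNorm_eq_trace_of_posSemidef {m : ℕ} (hm1 : m ≤ p₁)
    {U : Matrix (Fin p₁) (Fin p₁) ℝ} {V : Matrix (Fin p₂) (Fin p₂) ℝ} (hU : Uᵀ * U = 1)
    (hV : Vᵀ * V = 1) {M : Matrix (Fin p₂) (Fin p₂) ℝ} (hM : M.PosSemidef)
    (hM0 : ∀ i j : Fin p₂, m ≤ i.val ∨ m ≤ j.val → M i j = 0)
    {A : Matrix (Fin p₁) (Fin p₂) ℝ} (hA : ∀ k l, A k l = natEntry M k l) :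
    nuclearNorm (U * A * Vᵀ) = M.trace := by
  have hMt := transpose_eq_of_isHermitian hM.isHermitian
  have hι : A = rectDiag p₁ p₂ (fun _ => 1) * M := by
    ext k l
    rw [rectDiag_mul_apply, one_mul, hA]
  have hιA : (rectDiag p₁ p₂ fun _ => 1)ᵀ * A = M := by
    ext k l
    rw [transpose_rectDiag_mul_apply, one_mul]
    by_cases hk : k.val < p₁
    · simp [natEntry, hk, hA]
    · rw [natEntry_of_le_left A (not_lt.mp hk), hM0 k l (Or.inl (by omega))]
  have hAA : Aᵀ * A = M * M := by
    nth_rewrite 1 [hι]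
    rw [Matrix.transpose_mul, hMt, Matrix.mul_assoc, hιA]
  have hW : V * M * Vᵀ = modulus 0 (U * A * Vᵀ) := by
    apply eq_modulus
    · have := hM.mul_mul_conjTranspose_same V
      rwa [Matrix.conjTranspose_eq_transpose_of_trivial] at this
    · calc V * M * Vᵀ * (V * M * Vᵀ) = V * M * (Vᵀ * V) * M * Vᵀ := by simp only [Matrix.mul_assoc]
        _ = V * (M * M) * Vᵀ := by rw [hV, Matrix.mul_one]; simp only [Matrix.mul_assoc]
        _ = V * Aᵀ * (Uᵀ * U) * A * Vᵀ := by
          rw [hU, Matrix.mul_one, ← hAA]; simp only [Matrix.mul_assoc]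
        _ = _ := by
          simp only [Matrix.transpose_mul, Matrix.transpose_transpose, Matrix.mul_assoc]
          simp
  rw [nuclearNorm_eq_trace, ← hW, Matrix.trace_mul_comm, ← Matrix.mul_assoc, hV, Matrix.one_mul]

/-- A direction `U D Vᵀ` with `D` symmetric and supported in the `m × m` block, orthogonal to all
`X j`, would be one in which the objective is affine near the minimizer. This contradicts
uniqueness unless `D = 0`. -/
theorem eq_zero_of_symmetric_of_mInner_eq_zero {X : Fin n → Matrix (Fin p₁) (Fin p₂) ℝ}
    {y : Fin n → ℝ} {lam : ℝ} (hlam : 0 < lam) {Bhat Z : Matrix (Fin p₁) (Fin p₂) ℝ}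
    (hBhat : ∀ B, B ≠ Bhat →
      objective X y lam nuclearNorm Bhat < objective X y lam nuclearNorm B)
    {W T : Matrix (Fin p₂) (Fin p₂) ℝ}
    {U : Matrix (Fin p₁) (Fin p₁) ℝ} {V : Matrix (Fin p₂) (Fin p₂) ℝ} {m : ℕ} {σ g τ : ℕ → ℝ}
    (h : IsAdapted Bhat Z W T U V m σ g τ) {D : Matrix (Fin p₁) (Fin p₂) ℝ}
    (hD : ∀ k l : ℕ, natEntry D k l = natEntry D l k ∧ (m ≤ k ∨ m ≤ l → natEntry D k l = 0))
    (hX : ∀ j, mInner (X j) (U * D * Vᵀ) = 0) : D = 0 := by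
  -- Replacing `D` by `-D` if necessary, the nuclear norm does not increase in direction `D`.
  wlog htr : ∑ l : Fin p₂, natEntry D l l ≤ 0 generalizing D
  · have hn : ∀ k l, natEntry (-D) k l = -natEntry D k l := by
      intro k l
      unfold natEntry
      split_ifs <;> simp
    have := this (D := -D) (fun k l => by
        rw [hn, hn]
        exact ⟨by rw [(hD k l).1], fun h' => by rw [(hD k l).2 h', neg_zero]⟩)
      (fun j => by
        have h2 : U * -D * Vᵀ = (-1 : ℝ) • (U * D * Vᵀ) := by simp
        rw [h2, mInner_smul_right, hX, mul_zero])
      (by simp only [hn, Finset.sum_neg_distrib]; linarith)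
    exact neg_eq_zero.mp this
  set S : Matrix (Fin p₂) (Fin p₂) ℝ := Matrix.of fun k l => natEntry D k l with hS
  have hm1 := h.pair.le_left
  have hm2 := h.pair.le_right
  have hSm : ∀ i j : Fin p₂, m ≤ i.val ∨ m ≤ j.val → S i j = 0 := fun i j hij => (hD i j).2 hij
  have hev := eventually_posSemidef_diagonal_add_smul (k := p₂) h.pair.sigma_pos h.pair.sigma_zero
    (S := S) (by ext i j; exact (hD j i).1) hSm
  obtain ⟨t, hM, ht⟩ := (hev.and self_mem_nhdsWithin).exists
  have ht : (0 : ℝ) < t := ht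
  set M := Matrix.diagonal (fun l : Fin p₂ => σ l) + t • S with hMdef
  have hM0 : ∀ i j : Fin p₂, m ≤ i.val ∨ m ≤ j.val → M i j = 0 := by
    intro i j hij
    rw [hMdef, Matrix.add_apply, Matrix.smul_apply, hSm i j hij, Matrix.diagonal_apply]
    split_ifs with h1
    · subst h1
      rw [h.pair.sigma_zero i (by omega)]; simp
    · simp
  have hdiag0 : ∀ i j : Fin p₂, m ≤ i.val ∨ m ≤ j.val →
      Matrix.diagonal (fun l : Fin p₂ => σ l) i j = 0 := by
    intro i j hij
    rw [Matrix.diagonal_apply]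
    split_ifs with h1
    · subst h1
      rw [h.pair.sigma_zero i (by omega)]
    · rfl
  have hσnn : ∀ l : Fin p₂, 0 ≤ σ l := by
    intro l
    rcases lt_or_ge l.val m with h1 | h1
    · exact (h.pair.sigma_pos l h1).le
    · rw [h.pair.sigma_zero l h1]
  have hrect : ∀ (k : Fin p₁) (l : Fin p₂), rectDiag p₁ p₂ σ k l =
      natEntry (Matrix.diagonal fun l : Fin p₂ => σ l) k l := by
    intro k l
    rw [rectDiag, Matrix.of_apply]
    unfold natEntry
    split_ifs with h1 h2 h2
    · rw [Matrix.diagonal_apply, if_pos (Fin.ext h1)]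
    · omega
    · rw [Matrix.diagonal_apply, if_neg (fun h3 => h1 (congrArg Fin.val h3))]
    · rfl
  have n0 : nuclearNorm Bhat = (Matrix.diagonal fun l : Fin p₂ => σ l).trace := by
    rw [h.B_eq]
    exact nuclearNorm_eq_trace_of_posSemidef hm1 h.left_mul h.right_mul
      (Matrix.PosSemidef.diagonal hσnn) hdiag0 hrect
  have hBt : Bhat + t • (U * D * Vᵀ) = U * (rectDiag p₁ p₂ σ + t • D) * Vᵀ := by
    rw [Matrix.mul_add, Matrix.add_mul, ← h.B_eq, Matrix.mul_smul, Matrix.smul_mul]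
  have n1 : nuclearNorm (Bhat + t • (U * D * Vᵀ)) = M.trace := by
    rw [hBt]
    refine nuclearNorm_eq_trace_of_posSemidef hm1 h.left_mul h.right_mul hM hM0 fun k l => ?_
    rw [Matrix.add_apply, Matrix.smul_apply, hrect]
    by_cases hk : k.val < p₂
    · simp [natEntry, hk, hMdef, hS]
    · have := (hD k l).2 (Or.inl (by omega))
      rw [natEntry_val] at this
      rw [natEntry_of_le_left _ (not_lt.mp hk), natEntry_of_le_left _ (not_lt.mp hk), this]
      simp
  have hobj : objective X y lam nuclearNorm (Bhat + t • (U * D * Vᵀ)) ≤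
      objective X y lam nuclearNorm Bhat := by
    have htrace : M.trace ≤ (Matrix.diagonal fun l : Fin p₂ => σ l).trace := by
      rw [hMdef, Matrix.trace_add, Matrix.trace_smul, smul_eq_mul]
      have : S.trace ≤ 0 := htr
      nlinarith
    simp only [objective, mInner_add_right, mInner_smul_right, hX, mul_zero, add_zero]
    rw [n0, n1]
    have := mul_le_mul_of_nonneg_left htrace hlam.le
    linarith
  have hzero : t • (U * D * Vᵀ) = 0 := by
    by_contra hne
    exact absurd (hBhat (Bhat + t • (U * D * Vᵀ)) (by simpa using hne)) (not_lt.mpr hobj)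
  have h1 : U * D * Vᵀ = 0 := (smul_eq_zero.mp hzero).resolve_left ht.ne'
  calc D = (Uᵀ * U) * D * (Vᵀ * V) := by
        rw [h.left_mul, h.right_mul, Matrix.one_mul, Matrix.mul_one]
    _ = Uᵀ * (U * D * Vᵀ) * V := by simp only [Matrix.mul_assoc]
    _ = 0 := by rw [h1]; simp

theorem gramE_mulVec (X : Fin n → Matrix (Fin p₁) (Fin p₂) ℝ) (lam : ℝ)
    (U : Matrix (Fin p₁) (Fin p₁) ℝ) (V : Matrix (Fin p₂) (Fin p₂) ℝ) (σ g : ℕ → ℝ) (m : ℕ)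
    (v : EIdx p₁ p₂ m → ℝ) :
    gramE X lam U V σ g m *ᵥ v =
      (designE X U V m)ᵀ *ᵥ (designE X U V m *ᵥ v) + lam • (gMatrix p₁ p₂ m σ g *ᵥ v) := by
  rw [gramE, Matrix.add_mulVec, Matrix.smul_mulVec, Matrix.mulVec_mulVec]

/-- The quadratic form of the Gram matrix is a sum of two nonnegative terms. Where both vanish, the
uniqueness of the minimizer applies. -/
theorem isUnit_det_gramE {X : Fin n → Matrix (Fin p₁) (Fin p₂) ℝ}
    {y : Fin n → ℝ} {lam : ℝ} (hlam : 0 < lam) {Bhat Z : Matrix (Fin p₁) (Fin p₂) ℝ}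
    (hBhat : ∀ B, B ≠ Bhat →
      objective X y lam nuclearNorm Bhat < objective X y lam nuclearNorm B)
    {W T : Matrix (Fin p₂) (Fin p₂) ℝ}
    {U : Matrix (Fin p₁) (Fin p₁) ℝ} {V : Matrix (Fin p₂) (Fin p₂) ℝ} {m : ℕ} {σ g τ : ℕ → ℝ}
    (h : IsAdapted Bhat Z W T U V m σ g τ) :
    IsUnit (gramE X lam U V σ g m).det := by
  rw [← Matrix.isUnit_iff_isUnit_det, ← Matrix.mulVec_injective_iff_isUnit]
  refine (injective_iff_map_eq_zero
    (Matrix.mulVecLin (gramE X lam U V σ g m))).mpr fun v hv => ?_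
  rw [Matrix.mulVecLin_apply, gramE_mulVec] at hv
  have hD0 : ∀ k l, m ≤ k.val → m ≤ l.val → onE m v k l = 0 := fun k l => onE_eq_zero v
  have hvD : v = fun kl => onE m v kl.1.1 kl.1.2 := funext fun kl => (onE_apply v kl).symm
  set D := onE m v with hD
  have h1 := congrArg (fun w => w ⬝ᵥ v) hv
  simp only [add_dotProduct, smul_dotProduct, zero_dotProduct] at h1
  rw [Matrix.mulVec_transpose, ← Matrix.dotProduct_mulVec] at h1
  obtain ⟨h2, h3⟩ := gMatrix_quadraticForm h.pair hD0
  rw [← hvD] at h2 h3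
  have h4 : 0 ≤ (designE X U V m *ᵥ v) ⬝ᵥ (designE X U V m *ᵥ v) :=
    Finset.sum_nonneg fun i _ => mul_self_nonneg _
  rw [smul_eq_mul] at h1
  have h5 : 0 ≤ lam * ((gMatrix p₁ p₂ m σ g *ᵥ v) ⬝ᵥ v) := by positivity
  have h6 : (designE X U V m *ᵥ v) ⬝ᵥ (designE X U V m *ᵥ v) = 0 := by linarith
  have h7 : (gMatrix p₁ p₂ m σ g *ᵥ v) ⬝ᵥ v = 0 := by
    have : lam * ((gMatrix p₁ p₂ m σ g *ᵥ v) ⬝ᵥ v) = 0 := by linarith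
    exact (mul_eq_zero.mp this).resolve_left hlam.ne'
  have h8 := dotProduct_self_eq_zero.mp h6
  have hDz : D = 0 := by
    refine eq_zero_of_symmetric_of_mInner_eq_zero hlam hBhat h (h3 h7) fun j => ?_
    rw [← designE_mulVec X U V hD0, ← hvD, h8]
    rfl
  rw [hvD, hDz]
  rfl

/-! ### Solutions of the limit equations -/

theorem IsLinearized.smul {W T K J : Matrix (Fin p₂) (Fin p₂) ℝ}
    {B Z D Y : Matrix (Fin p₁) (Fin p₂) ℝ} (h : IsLinearized W T B Z D Y K J) (s : ℝ) :
    IsLinearized W T B Z (s • D) (s • Y) (s • K) (s • J) := by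
  constructor
  · rw [Matrix.smul_mul, Matrix.mul_smul, ← smul_add, ← h.dB_eq]
  · rw [Matrix.smul_mul, Matrix.mul_smul, ← smul_add, h.dW_eq, Matrix.transpose_smul,
      Matrix.smul_mul, Matrix.mul_smul, ← smul_add]
  · rw [Matrix.smul_mul, Matrix.mul_smul, h.dT_mul, smul_neg]
  · rw [Matrix.smul_mul, Matrix.mul_smul, h.mul_dT, smul_neg]
  · rw [Matrix.smul_mul, Matrix.mul_smul, ← smul_add, h.dT_eq, Matrix.transpose_smul,
      Matrix.smul_mul, Matrix.mul_smul, ← smul_add, smul_neg]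

theorem IsLinearized.of_tendsto {ι : Type*} {f : Filter ι} [f.NeBot]
    {W T K J : ι → Matrix (Fin p₂) (Fin p₂) ℝ} {B Z D Y : ι → Matrix (Fin p₁) (Fin p₂) ℝ}
    {W' T' K' J' : Matrix (Fin p₂) (Fin p₂) ℝ} {B' Z' D' Y' : Matrix (Fin p₁) (Fin p₂) ℝ}
    (h : ∀ᶠ x in f, IsLinearized (W x) (T x) (B x) (Z x) (D x) (Y x) (K x) (J x))
    (hW : Tendsto W f (𝓝 W')) (hT : Tendsto T f (𝓝 T')) (hB : Tendsto B f (𝓝 B'))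
    (hZ : Tendsto Z f (𝓝 Z')) (hD : Tendsto D f (𝓝 D')) (hY : Tendsto Y f (𝓝 Y'))
    (hK : Tendsto K f (𝓝 K')) (hJ : Tendsto J f (𝓝 J')) :
    IsLinearized W' T' B' Z' D' Y' K' J' := by
  have mul {a b c : ℕ} {F : ι → Matrix (Fin a) (Fin b) ℝ} {G : ι → Matrix (Fin b) (Fin c) ℝ}
    {A : Matrix (Fin a) (Fin b) ℝ} {B : Matrix (Fin b) (Fin c) ℝ} (hF : Tendsto F f (𝓝 A))
    (hG : Tendsto G f (𝓝 B)) := tendsto_matrix_mul hF hG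
  have tr {a b : ℕ} {F : ι → Matrix (Fin a) (Fin b) ℝ} {A : Matrix (Fin a) (Fin b) ℝ}
    (hF : Tendsto F f (𝓝 A)) := tendsto_matrix_transpose hF
  constructor
  · exact tendsto_nhds_unique (hD.congr' (h.mono fun x hx => hx.dB_eq))
      ((mul hY hW).add (mul hZ hK))
  · exact tendsto_nhds_unique (((mul hK hW).add (mul hW hK)).congr' (h.mono fun x hx => hx.dW_eq))
      ((mul (tr hD) hB).add (mul (tr hB) hD))
  · exact tendsto_nhds_unique ((mul hJ hW).congr' (h.mono fun x hx => hx.dT_mul)) (mul hT hK).neg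
  · exact tendsto_nhds_unique ((mul hW hJ).congr' (h.mono fun x hx => hx.mul_dT)) (mul hK hT).neg
  · exact tendsto_nhds_unique (((mul hT hJ).add (mul hJ hT)).congr' (h.mono fun x hx => hx.dT_eq))
      ((mul (tr hY) hZ).add (mul (tr hZ) hY)).neg

theorem IsLinearized.conj {W T K J : Matrix (Fin p₂) (Fin p₂) ℝ}
    {B Z D Y : Matrix (Fin p₁) (Fin p₂) ℝ} (h : IsLinearized W T B Z D Y K J)
    {U : Matrix (Fin p₁) (Fin p₁) ℝ} {V : Matrix (Fin p₂) (Fin p₂) ℝ} (hU : U * Uᵀ = 1)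
    (hV : V * Vᵀ = 1) :
    IsLinearized (Vᵀ * W * V) (Vᵀ * T * V) (Uᵀ * B * V) (Uᵀ * Z * V) (Uᵀ * D * V) (Uᵀ * Y * V)
      (Vᵀ * K * V) (Vᵀ * J * V) := by
  have hm {a : ℕ} (A : Matrix (Fin a) (Fin p₂) ℝ) (C : Matrix (Fin p₂) (Fin p₂) ℝ)
      (U : Matrix (Fin a) (Fin a) ℝ) : Uᵀ * A * V * (Vᵀ * C * V) = Uᵀ * (A * C) * V := by
    calc _ = Uᵀ * A * (V * Vᵀ) * C * V := by simp only [Matrix.mul_assoc]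
      _ = _ := by rw [hV, Matrix.mul_one]; simp only [Matrix.mul_assoc]
  have ht (A C : Matrix (Fin p₁) (Fin p₂) ℝ) :
      (Uᵀ * A * V)ᵀ * (Uᵀ * C * V) = Vᵀ * (Aᵀ * C) * V := by
    rw [Matrix.transpose_mul, Matrix.transpose_mul, Matrix.transpose_transpose]
    calc _ = Vᵀ * Aᵀ * (U * Uᵀ) * C * V := by simp only [Matrix.mul_assoc]
      _ = _ := by rw [hU, Matrix.mul_one]; simp only [Matrix.mul_assoc]
  constructor
  · rw [hm, hm, ← Matrix.add_mul, ← Matrix.mul_add, ← h.dB_eq]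
  · rw [hm, hm, ht, ht, ← Matrix.add_mul, ← Matrix.mul_add, ← Matrix.add_mul, ← Matrix.mul_add,
      h.dW_eq]
  · rw [hm, hm, h.dT_mul, Matrix.mul_neg, Matrix.neg_mul]
  · rw [hm, hm, h.mul_dT, Matrix.mul_neg, Matrix.neg_mul]
  · rw [hm, hm, ht, ht, ← Matrix.add_mul, ← Matrix.mul_add, ← Matrix.add_mul, ← Matrix.mul_add,
      h.dT_eq, Matrix.mul_neg, Matrix.neg_mul]

/-- The sum of the absolute values of the entries. -/
def absSum {a b : ℕ} (A : Matrix (Fin a) (Fin b) ℝ) : ℝ := ∑ k, ∑ l, |A k l|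

theorem absSum_nonneg {a b : ℕ} (A : Matrix (Fin a) (Fin b) ℝ) : 0 ≤ absSum A :=
  Finset.sum_nonneg fun _ _ => Finset.sum_nonneg fun _ _ => abs_nonneg _

theorem abs_apply_le_absSum {a b : ℕ} (A : Matrix (Fin a) (Fin b) ℝ) (k : Fin a) (l : Fin b) :
    |A k l| ≤ absSum A :=
  (Finset.single_le_sum (f := fun l => |A k l|) (fun _ _ => abs_nonneg _)
    (Finset.mem_univ l)).trans (Finset.single_le_sum (f := fun k => ∑ l, |A k l|)
    (fun _ _ => Finset.sum_nonneg fun _ _ => abs_nonneg _) (Finset.mem_univ k))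

theorem absSum_smul {a b : ℕ} (A : Matrix (Fin a) (Fin b) ℝ) {s : ℝ} (hs : 0 ≤ s) :
    absSum (s • A) = s * absSum A := by
  simp [absSum, abs_mul, abs_of_nonneg hs, Finset.mul_sum]

theorem continuous_absSum {a b : ℕ} : Continuous (absSum : Matrix (Fin a) (Fin b) ℝ → ℝ) := by
  unfold absSum
  fun_prop

theorem hatMatrix_apply_self (X : Fin n → Matrix (Fin p₁) (Fin p₂) ℝ) (lam : ℝ)
    (U : Matrix (Fin p₁) (Fin p₁) ℝ) (V : Matrix (Fin p₂) (Fin p₂) ℝ) (σ g : ℕ → ℝ) (m : ℕ)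
    (i : Fin n) : hatMatrix X lam U V σ g m i i =
      designE X U V m i ⬝ᵥ ((gramE X lam U V σ g m)⁻¹ *ᵥ designE X U V m i) := by
  rw [hatMatrix, Matrix.mul_assoc, Matrix.mul_apply]
  rfl

/-- The limit of the leave-one-out equations with right-hand side `s X_i`. In the coordinates `U`,
`V` they say `(𝒳_Eᵀ 𝒳_E + lam 𝒢) v = (s + a) x_i` for `a = ⟨X_i, D⟩`, so that `a = (s + a) H_ii`.
The homogeneous equations, `s = 0`, have only the trivial solution. -/
theorem IsAdapted.limit_solution {X : Fin n → Matrix (Fin p₁) (Fin p₂) ℝ} {lam : ℝ}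
    (hlam : 0 < lam) {Bhat Z : Matrix (Fin p₁) (Fin p₂) ℝ} {W T : Matrix (Fin p₂) (Fin p₂) ℝ}
    {U : Matrix (Fin p₁) (Fin p₁) ℝ} {V : Matrix (Fin p₂) (Fin p₂) ℝ} {m : ℕ} {σ g τ : ℕ → ℝ}
    (h : IsAdapted Bhat Z W T U V m σ g τ) (hG : IsUnit (gramE X lam U V σ g m).det)
    {i : Fin n} (hH : hatMatrix X lam U V σ g m i i ≠ 1)
    {D Y : Matrix (Fin p₁) (Fin p₂) ℝ} {K J : Matrix (Fin p₂) (Fin p₂) ℝ}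
    (hL : IsLinearized W T Bhat Z D Y K J) {s : ℝ}
    (heq : ∑ j ∈ Finset.univ.erase i, mInner (X j) D • X j + lam • Y = s • X i) :
    mInner (X i) D * (1 - hatMatrix X lam U V σ g m i i) = s * hatMatrix X lam U V σ g m i i ∧
      (s = 0 → D = 0 ∧ Y = 0 ∧ K = 0 ∧ J = 0) := by
  have hUt : U * Uᵀ = 1 := mul_eq_one_comm.mp h.left_mul
  have hVt : V * Vᵀ = 1 := mul_eq_one_comm.mp h.right_mul
  have hL' := hL.conj hUt hVt
  have hback {a b : ℕ} {P : Matrix (Fin a) (Fin a) ℝ} {Q : Matrix (Fin b) (Fin b) ℝ}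
      (hP : Pᵀ * P = 1) (hQ : Qᵀ * Q = 1) {A C : Matrix (Fin a) (Fin b) ℝ}
      (hA : A = P * C * Qᵀ) : Pᵀ * A * Q = C := by
    calc _ = (Pᵀ * P) * C * (Qᵀ * Q) := by rw [hA]; simp only [Matrix.mul_assoc]
      _ = C := by rw [hP, hQ, Matrix.one_mul, Matrix.mul_one]
  have hforw {a b : ℕ} {P : Matrix (Fin a) (Fin a) ℝ} {Q : Matrix (Fin b) (Fin b) ℝ}
      (hP : P * Pᵀ = 1) (hQ : Q * Qᵀ = 1) (A : Matrix (Fin a) (Fin b) ℝ) :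
      P * (Pᵀ * A * Q) * Qᵀ = A := by
    calc _ = (P * Pᵀ) * A * (Q * Qᵀ) := by simp only [Matrix.mul_assoc]
      _ = A := by rw [hP, hQ, Matrix.one_mul, Matrix.mul_one]
  rw [hback h.right_mul h.right_mul h.W_eq, hback h.right_mul h.right_mul h.T_eq,
    hback h.left_mul h.right_mul h.B_eq, hback h.left_mul h.right_mul h.Z_eq] at hL'
  obtain ⟨hd0, hy, hz⟩ := h.pair.solve hL'
  have hDd := hforw hUt hVt D
  set d := Uᵀ * D * V with hd
  set v : EIdx p₁ p₂ m → ℝ := fun kl => d kl.1.1 kl.1.2 with hv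
  set a := mInner (X i) D with ha
  set x : EIdx p₁ p₂ m → ℝ := designE X U V m i with hx
  set H := hatMatrix X lam U V σ g m i i with hHdef
  have hdes : ∀ j, (designE X U V m *ᵥ v) j = mInner (X j) D := by
    intro j
    rw [hv, designE_mulVec X U V hd0, hDd]
  have hfull : ∑ j, mInner (X j) D • X j + lam • Y = (s + a) • X i := by
    rw [← Finset.add_sum_erase _ _ (Finset.mem_univ i), add_assoc, heq, add_smul, add_comm]
  have hgram : gramE X lam U V σ g m *ᵥ v = (s + a) • x := by
    rw [gramE_mulVec]
    funext kl
    have h1 := congrArg (fun A => (Uᵀ * A * V) kl.1.1 kl.1.2) hfull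
    simp only [Matrix.mul_add, Matrix.add_mul, Matrix.mul_smul, Matrix.smul_mul, Matrix.mul_sum,
      Matrix.sum_mul, Matrix.add_apply, Matrix.smul_apply, Matrix.sum_apply, smul_eq_mul] at h1
    rw [hy _ _ kl.2, ← gMatrix_mulVec] at h1
    rw [Pi.add_apply, Pi.smul_apply, Pi.smul_apply, smul_eq_mul, smul_eq_mul]
    refine Eq.trans ?_ h1
    congr 1
    rw [Matrix.mulVec, dotProduct]
    refine Finset.sum_congr rfl fun j _ => ?_
    rw [hdes, mul_comm]
    rfl
  have hvsol : v = (s + a) • ((gramE X lam U V σ g m)⁻¹ *ᵥ x) := by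
    rw [← Matrix.mulVec_smul, ← hgram, Matrix.mulVec_mulVec, Matrix.nonsing_inv_mul _ hG,
      Matrix.one_mulVec]
  have haH : a = (s + a) * H := by
    have h1 : a = x ⬝ᵥ v := (hdes i).symm
    have h2 : x ⬝ᵥ v = (s + a) * H := by
      rw [hvsol, dotProduct_smul, smul_eq_mul, hHdef, hatMatrix_apply_self]
    exact h1.trans h2
  refine ⟨by linarith, fun hs => ?_⟩
  have ha0 : a = 0 := by
    rw [hs, zero_add] at haH
    have h1 : a * (1 - H) = 0 := by linarith
    exact (mul_eq_zero.mp h1).resolve_right (sub_ne_zero.mpr hH.symm)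
  have hv0 : v = 0 := by rw [hvsol, hs, ha0]; simp
  have hdz : d = 0 := by
    ext k l
    by_cases hkl : k.val < m ∨ l.val < m
    · exact congrFun hv0 ⟨(k, l), hkl⟩
    · simp only [not_or, not_lt] at hkl
      exact hd0 k l hkl.1 hkl.2
  have hDz : D = 0 := by rw [← hDd, hdz]; simp
  have hYz : Y = 0 := by
    rw [hDz, hs, ha0] at hfull
    have hm0 : ∀ j, mInner (X j) 0 = 0 := fun j => by simp [mInner]
    simp only [hm0, zero_smul, Finset.sum_const_zero, zero_add] at hfull
    exact (smul_eq_zero.mp hfull).resolve_left hlam.ne'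
  obtain ⟨hk, hj⟩ := hz hdz (by rw [hYz]; simp)
  refine ⟨hDz, hYz, ?_, ?_⟩
  · rw [← hforw hVt hVt K, hk]; simp
  · rw [← hforw hVt hVt J, hj]; simp

theorem card_eidx {m : ℕ} (h1 : m ≤ p₁) (h2 : m ≤ p₂) :
    Fintype.card (EIdx p₁ p₂ m) = m * p₁ + m * p₂ - m ^ 2 := by
  have hc : ∀ p, m ≤ p → (Finset.univ.filter fun k : Fin p => ¬ k.val < m).card = p - m := by
    intro p hp
    have h3 := Finset.card_filter_add_card_filter_not (s := (Finset.univ : Finset (Fin p)))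
      (fun k : Fin p => k.val < m)
    have h4 : (Finset.univ.filter fun k : Fin p => k.val < m).card = m := by
      rw [Fin.card_filter_val_lt]
      omega
    rw [Finset.card_univ, Fintype.card_fin] at h3
    omega
  have h3 := Finset.card_filter_add_card_filter_not
    (s := (Finset.univ : Finset (Fin p₁ × Fin p₂))) (fun kl => kl.1.val < m ∨ kl.2.val < m)
  have h4 : (Finset.univ.filter fun kl : Fin p₁ × Fin p₂ => ¬ (kl.1.val < m ∨ kl.2.val < m)) =
      (Finset.univ.filter fun k : Fin p₁ => ¬ k.val < m) ×ˢ
        (Finset.univ.filter fun l : Fin p₂ => ¬ l.val < m) := by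
    ext kl
    simp [not_or]
  rw [h4, Finset.card_product, hc p₁ h1, hc p₂ h2, Finset.card_univ, Fintype.card_prod,
    Fintype.card_fin, Fintype.card_fin] at h3
  rw [Fintype.card_subtype]
  obtain ⟨a, rfl⟩ := Nat.exists_eq_add_of_le h1
  obtain ⟨b, rfl⟩ := Nat.exists_eq_add_of_le h2
  rw [Nat.add_sub_cancel_left, Nat.add_sub_cancel_left] at h3
  have h5 : m * (m + a) + m * (m + b) = (m * m + m * a + m * b) + m ^ 2 := by ring
  rw [h5, Nat.add_sub_cancel]
  have h6 : (m + a) * (m + b) = (m * m + m * a + m * b) + a * b := by ring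
  omega

/-! ### Convergence of the leave-one-out predictions -/

/-- The approximate leave-one-out prediction in terms of the solution `D` of the linearized
leave-one-out equations with right-hand side `X_i`. -/
theorem exists_solution_looHessian (X : Fin n → Matrix (Fin p₁) (Fin p₂) ℝ) (y : Fin n → ℝ)
    {lam : ℝ} (hlam : 0 < lam) {ε : ℝ} (hε : 0 < ε) (i : Fin n)
    (B : Matrix (Fin p₁) (Fin p₂) ℝ) :
    ∃ D Y K J, IsLinearized (modulus ε B) (ε • (modulus ε B)⁻¹) B (smoothGrad ε B) D Y K J ∧
      ∑ j ∈ Finset.univ.erase i, mInner (X j) D • X j + lam • Y = X i ∧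
      mInner (X i) (aloEstimate X y lam (smoothNuclear ε) i B) =
        mInner (X i) B + mInner (X i) D * (mInner (X i) B - y i) := by
  have hdet := isUnit_det_looHessian X hlam hε i B
  set M := looHessian X lam (smoothNuclear ε) i B with hM
  let D : Matrix (Fin p₁) (Fin p₂) ℝ := Matrix.of fun k l => (vec (X i) ᵥ* M⁻¹) (k, l)
  have hD : vec D = vec (X i) ᵥ* M⁻¹ := rfl
  obtain ⟨Y, K, J, hL, hY, -, -⟩ := exists_isLinearized hε B D
  refine ⟨D, Y, K, J, hL, ?_, ?_⟩
  · have h1 : vec (∑ j ∈ Finset.univ.erase i, mInner (X j) D • X j + lam • Y) = vec (X i) := by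
      rw [← looHessian_transpose_mulVec X lam _ i B D Y hY, ← hM, Matrix.mulVec_transpose, hD,
        Matrix.vecMul_vecMul, Matrix.nonsing_inv_mul _ hdet, Matrix.vecMul_one]
    ext k l
    exact congrFun h1 (k, l)
  · have h1 : vec (aloEstimate X y lam (smoothNuclear ε) i B) =
        vec B + M⁻¹ *ᵥ ((mInner (X i) B - y i) • vec (X i)) := rfl
    rw [← vec_dotProduct_vec, h1, dotProduct_add, vec_dotProduct_vec, Matrix.mulVec_smul,
      dotProduct_smul, Matrix.dotProduct_mulVec, ← hD, vec_dotProduct_vec, smul_eq_mul,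
      mInner_comm D, mul_comm]

/-- The solutions of the leave-one-out equations satisfy `⟨X_i, D⟩ → H_ii / (1 - H_ii)`. -/
theorem tendsto_mInner_solution {X : Fin n → Matrix (Fin p₁) (Fin p₂) ℝ} {lam : ℝ}
    (hlam : 0 < lam) {Bhat Z : Matrix (Fin p₁) (Fin p₂) ℝ} {W T : Matrix (Fin p₂) (Fin p₂) ℝ}
    {U : Matrix (Fin p₁) (Fin p₁) ℝ} {V : Matrix (Fin p₂) (Fin p₂) ℝ} {m : ℕ} {σ g τ : ℕ → ℝ}
    (h : IsAdapted Bhat Z W T U V m σ g τ) (hG : IsUnit (gramE X lam U V σ g m).det)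
    {i : Fin n} (hH : hatMatrix X lam U V σ g m i i ≠ 1) {ι : Type*} {f : Filter ι}
    {We Te K J : ι → Matrix (Fin p₂) (Fin p₂) ℝ} {Be Ze D Y : ι → Matrix (Fin p₁) (Fin p₂) ℝ}
    (hW : Tendsto We f (𝓝 W)) (hT : Tendsto Te f (𝓝 T)) (hB : Tendsto Be f (𝓝 Bhat))
    (hZ : Tendsto Ze f (𝓝 Z))
    (hL : ∀ᶠ e in f, IsLinearized (We e) (Te e) (Be e) (Ze e) (D e) (Y e) (K e) (J e))
    (heq : ∀ᶠ e in f,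
      ∑ j ∈ Finset.univ.erase i, mInner (X j) (D e) • X j + lam • Y e = X i) :
    Tendsto (fun e => mInner (X i) (D e)) f
      (𝓝 (hatMatrix X lam U V σ g m i i / (1 - hatMatrix X lam U V σ g m i i))) := by
  rw [tendsto_iff_ultrafilter]
  intro u hu
  -- The solutions are not known to be bounded, so they are scaled to lie in a compact set; `s' = 0`
  -- would mean that they are unbounded along the ultrafilter.
  set s : ι → ℝ := fun e =>
    (1 + absSum (D e) + absSum (Y e) + absSum (K e) + absSum (J e))⁻¹ with hs
  have hc : ∀ e, 0 < 1 + absSum (D e) + absSum (Y e) + absSum (K e) + absSum (J e) := by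
    intro e
    have := absSum_nonneg (D e)
    have := absSum_nonneg (Y e)
    have := absSum_nonneg (K e)
    have := absSum_nonneg (J e)
    positivity
  have hs0 : ∀ e, 0 < s e := fun e => inv_pos.mpr (hc e)
  have hsum : ∀ e, s e = 1 - absSum (s e • D e) - absSum (s e • Y e) - absSum (s e • K e) -
      absSum (s e • J e) := by
    intro e
    rw [absSum_smul _ (hs0 e).le, absSum_smul _ (hs0 e).le, absSum_smul _ (hs0 e).le,
      absSum_smul _ (hs0 e).le]
    have h1 : s e * (1 + absSum (D e) + absSum (Y e) + absSum (K e) + absSum (J e)) = 1 :=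
      inv_mul_cancel₀ (hc e).ne'
    linarith
  have hb : ∀ e, absSum (s e • D e) ≤ 1 ∧ absSum (s e • Y e) ≤ 1 ∧ absSum (s e • K e) ≤ 1 ∧
      absSum (s e • J e) ≤ 1 := by
    intro e
    have := absSum_nonneg (s e • D e)
    have := absSum_nonneg (s e • Y e)
    have := absSum_nonneg (s e • K e)
    have := absSum_nonneg (s e • J e)
    have := hs0 e
    have := hsum e
    refine ⟨?_, ?_, ?_, ?_⟩ <;> linarith
  obtain ⟨D', hD'⟩ := exists_tendsto_of_abs_apply_le u (F := fun e => s e • D e) 1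
    (Eventually.of_forall fun e k l => (abs_apply_le_absSum _ k l).trans (hb e).1)
  obtain ⟨Y', hY'⟩ := exists_tendsto_of_abs_apply_le u (F := fun e => s e • Y e) 1
    (Eventually.of_forall fun e k l => (abs_apply_le_absSum _ k l).trans (hb e).2.1)
  obtain ⟨K', hK'⟩ := exists_tendsto_of_abs_apply_le u (F := fun e => s e • K e) 1
    (Eventually.of_forall fun e k l => (abs_apply_le_absSum _ k l).trans (hb e).2.2.1)
  obtain ⟨J', hJ'⟩ := exists_tendsto_of_abs_apply_le u (F := fun e => s e • J e) 1
    (Eventually.of_forall fun e k l => (abs_apply_le_absSum _ k l).trans (hb e).2.2.2)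
  have hN {a b : ℕ} {F : ι → Matrix (Fin a) (Fin b) ℝ} {A : Matrix (Fin a) (Fin b) ℝ}
      (hF : Tendsto F u (𝓝 A)) : Tendsto (fun e => absSum (F e)) u (𝓝 (absSum A)) :=
    Tendsto.comp (g := absSum) (continuous_absSum.tendsto A) hF
  set s' := 1 - absSum D' - absSum Y' - absSum K' - absSum J' with hs'
  have hslim : Tendsto s u (𝓝 s') := by
    have h1 := ((((tendsto_const_nhds (x := (1 : ℝ))).sub (hN hD')).sub (hN hY')).sub
      (hN hK')).sub (hN hJ')
    exact h1.congr fun e => (hsum e).symm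
  have hL' : IsLinearized W T Bhat Z D' Y' K' J' :=
    IsLinearized.of_tendsto (f := (u : Filter ι))
      ((Filter.Eventually.filter_mono hu hL).mono fun e he => he.smul (s e))
      (hW.mono_left hu) (hT.mono_left hu) (hB.mono_left hu) (hZ.mono_left hu) hD' hY' hK' hJ'
  have hin : ∀ j, Tendsto (fun e => mInner (X j) (s e • D e)) u (𝓝 (mInner (X j) D')) := fun j =>
    Tendsto.comp (g := mInner (X j)) ((continuous_mInner (X j)).tendsto D') hD'
  have heq' : ∑ j ∈ Finset.univ.erase i, mInner (X j) D' • X j + lam • Y' = s' • X i := by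
    have h1 : Tendsto (fun e => ∑ j ∈ Finset.univ.erase i, mInner (X j) (s e • D e) • X j +
        lam • (s e • Y e)) u
        (𝓝 (∑ j ∈ Finset.univ.erase i, mInner (X j) D' • X j + lam • Y')) :=
      (tendsto_finsetSum _ fun j _ => (hin j).smul_const (X j)).add (hY'.const_smul lam)
    refine tendsto_nhds_unique h1 ((hslim.smul_const (X i)).congr' ?_)
    filter_upwards [hu heq] with e he
    rw [← he, smul_add, Finset.smul_sum, smul_comm lam]
    simp only [mInner_smul_right, mul_smul]
  obtain ⟨h1, h2⟩ := h.limit_solution hlam hG hH hL' heq'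
  have hs'0 : s' ≠ 0 := by
    intro h0
    -- All four limits vanish, and then `s' = 1`.
    obtain ⟨rfl, rfl, rfl, rfl⟩ := h2 h0
    simp [hs', absSum] at h0
  have h3 : Tendsto (fun e => mInner (X i) (s e • D e) / s e) u (𝓝 (mInner (X i) D' / s')) :=
    (hin i).div hslim hs'0
  have h4 : mInner (X i) D' / s' =
      hatMatrix X lam U V σ g m i i / (1 - hatMatrix X lam U V σ g m i i) := by
    rw [div_eq_div_iff hs'0 (sub_ne_zero.mpr hH.symm), h1, mul_comm]
  rw [h4] at h3
  refine h3.congr fun e => ?_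
  rw [mInner_smul_right, mul_div_assoc, mul_comm, div_mul_cancel₀ _ (hs0 e).ne']

end NuclearALO

end

open NuclearALO

theorem theorem6 {n p₁ p₂ : ℕ} (X : Fin n → Matrix (Fin p₁) (Fin p₂) ℝ) (y : Fin n → ℝ)
    (lam : ℝ) (hlam : 0 < lam) (Bhat : Matrix (Fin p₁) (Fin p₂) ℝ)
    (hBhat : ∀ B, B ≠ Bhat →
      objective X y lam nuclearNorm Bhat < objective X y lam nuclearNorm B) :
    (∃ U V σ g, IsOptimalSVD X y lam Bhat U V σ g) ∧
    (∀ ε : ℝ, 0 < ε → ∃ B, IsMinOn (objective X y lam (smoothNuclear ε)) Set.univ B) ∧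
    ∀ (U : Matrix (Fin p₁) (Fin p₁) ℝ) (V : Matrix (Fin p₂) (Fin p₂) ℝ) (σ g : ℕ → ℝ),
      IsOptimalSVD X y lam Bhat U V σ g →
      (∀ j < min p₁ p₂, σ j = 0 → g j < 1) →
      Fintype.card (EIdx p₁ p₂ Bhat.rank) =
        Bhat.rank * p₁ + Bhat.rank * p₂ - Bhat.rank ^ 2 ∧
      IsUnit (gramE X lam U V σ g Bhat.rank).det ∧
      ∀ Bε : ℝ → Matrix (Fin p₁) (Fin p₂) ℝ,
        (∀ ε : ℝ, 0 < ε → IsMinOn (objective X y lam (smoothNuclear ε)) Set.univ (Bε ε)) →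
        ∀ i : Fin n,
          (∀ ε : ℝ, 0 < ε → IsUnit (looHessian X lam (smoothNuclear ε) i (Bε ε)).det) ∧
          (hatMatrix X lam U V σ g Bhat.rank i i ≠ 1 →
            Tendsto
              (fun ε : ℝ => mInner (X i) (aloEstimate X y lam (smoothNuclear ε) i (Bε ε)))
              (𝓝[>] 0)
              (𝓝 (mInner (X i) Bhat +
                hatMatrix X lam U V σ g Bhat.rank i i /
                  (1 - hatMatrix X lam U V σ g Bhat.rank i i) *
                  (mInner (X i) Bhat - y i)))) := by
  have hmin : ∀ ε : ℝ, 0 < ε → ∃ B, IsMinOn (objective X y lam (smoothNuclear ε)) Set.univ B :=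
    fun ε hε => exists_isMinOn_objective X y hlam hε.le
  have hex : ∀ ε : ℝ, ∃ B, 0 < ε → IsMinOn (objective X y lam (smoothNuclear ε)) Set.univ B := by
    intro ε
    by_cases hε : 0 < ε
    · exact (hmin ε hε).imp fun B hB _ => hB
    · exact ⟨0, fun h => absurd h hε⟩
  choose B₀ hB₀ using hex
  obtain ⟨-, -, hZW, T, hT, -, hZZ, hWT, hTW⟩ := tendsto_modulus_of_isMinOn hlam hBhat hB₀
  refine ⟨?_, hmin, ?_⟩
  · obtain ⟨U, V, σ, g, h1, h2, h3⟩ := exists_simultaneous_svd (modulus_posSemidef 0 Bhat) hT hWT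
      hTW hZZ hZW
    exact ⟨U, V, σ, g, h1, h2, h3⟩
  intro U V σ g hsvd hg
  obtain ⟨σ', g', τ, hA, hgM⟩ := exists_isAdapted hsvd.svd hsvd.nonzero_first hsvd.svd_dual hg hT
    hZZ hWT
  have hgram : gramE X lam U V σ g Bhat.rank = gramE X lam U V σ' g' Bhat.rank := by
    rw [gramE, gramE, hgM]
  have hhat : hatMatrix X lam U V σ g Bhat.rank = hatMatrix X lam U V σ' g' Bhat.rank := by
    rw [hatMatrix, hatMatrix, hgram]
  have hG := isUnit_det_gramE hlam hBhat hA
  refine ⟨card_eidx (Matrix.rank_le_height Bhat) (Matrix.rank_le_width Bhat), hgram ▸ hG, ?_⟩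
  intro Bε hBε i
  refine ⟨fun ε hε => isUnit_det_looHessian X hlam hε i (Bε ε), fun hH => ?_⟩
  rw [hhat] at hH ⊢
  have hB := tendsto_of_isMinOn_objective hlam hBhat hBε
  obtain ⟨hW, hZ, -, T', hT', hTlim, hZZ', -, -⟩ := tendsto_modulus_of_isMinOn hlam hBhat hBε
  have hTT' : T' = T := posSemidef_eq_of_mul_self_eq hT' hT
    (sub_right_injective (hZZ'.symm.trans hZZ))
  rw [hTT'] at hTlim
  have hsol : ∀ ε : ℝ, ∃ D Y K J, 0 < ε →
      IsLinearized (modulus ε (Bε ε)) (ε • (modulus ε (Bε ε))⁻¹) (Bε ε) (smoothGrad ε (Bε ε))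
        D Y K J ∧
      ∑ j ∈ Finset.univ.erase i, mInner (X j) D • X j + lam • Y = X i ∧
      mInner (X i) (aloEstimate X y lam (smoothNuclear ε) i (Bε ε)) =
        mInner (X i) (Bε ε) + mInner (X i) D * (mInner (X i) (Bε ε) - y i) := by
    intro ε
    by_cases hε : 0 < ε
    · obtain ⟨D, Y, K, J, h⟩ := exists_solution_looHessian X y hlam hε i (Bε ε)
      exact ⟨D, Y, K, J, fun _ => h⟩
    · exact ⟨0, 0, 0, 0, fun h => absurd h hε⟩
  choose D Y K J hDYKJ using hsol
  have hpos : ∀ᶠ ε : ℝ in 𝓝[>] 0, 0 < ε := self_mem_nhdsWithin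
  have hlim := tendsto_mInner_solution hlam hA hG hH hW hTlim hB hZ
    (hpos.mono fun ε hε => (hDYKJ ε hε).1) (hpos.mono fun ε hε => (hDYKJ ε hε).2.1)
  have hXB : Tendsto (fun ε => mInner (X i) (Bε ε)) (𝓝[>] 0) (𝓝 (mInner (X i) Bhat)) :=
    Tendsto.comp (g := mInner (X i)) ((continuous_mInner (X i)).tendsto Bhat) hB
  refine (hXB.add (hlim.mul (hXB.sub_const (y i)))).congr' ?_
  filter_upwards [hpos] with ε hε
  exact (hDYKJ ε hε).2.2.symm
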